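/- Let $m\ge 1$. A permutation $w\in\mathfrak S_n$ is *alternating* if $w(1)>w(2)<w(3)>w(4)<\cdots$; it is *$321$-avoiding* if there are no $i<j<k$ with $w(i)>w(j)>w(k)$; and it is *fully supported* if every simple reflection $(i\ \,i+1)$, $1\le i<n$, appears in the reduced decompositions of $w$ (equivalently, $\{w(1),\ldots,w(r)\}\neq\{1,\ldots,r\}$ for all $1\le r<n$). For $v\in\mathfrak S_{2m-2}$ let $\phi(v)\in\mathfrak S_{2m}$ be given by $$\big(\phi(v)\big)(i)=\begin{cases} v(i)+1 & \text{if } i<2m-1 \text{ is odd},\\ v(i-2)+1 & \text{if } i>2 \text{ is even},\\ 1 & \text{if } i=2,\\ 2m & \text{if } i=2m-1.\end{cases}$$ *Elnitsky's polygon* $X(w)$ of a fully supported $w\in\mathfrak S_n$ is an equilateral $2n$-gon with sides labeled $1,\ldots,n,w(n),\ldots,w(1)$ in counterclockwise order starting from its top vertex, such that the first $n$ sides (the leftside boundary) form half of a convex, centrally symmetric $2n$-gon and sides with the same label are parallel; the sides labeled $w(1),\ldots,w(n)$ form the rightside boundary. A *rhombic tiling* of $X(w)$ is an edge-to-edge tiling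 by rhombi whose edges are congruent and parallel to sides of $X(w)$. A tile $t$ is a *forced right-perimeter tile* for $w$ if, in every rhombic tiling of $X(w)$, $t$ appears and shares two consecutive edges with the rightside boundary of $X(w)$. **Theorem.** The map $\phi$ restricts to a bijection from the set of $321$-avoiding alternating permutations in $\mathfrak S_{2m-2}$ to the set of fully supported $321$-avoiding alternating permutations in $\mathfrak S_{2m}$. Moreover, a fully supported $w\in\mathfrak S_{2m}$ has exactly $m$ forced right-perimeter tiles if and only if it is $321$-avoiding and alternating, and the number of fully supported $w\in\mathfrak S_{2m}$ with exactly $m$ forced right-perimeter tiles (equivalently, the number of fully supported $321$-avoiding alternating permutations in $\mathfrak S_{2m}$) is the Catalan number $C_{m-1}$. -/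

import Mathlib

namespace Elnitsky

/-! Permutations of `{1, …, n}` are modelled as `Equiv.Perm (Fin n)`; the position (or value) `i` of
the usual one-line notation is the element of `Fin n` with underlying number `i - 1`. -/

/-- A simple reflection of the symmetric group: the transposition of two adjacent numbers. -/
def IsSimpleReflection {n : ℕ} (s : Equiv.Perm (Fin n)) : Prop :=
  ∃ (i : ℕ) (h : i + 1 < n), s = Equiv.swap ⟨i, Nat.lt_of_succ_lt h⟩ ⟨i + 1, h⟩

/-- `L` is a reduced decomposition of `w`: a factorization of `w` into simple reflections that is
as short as possible. -/
def IsReducedDecomposition {n : ℕ} (w : Equiv.Perm (Fin n)) (L : List (Equiv.Perm (Fin n))) :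
    Prop :=
  (∀ s ∈ L, IsSimpleReflection s) ∧ L.prod = w ∧
    ∀ L' : List (Equiv.Perm (Fin n)),
      (∀ s ∈ L', IsSimpleReflection s) → L'.prod = w → L.length ≤ L'.length

/-- All simple reflections appear in the reduced decompositions of `w`. -/
def IsFullySupported {n : ℕ} (w : Equiv.Perm (Fin n)) : Prop :=
  ∀ s : Equiv.Perm (Fin n), IsSimpleReflection s →
    ∀ L : List (Equiv.Perm (Fin n)), IsReducedDecomposition w L → s ∈ L

/-- `w` contains no `321`-pattern. -/
def Avoids321 {n : ℕ} (w : Equiv.Perm (Fin n)) : Prop :=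
  ¬ ∃ i j k : Fin n, i < j ∧ j < k ∧ w k < w j ∧ w j < w i

/-- `w(1) > w(2) < w(3) > w(4) < ⋯`, with positions counted from `1`. -/
def IsAlternating {n : ℕ} (w : Equiv.Perm (Fin n)) : Prop :=
  ∀ (i : ℕ) (h : i + 1 < n),
    (Even i → w ⟨i + 1, h⟩ < w ⟨i, Nat.lt_of_succ_lt h⟩) ∧
      (Odd i → w ⟨i, Nat.lt_of_succ_lt h⟩ < w ⟨i + 1, h⟩)

/-- With positions and values counted from `1`, this is the function sending `i` to
`1` if `i = 2`, to `2m` if `i = 2m - 1`, to `v(i) + 1` if `i < 2m - 1` is odd, and to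
`v(i - 2) + 1` if `i > 2` is even. (Below, positions and values are counted from `0`.) -/
def phiFun (m : ℕ) (v : Equiv.Perm (Fin (2 * m - 2))) (i : Fin (2 * m)) : Fin (2 * m) :=
  if h₁ : (i : ℕ) = 1 then ⟨0, by omega⟩
  else if h₂ : (i : ℕ) = 2 * m - 2 then ⟨2 * m - 1, by omega⟩
  else if h₃ : (i : ℕ) % 2 = 0 then ⟨(v ⟨i, by omega⟩ : ℕ) + 1, by omega⟩
  else ⟨(v ⟨(i : ℕ) - 2, by omega⟩ : ℕ) + 1, by omega⟩

theorem phiFun_injective (m : ℕ) (v : Equiv.Perm (Fin (2 * m - 2))) :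
    Function.Injective (phiFun m v) := by
  have key : ∀ (a b : ℕ) (ha : a < 2 * m - 2) (hb : b < 2 * m - 2),
      (v ⟨a, ha⟩ : ℕ) = (v ⟨b, hb⟩ : ℕ) → a = b := by
    intro a b ha hb h
    have := v.injective (Fin.ext h)
    simpa using this
  intro i j hij
  have hij' := congrArg Fin.val hij
  apply Fin.ext
  unfold phiFun at hij'
  split_ifs at hij' <;> simp only [Nat.add_right_cancel_iff] at hij' <;>
    first
    | omega
    | (have := key _ _ _ _ hij'; omega)

/-- The map `φ` from permutations of `{1, …, 2m - 2}` to permutations of `{1, …, 2m}`. -/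
noncomputable def phi (m : ℕ) (v : Equiv.Perm (Fin (2 * m - 2))) : Equiv.Perm (Fin (2 * m)) :=
  Equiv.ofBijective (phiFun m v) (Finite.injective_iff_bijective.mp (phiFun_injective m v))

/-! Elnitsky polygons live in the plane `ℂ`. They depend on directions of the `n` sides forming the
convex leftside boundary. Traversed counterclockwise from the top vertex, these sides all point
downwards and turn to the left, so they are given by angles `θ 1 < ⋯ < θ n` in `(π, 2π)`. -/

/-- Admissible angles for the sides labeled `1, …, n`. -/
def IsAdmissible {n : ℕ} (θ : Fin n → ℝ) : Prop :=
  StrictMono θ ∧ ∀ i, θ i ∈ Set.Ioo Real.pi (2 * Real.pi)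

/-- The unit vector along the sides labeled `a`, pointing downwards. -/
noncomputable def dir {n : ℕ} (θ : Fin n → ℝ) (a : Fin n) : ℂ :=
  Complex.exp ((θ a : ℂ) * Complex.I)

/-- The `k`-th vertex (`0 ≤ k ≤ n`) of the path of unit sides that starts at the top vertex `0` and
whose sides are labeled `u(1), …, u(n)`. -/
noncomputable def vertex {n : ℕ} (θ : Fin n → ℝ) (u : Equiv.Perm (Fin n)) (k : ℕ) : ℂ :=
  ∑ i : Fin n with i.val < k, dir θ (u i)

/-- A side of a polygon or of a tile is recorded by its unordered pair of endpoints; this is the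
side labeled `u(k + 1)` of the path with labels `u(1), …, u(n)`. -/
noncomputable def side {n : ℕ} (θ : Fin n → ℝ) (u : Equiv.Perm (Fin n)) (k : ℕ) : Sym2 ℂ :=
  s(vertex θ u k, vertex θ u (k + 1))

/-- The sides of Elnitsky's polygon `X(w)`: the leftside boundary has labels `1, …, n`, the rightside
boundary has labels `w(1), …, w(n)`, from top to bottom. -/
def polygonSides {n : ℕ} (θ : Fin n → ℝ) (w : Equiv.Perm (Fin n)) : Set (Sym2 ℂ) :=
  {e | ∃ k < n, e = side θ 1 k ∨ e = side θ w k}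

/-- The points of the path with labels `u(1), …, u(n)`. -/
def path {n : ℕ} (θ : Fin n → ℝ) (u : Equiv.Perm (Fin n)) : Set ℂ :=
  {z | ∃ k < n, z ∈ segment ℝ (vertex θ u k) (vertex θ u (k + 1))}

/-- The closed region enclosed by Elnitsky's polygon `X(w)`. Both boundary paths go strictly
downwards from the top vertex to the bottom vertex, so the region consists of the points that lie
horizontally between the leftside boundary and the rightside boundary. -/
def region {n : ℕ} (θ : Fin n → ℝ) (w : Equiv.Perm (Fin n)) : Set ℂ :=
  {z | ∃ p ∈ path θ 1, ∃ q ∈ path θ w,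
    p.im = z.im ∧ q.im = z.im ∧ p.re ≤ z.re ∧ z.re ≤ q.re}

/-- A rhombic tile with unit edges parallel to the sides labeled `a < b`, given by its top vertex
and its labels. -/
structure Tile (n : ℕ) where
  /-- the top vertex -/
  top : ℂ
  /-- the smaller label -/
  a : Fin n
  /-- the larger label -/
  b : Fin n
  /-- the labels are distinct -/
  lt : a < b

/-- The points of a (closed) tile. -/
def Tile.carrier {n : ℕ} (θ : Fin n → ℝ) (t : Tile n) : Set ℂ :=
  {z | ∃ x ∈ Set.Icc (0 : ℝ) 1, ∃ y ∈ Set.Icc (0 : ℝ) 1,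
    z = t.top + (x : ℂ) * dir θ t.a + (y : ℂ) * dir θ t.b}

/-- The interior points of a tile. -/
def Tile.inner {n : ℕ} (θ : Fin n → ℝ) (t : Tile n) : Set ℂ :=
  {z | ∃ x ∈ Set.Ioo (0 : ℝ) 1, ∃ y ∈ Set.Ioo (0 : ℝ) 1,
    z = t.top + (x : ℂ) * dir θ t.a + (y : ℂ) * dir θ t.b}

/-- The four edges of a tile. -/
def Tile.edges {n : ℕ} (θ : Fin n → ℝ) (t : Tile n) : Set (Sym2 ℂ) :=
  {s(t.top, t.top + dir θ t.a), s(t.top, t.top + dir θ t.b),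
    s(t.top + dir θ t.a, t.top + dir θ t.a + dir θ t.b),
    s(t.top + dir θ t.b, t.top + dir θ t.a + dir θ t.b)}

/-- `T` is a rhombic tiling of `X(w)`: the tiles fill the region, do not overlap, and meet edge to
edge. -/
def IsRhombicTiling {n : ℕ} (θ : Fin n → ℝ) (w : Equiv.Perm (Fin n)) (T : Finset (Tile n)) :
    Prop :=
  (⋃ t ∈ T, t.carrier θ) = region θ w ∧
  (∀ t ∈ T, ∀ t' ∈ T, t ≠ t' → Disjoint (t.inner θ) (t'.inner θ)) ∧
  (∀ t ∈ T, ∀ e ∈ t.edges θ, e ∈ polygonSides θ w ∨ ∃ t' ∈ T, t' ≠ t ∧ e ∈ t'.edges θ)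

/-- The tile `t` shares two consecutive edges with the rightside boundary of `X(w)`. -/
def SharesRightCorner {n : ℕ} (θ : Fin n → ℝ) (w : Equiv.Perm (Fin n)) (t : Tile n) : Prop :=
  ∃ k : ℕ, k + 1 < n ∧ side θ w k ∈ t.edges θ ∧ side θ w (k + 1) ∈ t.edges θ

/-- The tile `t` is a right-perimeter tile of the tiling `T` of `X(w)`. -/
def IsRightPerimeterTile {n : ℕ} (θ : Fin n → ℝ) (w : Equiv.Perm (Fin n)) (T : Finset (Tile n))
    (t : Tile n) : Prop :=
  t ∈ T ∧ SharesRightCorner θ w t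

/-- The tile `t` is a forced right-perimeter tile for `w`: it appears as a right-perimeter tile in
all rhombic tilings of `X(w)`. -/
def IsForcedRightPerimeterTile {n : ℕ} (θ : Fin n → ℝ) (w : Equiv.Perm (Fin n)) (t : Tile n) :
    Prop :=
  ∀ T : Finset (Tile n), IsRhombicTiling θ w T → IsRightPerimeterTile θ w T t

end Elnitsky

/-! Positions are counted from 0. A 321-avoiding alternating permutation of even degree is a two-row
array: the even positions carry the peaks, the odd ones the valleys, both rows increase, and each
peak exceeds the valley in its column (`avoids321_and_isAlternating_iff`). Recording which values
are valleys gives a Dyck word, and this is a bijection, so there are `catalan k` such permutations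
of degree `2 * k` (`ncard_isTwoRow`).

On arrays, `phi` slides the valley row one column to the right, with a new minimum in front of it
and a new maximum behind the peaks. Full support means that no proper prefix of positions is
preserved (`isFullySupported_iff`). For a two-row array it says that each peak exceeds the valley
one column further right, and these are exactly the column conditions of the array before the slide.
Hence `phi` is a bijection onto the fully supported arrays (`bijOn_phi`).

For the tilings, both boundaries of the polygon are graphs over the vertical axis. A descent of `w`
at `k` gives a corner tile at the sides `k` and `k + 1`, and removing it leaves the polygon of `w *
simpleRefl k`. Conversely, every tiling contains some corner tile: a tile at a right side has that
side as its upper or its lower right edge, and somewhere along the boundary the type changes from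
upper to lower. Peeling off corner tiles identifies the rhombic tilings with the inductively built
`FlipTiling`s (`IsPretiling.flipTiling`, `FlipTiling.isRhombicTiling`).

A forced right-perimeter tile must therefore be a corner tile at a descent. It is missing from some
tiling as soon as a larger entry precedes its two labels or a smaller one follows them: by flips
that leave the corner alone, this entry becomes adjacent to the labels, and the three consecutive
decreasing entries then span a hexagon, which can be tiled in a second way. If `w` avoids 321,
corners never interfere and all of them are forced, so an alternating `w` has exactly `m`.
Conversely, forced descents are never adjacent, so `m` of them among the `2 * m - 1` possible places
sit at all even positions. The restrictions on the other entries then exclude every 321 pattern, and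
`w` alternates. -/

namespace Elnitsky

/-! ### Simple reflections, descents and inversions. -/

/-- The simple reflection exchanging `k` and `k + 1`. -/
def simpleRefl {n : ℕ} (k : ℕ) (hk : k + 1 < n) : Equiv.Perm (Fin n) :=
  Equiv.swap ⟨k, Nat.lt_of_succ_lt hk⟩ ⟨k + 1, hk⟩

theorem simpleRefl_left {n k : ℕ} (hk : k + 1 < n) :
    simpleRefl k hk ⟨k, Nat.lt_of_succ_lt hk⟩ = ⟨k + 1, hk⟩ := Equiv.swap_apply_left _ _

theorem simpleRefl_right {n k : ℕ} (hk : k + 1 < n) :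
    simpleRefl k hk ⟨k + 1, hk⟩ = ⟨k, Nat.lt_of_succ_lt hk⟩ := Equiv.swap_apply_right _ _

theorem simpleRefl_of_ne {n k : ℕ} (hk : k + 1 < n) {i : Fin n} (h : (i : ℕ) ≠ k)
    (h' : (i : ℕ) ≠ k + 1) : simpleRefl k hk i = i :=
  Equiv.swap_apply_of_ne_of_ne (fun e => h (congrArg Fin.val e)) (fun e => h' (congrArg Fin.val e))

theorem simpleRefl_mul_self {n k : ℕ} (hk : k + 1 < n) :
    simpleRefl k hk * simpleRefl k hk = 1 := Equiv.swap_mul_self _ _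

theorem mul_simpleRefl_mul_self {n k : ℕ} (hk : k + 1 < n) (w : Equiv.Perm (Fin n)) :
    w * simpleRefl k hk * simpleRefl k hk = w := by
  rw [mul_assoc, simpleRefl_mul_self, mul_one]

theorem simpleRefl_val {n k : ℕ} (hk : k + 1 < n) (i : Fin n) :
    (simpleRefl k hk i : ℕ) = if (i : ℕ) = k then k + 1 else if (i : ℕ) = k + 1 then k else i := by
  unfold simpleRefl
  rw [Equiv.swap_apply_def]
  simp only [Fin.ext_iff]
  split_ifs <;> rfl

/-- `w(k + 1) < w(k)`, with positions counted from `0`. -/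
def IsDescent {n : ℕ} (w : Equiv.Perm (Fin n)) (k : ℕ) (hk : k + 1 < n) : Prop :=
  w ⟨k + 1, hk⟩ < w ⟨k, Nat.lt_of_succ_lt hk⟩

/-- The inversions of `w`, recorded by values. -/
def inversions {n : ℕ} (w : Equiv.Perm (Fin n)) : Finset (Fin n × Fin n) :=
  {p | p.1 < p.2 ∧ w.symm p.2 < w.symm p.1}

theorem mem_inversions {n : ℕ} {w : Equiv.Perm (Fin n)} {a b : Fin n} :
    (a, b) ∈ inversions w ↔ a < b ∧ w.symm b < w.symm a := by
  simp [inversions]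

/-- Exchanging two adjacent positions alters the relative order of that one pair of values only.
Recording inversions by values rather than by positions makes this a plain `erase`. -/
theorem inversions_mul_simpleRefl {n k : ℕ} (hk : k + 1 < n) (w : Equiv.Perm (Fin n))
    (h : IsDescent w k hk) :
    inversions (w * simpleRefl k hk) =
      (inversions w).erase (w ⟨k + 1, hk⟩, w ⟨k, Nat.lt_of_succ_lt hk⟩) := by
  ext ⟨a, b⟩
  obtain ⟨i, rfl⟩ := w.surjective a
  obtain ⟨j, rfl⟩ := w.surjective b
  rw [Finset.mem_erase, mem_inversions, mem_inversions]
  have hs : ∀ x, (w * simpleRefl k hk).symm (w x) = simpleRefl k hk x := by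
    intro x
    rw [Equiv.symm_apply_eq, Equiv.Perm.mul_apply, ← Equiv.Perm.mul_apply (simpleRefl k hk),
      simpleRefl_mul_self, Equiv.Perm.one_apply]
  simp only [hs, Equiv.symm_apply_apply, ne_eq, Prod.mk.injEq,
    EmbeddingLike.apply_eq_iff_eq, Fin.lt_def, simpleRefl_val, Fin.ext_iff]
  unfold IsDescent at h
  have e1 : (i : ℕ) = k → (w i : ℕ) = w ⟨k, Nat.lt_of_succ_lt hk⟩ := by
    intro e; congr; exact Fin.ext e
  have e2 : (i : ℕ) = k + 1 → (w i : ℕ) = w ⟨k + 1, hk⟩ := by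
    intro e; congr; exact Fin.ext e
  have e3 : (j : ℕ) = k → (w j : ℕ) = w ⟨k, Nat.lt_of_succ_lt hk⟩ := by
    intro e; congr; exact Fin.ext e
  have e4 : (j : ℕ) = k + 1 → (w j : ℕ) = w ⟨k + 1, hk⟩ := by
    intro e; congr; exact Fin.ext e
  rw [Fin.lt_def] at h
  split_ifs <;> omega

theorem mem_inversions_of_isDescent {n k : ℕ} (hk : k + 1 < n) (w : Equiv.Perm (Fin n))
    (h : IsDescent w k hk) :
    (w ⟨k + 1, hk⟩, w ⟨k, Nat.lt_of_succ_lt hk⟩) ∈ inversions w := by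
  rw [mem_inversions]
  exact ⟨h, by simp [Fin.lt_def]⟩

theorem card_inversions_mul_simpleRefl {n k : ℕ} (hk : k + 1 < n) (w : Equiv.Perm (Fin n))
    (h : IsDescent w k hk) :
    (inversions (w * simpleRefl k hk)).card + 1 = (inversions w).card := by
  rw [inversions_mul_simpleRefl hk w h]
  exact Finset.card_erase_add_one (mem_inversions_of_isDescent hk w h)

theorem isDescent_mul_simpleRefl {n k : ℕ} (hk : k + 1 < n) (w : Equiv.Perm (Fin n)) :
    IsDescent (w * simpleRefl k hk) k hk ↔ ¬ IsDescent w k hk := by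
  unfold IsDescent
  rw [Equiv.Perm.mul_apply, Equiv.Perm.mul_apply, simpleRefl_left, simpleRefl_right, not_lt]
  refine ⟨le_of_lt, fun h => lt_of_le_of_ne h fun e => ?_⟩
  have := w.injective e
  simp [Fin.ext_iff] at this

theorem card_inversions_mul_simpleRefl_le {n k : ℕ} (hk : k + 1 < n) (w : Equiv.Perm (Fin n)) :
    (inversions (w * simpleRefl k hk)).card ≤ (inversions w).card + 1 := by
  by_cases h : IsDescent w k hk
  · have := card_inversions_mul_simpleRefl hk w h
    omega
  · have := card_inversions_mul_simpleRefl hk _ ((isDescent_mul_simpleRefl hk w).2 h)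
    rw [mul_simpleRefl_mul_self] at this
    omega

theorem inversions_one {n : ℕ} : inversions (1 : Equiv.Perm (Fin n)) = ∅ := by
  ext ⟨a, b⟩
  rw [mem_inversions]
  exact ⟨fun h => absurd h.2 (not_lt.2 h.1.le), fun h => absurd h (Finset.notMem_empty _)⟩

/-- Without descents `w` is strictly increasing, hence an order automorphism of a finite chain, and
there is only one. -/
theorem eq_one_of_forall_not_isDescent {n : ℕ} (w : Equiv.Perm (Fin n))
    (h : ∀ k hk, ¬ IsDescent w k hk) : w = 1 := by
  have hm : StrictMono w := by
    rcases n with _ | n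
    · exact fun i => i.elim0
    refine Fin.strictMono_iff_lt_succ.2 fun i => ?_
    have := h i (by omega)
    refine lt_of_le_of_ne (not_lt.1 this) fun e => ?_
    have := w.injective e
    simp [Fin.ext_iff] at this
  have : (OrderIso.refl (Fin n)) = hm.orderIsoOfSurjective _ w.surjective := Subsingleton.elim _ _
  ext i
  have := congrArg (fun f => f i) this
  exact (congrArg Fin.val this).symm

theorem exists_isDescent {n : ℕ} {w : Equiv.Perm (Fin n)} (h : w ≠ 1) :
    ∃ k hk, IsDescent w k hk := by
  by_contra! hc
  exact h (eq_one_of_forall_not_isDescent w hc)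

/-! ### Full support and stable prefixes. -/

/-- `w` maps the `r` smallest elements to themselves. -/
def StablePrefix {n : ℕ} (r : ℕ) (w : Equiv.Perm (Fin n)) : Prop :=
  ∀ i : Fin n, (i : ℕ) < r → (w i : ℕ) < r

theorem StablePrefix.le_apply {n r : ℕ} {w : Equiv.Perm (Fin n)} (h : StablePrefix r w)
    {i : Fin n} (hi : r ≤ i) : r ≤ w i := by
  have hm : Set.MapsTo w {i : Fin n | (i : ℕ) < r} {i : Fin n | (i : ℕ) < r} := fun i hi => h i hi
  by_contra! hc
  obtain ⟨j, hj, e⟩ :=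
    (((Set.toFinite _).injOn_iff_bijOn_of_mapsTo hm).1 w.injective.injOn).surjOn hc
  rw [w.injective e] at hj
  exact absurd hj (not_lt.2 hi)

theorem StablePrefix.mul {n r : ℕ} {v w : Equiv.Perm (Fin n)} (hv : StablePrefix r v)
    (hw : StablePrefix r w) : StablePrefix r (v * w) :=
  fun i hi => hv _ (hw i hi)

theorem stablePrefix_simpleRefl {n r k : ℕ} (hk : k + 1 < n) (h : k + 1 ≠ r) :
    StablePrefix r (simpleRefl (n := n) k hk) := by
  intro i hi
  rw [simpleRefl_val]
  split_ifs <;> omega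

/-- If an early position had a value at least `r`, all values at late positions would lie above it,
and there are too few values for that. -/
theorem stablePrefix_of_forall_lt {n r : ℕ} {w : Equiv.Perm (Fin n)}
    (h : ∀ i j : Fin n, (i : ℕ) < r → r ≤ (j : ℕ) → w i < w j) : StablePrefix r w := by
  intro i hi
  by_contra! hc
  have hsub : (Finset.univ.filter fun j : Fin n => r ≤ (j : ℕ)).map w.toEmbedding ⊆
      (Finset.univ.filter fun j : Fin n => r ≤ (j : ℕ)).erase (w i) := by
    intro x hx
    obtain ⟨j, hj, rfl⟩ := Finset.mem_map.1 hx
    have hj := (Finset.mem_filter.1 hj).2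
    have := h i j hi hj
    refine Finset.mem_erase.2 ⟨this.ne', Finset.mem_filter.2 ⟨Finset.mem_univ _, ?_⟩⟩
    exact hc.trans (Fin.le_def.1 this.le)
  have h1 := Finset.card_le_card hsub
  rw [Finset.card_map] at h1
  have h2 : w i ∈ Finset.univ.filter fun j : Fin n => r ≤ (j : ℕ) := by simpa using hc
  have := Finset.card_erase_lt_of_mem h2
  omega

theorem card_inversions_prod_le {n : ℕ} (L : List (Equiv.Perm (Fin n)))
    (hL : ∀ s ∈ L, IsSimpleReflection s) : (inversions L.prod).card ≤ L.length := by
  induction L using List.reverseRecOn with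
  | nil => simp [inversions_one]
  | append_singleton L s ih =>
    obtain ⟨k, hk, rfl⟩ := hL s (by simp)
    have := card_inversions_mul_simpleRefl_le hk L.prod
    have := ih fun s hs => hL s (by simp [hs])
    rw [List.prod_append, List.length_append, List.prod_singleton, List.length_singleton]
    change (inversions (L.prod * simpleRefl k hk)).card ≤ _
    omega

/-- Sort `w` by removing descents one at a time. The reflection across the boundary of a stable
prefix never occurs, since values before the boundary are smaller than values after it. The length
is the number of inversions, so by `card_inversions_prod_le` the word is reduced. -/
theorem exists_word_of_stablePrefix {n r : ℕ} (w : Equiv.Perm (Fin n)) (h : StablePrefix r w) :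
    ∃ L : List (Equiv.Perm (Fin n)), L.length = (inversions w).card ∧ L.prod = w ∧
      ∀ s ∈ L, ∃ k hk, s = simpleRefl k hk ∧ k + 1 ≠ r := by
  induction hN : (inversions w).card generalizing w with
  | zero =>
    refine ⟨[], rfl, ?_, by simp⟩
    by_contra hc
    obtain ⟨k, hk, hd⟩ := exists_isDescent (Ne.symm hc)
    have := card_inversions_mul_simpleRefl hk w hd
    omega
  | succ N ih =>
    have hw : w ≠ 1 := by
      rintro rfl
      simp [inversions_one] at hN
    obtain ⟨k, hk, hd⟩ := exists_isDescent hw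
    have hc := card_inversions_mul_simpleRefl hk w hd
    have hkr : k + 1 ≠ r := by
      rintro rfl
      have h1 := h ⟨k, by omega⟩ (by simp)
      have h2 := h.le_apply (i := ⟨k + 1, hk⟩) le_rfl
      have h3 := Fin.lt_def.1 hd
      omega
    obtain ⟨L, h1, h2, h3⟩ := ih (w * simpleRefl k hk) (h.mul (stablePrefix_simpleRefl hk hkr))
      (by omega)
    refine ⟨L ++ [simpleRefl k hk], by simp [h1], ?_, ?_⟩
    · rw [List.prod_append, List.prod_singleton, h2, mul_simpleRefl_mul_self]
    · intro s hs
      rcases List.mem_append.1 hs with hs | hs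
      · exact h3 s hs
      · exact ⟨k, hk, by simpa using hs, hkr⟩

/-- A stable prefix yields a reduced word without the reflection across its end. Conversely, every
other simple reflection preserves that prefix, so a word avoiding the reflection has a product
preserving it. -/
theorem isFullySupported_iff {n : ℕ} (w : Equiv.Perm (Fin n)) :
    IsFullySupported w ↔ ∀ r, 0 < r → r < n → ¬ StablePrefix r w := by
  constructor
  · intro h r hr hrn hs
    obtain ⟨L, h1, h2, h3⟩ := exists_word_of_stablePrefix w hs
    obtain ⟨k, rfl⟩ : ∃ k, r = k + 1 := ⟨r - 1, by omega⟩
    have := h (simpleRefl k hrn) ⟨k, hrn, rfl⟩ L ⟨fun s hs => ?_, h2, fun L' h4 h5 => ?_⟩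
    · obtain ⟨j, hj, he, hne⟩ := h3 _ this
      have e := congrArg (fun f : Equiv.Perm (Fin n) => ((f ⟨k, by omega⟩ : Fin n) : ℕ)) he
      simp only [simpleRefl_val] at e
      split_ifs at e <;> omega
    · obtain ⟨j, hj, he, hne⟩ := h3 _ hs
      exact ⟨j, hj, he⟩
    · rw [h1, ← h5]
      exact card_inversions_prod_le L' h4
  · rintro h s ⟨k, hk, rfl⟩ L ⟨h1, h2, -⟩
    by_contra hc
    refine h (k + 1) (by omega) hk ?_
    rw [← h2]
    clear h2
    induction L with
    | nil => exact fun i hi => by simpa using hi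
    | cons s L ih =>
      rw [List.prod_cons]
      refine StablePrefix.mul ?_ (ih (fun s hs => h1 s (by simp [hs])) fun hs => hc (by simp [hs]))
      obtain ⟨j, hj, rfl⟩ := h1 s (by simp)
      refine stablePrefix_simpleRefl hj fun e => hc ?_
      obtain rfl : j = k := by omega
      simp

/-! ### 321-avoiding alternating permutations as two-row arrays. -/

/-- The entries at odd positions and the entries at even positions increase, and each entry at an
even position (counted from `0`) is larger than its successor. -/
def IsTwoRow {n : ℕ} (w : Equiv.Perm (Fin n)) : Prop :=
  (∀ i j : Fin n, i < j → (i : ℕ) % 2 = (j : ℕ) % 2 → w i < w j) ∧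
    ∀ i j : Fin n, (j : ℕ) = i + 1 → (i : ℕ) % 2 = 0 → w j < w i

theorem lt_of_forall_lt_add_two {n : ℕ} (w : Equiv.Perm (Fin n))
    (h : ∀ i j : Fin n, (j : ℕ) = i + 2 → w i < w j) :
    ∀ i j : Fin n, i < j → (i : ℕ) % 2 = (j : ℕ) % 2 → w i < w j := by
  intro i j hij hp
  have key : ∀ (k : ℕ) (i j : Fin n), (j : ℕ) = i + 2 * (k + 1) → w i < w j := by
    intro k
    induction k with
    | zero => exact fun i j e => h i j (by omega)
    | succ k ih =>
      intro i j e
      exact (ih i ⟨j - 2, by omega⟩ (by simp only; omega)).trans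
        (h ⟨j - 2, by omega⟩ j (by simp only; omega))
  rw [Fin.lt_def] at hij
  exact key ((j - i) / 2 - 1) i j (by omega)

/-- An inversion between positions `i` and `i + 2` extends to a 321 pattern by an alternating
descent: the one after `i + 2` if `i` is even (it exists because the degree is even), the one before
`i` if `i` is odd. Conversely, both steps of a 321 pattern would have to change the parity of the
position, so its ends would be in the same, increasing row. -/
theorem avoids321_and_isAlternating_iff {k : ℕ} (w : Equiv.Perm (Fin (2 * k))) :
    Avoids321 w ∧ IsAlternating w ↔ IsTwoRow w := by
  constructor
  · rintro ⟨h1, h2⟩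
    have hd : ∀ i j : Fin (2 * k), (j : ℕ) = i + 1 → (i : ℕ) % 2 = 0 → w j < w i := by
      intro i j e hi
      have := (h2 i (by omega)).1 (Nat.even_iff.2 hi)
      rwa [show j = ⟨i + 1, by omega⟩ from Fin.ext e]
    refine ⟨lt_of_forall_lt_add_two w fun i j e => ?_, hd⟩
    by_contra hc
    have hne : w i ≠ w j := fun e' => by
      have := congrArg Fin.val (w.injective e')
      omega
    have hji : w j < w i := lt_of_le_of_ne (not_lt.1 hc) hne.symm
    refine h1 ?_
    rcases Nat.mod_two_eq_zero_or_one i with hi | hi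
    · have hj : (j : ℕ) + 1 < 2 * k := by omega
      exact ⟨i, j, ⟨j + 1, hj⟩, Fin.lt_def.2 (by omega), Fin.lt_def.2 (by simp),
        hd j ⟨j + 1, hj⟩ rfl (by omega), hji⟩
    · exact ⟨⟨i - 1, by omega⟩, i, j, Fin.lt_def.2 (by simp only; omega), Fin.lt_def.2 (by omega),
        hji, hd ⟨i - 1, by omega⟩ i (by simp only; omega) (by simp only; omega)⟩
  · rintro ⟨h1, h2⟩
    refine ⟨?_, fun i h => ⟨fun hi => h2 _ _ rfl (Nat.even_iff.1 hi), fun hi => ?_⟩⟩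
    · rintro ⟨i, j, l, hij, hjl, h3, h4⟩
      have a1 : (i : ℕ) % 2 ≠ (j : ℕ) % 2 := fun e => absurd (h1 i j hij e) (not_lt.2 h4.le)
      have a2 : (j : ℕ) % 2 ≠ (l : ℕ) % 2 := fun e => absurd (h1 j l hjl e) (not_lt.2 h3.le)
      have a3 := h1 i l (hij.trans hjl) (by omega)
      exact absurd a3 (not_lt.2 (h3.trans h4).le)
    · rw [Nat.odd_iff] at hi
      have a1 := h2 ⟨i - 1, by omega⟩ ⟨i, by omega⟩ (by simp only; omega) (by simp only; omega)
      exact a1.trans (h1 ⟨i - 1, by omega⟩ ⟨i + 1, h⟩ (Fin.lt_def.2 (by simp only; omega))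
        (by simp only; omega))

/-! ### Counting two-row arrays by Dyck words. -/

open DyckStep

/-- The word whose letter at `v` records the parity of the position of the value `v`. -/
def stepWord {k : ℕ} (w : Equiv.Perm (Fin (2 * k))) : List DyckStep :=
  List.ofFn fun v => if (w.symm v : ℕ) % 2 = 1 then U else D

theorem count_take_ofFn {α : Type*} [DecidableEq α] {n : ℕ} (f : Fin n → α) (a : α) (r : ℕ) :
    ((List.ofFn f).take r).count a =
      (Finset.univ.filter fun v : Fin n => (v : ℕ) < r ∧ f v = a).card := by
  induction n generalizing r with
  | zero => simp
  | succ n ih =>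
    rcases r with _ | r
    · simp
    · rw [List.ofFn_succ, List.take_succ_cons, List.count_cons, ih, Finset.card_filter,
        Finset.card_filter, Fin.sum_univ_succ, add_comm]
      simp

/-- Sending a peak to the valley in its column is injective and decreases the value, so it stays
below `r`. This is the prefix condition of a Dyck word. -/
theorem IsTwoRow.card_even_le_card_odd {k : ℕ} {w : Equiv.Perm (Fin (2 * k))} (hw : IsTwoRow w)
    (r : ℕ) :
    (Finset.univ.filter fun v : Fin (2 * k) => (v : ℕ) < r ∧ (w.symm v : ℕ) % 2 = 0).card ≤
      (Finset.univ.filter fun v : Fin (2 * k) => (v : ℕ) < r ∧ (w.symm v : ℕ) % 2 = 1).card := by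
  have hpos : ∀ v ∈ Finset.univ.filter fun v : Fin (2 * k) => (v : ℕ) < r ∧ (w.symm v : ℕ) % 2 = 0,
      (w.symm v : ℕ) + 1 < 2 * k := by
    intro v hv
    have := (Finset.mem_filter.1 hv).2.2
    omega
  refine Finset.card_le_card_of_injOn
    -- The value `v` in the second branch is a dummy: an even position below `2 * k` always has a
    -- successor.
    (fun v => if h : (w.symm v : ℕ) + 1 < 2 * k then w ⟨w.symm v + 1, h⟩ else v) ?_ ?_
  · intro v hv
    have h := hpos v hv
    obtain ⟨-, h1, h2⟩ := Finset.mem_filter.1 hv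
    have h3 := hw.2 (w.symm v) ⟨w.symm v + 1, h⟩ rfl h2
    rw [Equiv.apply_symm_apply] at h3
    simp only [dif_pos h]
    refine Finset.mem_coe.2 (Finset.mem_filter.2
      ⟨Finset.mem_univ _, (Fin.lt_def.1 h3).trans h1, ?_⟩)
    rw [Equiv.symm_apply_apply]
    simp only
    omega
  · intro v hv u hu e
    simp only [dif_pos (hpos v hv), dif_pos (hpos u hu)] at e
    have := congrArg Fin.val (w.injective e)
    exact w.symm.injective (Fin.ext (by simpa using this))

theorem card_odd_eq_card_even {k : ℕ} (w : Equiv.Perm (Fin (2 * k))) :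
    (Finset.univ.filter fun v : Fin (2 * k) => (w.symm v : ℕ) % 2 = 1).card =
      (Finset.univ.filter fun v : Fin (2 * k) => (w.symm v : ℕ) % 2 = 0).card := by
  refine Finset.card_bij' (fun v hv => w ⟨w.symm v - 1, by omega⟩)
    (fun v hv => w ⟨w.symm v + 1, by have := (Finset.mem_filter.1 hv).2; omega⟩) ?_ ?_ ?_ ?_
  · intro v hv
    have := (Finset.mem_filter.1 hv).2
    simp only [Finset.mem_filter, Finset.mem_univ, Equiv.symm_apply_apply, true_and]
    omega
  · intro v hv
    have := (Finset.mem_filter.1 hv).2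
    simp only [Finset.mem_filter, Finset.mem_univ, Equiv.symm_apply_apply, true_and]
    omega
  · intro v hv
    have := (Finset.mem_filter.1 hv).2
    rw [← Equiv.eq_symm_apply]
    simp only [Equiv.symm_apply_apply, Fin.ext_iff]
    omega
  · intro v hv
    have := (Finset.mem_filter.1 hv).2
    rw [← Equiv.eq_symm_apply]
    simp only [Equiv.symm_apply_apply, Fin.ext_iff]
    omega

theorem ite_eq_U_iff (a : ℕ) : (if a % 2 = 1 then U else D) = U ↔ a % 2 = 1 := by
  split_ifs <;> simp_all

theorem ite_eq_D_iff (a : ℕ) : (if a % 2 = 1 then U else D) = D ↔ a % 2 = 0 := by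
  split_ifs <;> simp <;> omega

/-- The Dyck word whose letter at `v` is `U` if `v` is a valley of `w`, and `D` if it is a peak. -/
def IsTwoRow.dyckWord {k : ℕ} {w : Equiv.Perm (Fin (2 * k))} (hw : IsTwoRow w) : DyckWord where
  toList := stepWord w
  count_U_eq_count_D := by
    have h : (stepWord w).take (2 * k) = stepWord w := List.take_of_length_le (by simp [stepWord])
    rw [← h, stepWord, count_take_ofFn, count_take_ofFn]
    simp only [Fin.is_lt, true_and, ite_eq_U_iff, ite_eq_D_iff]
    exact card_odd_eq_card_even w
  count_D_le_count_U r := by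
    rw [stepWord, count_take_ofFn, count_take_ofFn]
    simp only [ite_eq_U_iff, ite_eq_D_iff]
    exact hw.card_even_le_card_odd r

theorem IsTwoRow.semilength_dyckWord {k : ℕ} {w : Equiv.Perm (Fin (2 * k))} (hw : IsTwoRow w) :
    hw.dyckWord.semilength = k := by
  have := hw.dyckWord.two_mul_semilength_eq_length
  simp only [IsTwoRow.dyckWord, stepWord, List.length_ofFn] at this
  change 2 * hw.dyckWord.semilength = _ at this
  omega

/-- The word determines the set of values in each row, and each row is the increasing enumeration of
its set. -/
theorem IsTwoRow.eq_of_stepWord_eq {k : ℕ} {v w : Equiv.Perm (Fin (2 * k))} (hv : IsTwoRow v)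
    (hw : IsTwoRow w) (h : stepWord v = stepWord w) : v = w := by
  have hpar : ∀ x, (v.symm x : ℕ) % 2 = (w.symm x : ℕ) % 2 := by
    intro x
    have e := congrFun (List.ofFn_injective h) x
    split_ifs at e <;> omega
  have key : ∀ p < 2, ∀ i (hi : 2 * i + p < 2 * k), v ⟨2 * i + p, hi⟩ = w ⟨2 * i + p, hi⟩ := by
    intro p hp i hi
    have hmono : ∀ u : Equiv.Perm (Fin (2 * k)), IsTwoRow u →
        StrictMono fun j : Fin k => u ⟨2 * j + p, by omega⟩ := by
      intro u hu a b hab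
      rw [Fin.lt_def] at hab
      exact hu.1 _ _ (Fin.lt_def.2 (by simp only; omega)) (by simp only; omega)
    have hrange : ∀ u : Equiv.Perm (Fin (2 * k)),
        Set.range (fun j : Fin k => u ⟨2 * j + p, by omega⟩) = {x | (u.symm x : ℕ) % 2 = p} := by
      intro u
      ext x
      constructor
      · rintro ⟨j, rfl⟩
        simp only [Set.mem_ofPred_eq, Equiv.symm_apply_apply]
        omega
      · intro hx
        have hx : (u.symm x : ℕ) % 2 = p := hx
        refine ⟨⟨(u.symm x : ℕ) / 2, by omega⟩, ?_⟩
        simp only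
        rw [← Equiv.eq_symm_apply]
        apply Fin.ext
        simp only
        omega
    have e := ((hmono v hv).range_inj (hmono w hw)).1 (by
      rw [hrange v, hrange w]
      ext x
      simp only [Set.mem_ofPred_eq, hpar x])
    exact congrFun e ⟨i, by omega⟩
  ext i
  have := key ((i : ℕ) % 2) (by omega) (i / 2) (by omega)
  simpa only [Nat.div_add_mod, Fin.eta] using congrArg Fin.val this

/-- The places of the letters `U`, in order, form the valley row and those of `D` the peak row. The
column condition is the Dyck condition. -/
theorem exists_isTwoRow_stepWord_eq {k : ℕ} (p : DyckWord) (hp : p.semilength = k) :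
    ∃ w : Equiv.Perm (Fin (2 * k)), IsTwoRow w ∧ stepWord w = p.toList := by
  have hlen : p.toList.length = 2 * k := by rw [← p.two_mul_semilength_eq_length, hp]
  obtain ⟨l, hl⟩ : ∃ l : Fin (2 * k) → DyckStep, p.toList = List.ofFn l :=
    ⟨fun i => p.toList[i], by
      refine List.ext_getElem (by simp [hlen]) ?_
      simp⟩
  have htake : p.toList.take (2 * k) = p.toList := List.take_of_length_le hlen.le
  have hU : (Finset.univ.filter fun v => l v = U).card = k := by
    have h : p.toList.count U = k := hp
    rw [← htake, hl, count_take_ofFn] at h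
    simpa only [Fin.is_lt, true_and] using h
  have hD : (Finset.univ.filter fun v => l v = D).card = k := by
    have h : p.toList.count D = k := p.count_U_eq_count_D ▸ hp
    rw [← htake, hl, count_take_ofFn] at h
    simpa only [Fin.is_lt, true_and] using h
  set valley := (Finset.univ.filter fun v => l v = U).orderEmbOfFin hU with hvalley
  set peak := (Finset.univ.filter fun v => l v = D).orderEmbOfFin hD with hpeak
  have hlU : ∀ i, l (valley i) = U := fun i =>
    (Finset.mem_filter.1 (Finset.orderEmbOfFin_mem _ hU i)).2
  have hlD : ∀ i, l (peak i) = D := fun i =>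
    (Finset.mem_filter.1 (Finset.orderEmbOfFin_mem _ hD i)).2
  have hlt : ∀ i, valley i < peak i := by
    intro i
    by_contra hc
    have hne : valley i ≠ peak i := fun e => by
      have := hlU i
      rw [e, hlD] at this
      cases this
    have hlt : peak i < valley i := lt_of_le_of_ne (not_lt.1 hc) hne.symm
    -- If peak `i` came before valley `i`, the prefix ending at that peak would contain at least `i
    -- + 1` letters `D` but at most `i` letters `U`.
    have hdyck := p.count_D_le_count_U (peak i + 1)
    rw [hl, count_take_ofFn, count_take_ofFn] at hdyck
    have h1 : (Finset.Iic i).map peak.toEmbedding ⊆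
        Finset.univ.filter fun v : Fin (2 * k) => (v : ℕ) < peak i + 1 ∧ l v = D := by
      intro x hx
      obtain ⟨j, hj, rfl⟩ := Finset.mem_map.1 hx
      refine Finset.mem_filter.2 ⟨Finset.mem_univ _, Nat.lt_succ_of_le ?_, hlD j⟩
      exact Fin.le_def.1 (peak.monotone (Finset.mem_Iic.1 hj))
    have h2 : (Finset.univ.filter fun v : Fin (2 * k) => (v : ℕ) < peak i + 1 ∧ l v = U) ⊆
        (Finset.Iio i).map valley.toEmbedding := by
      intro x hx
      obtain ⟨-, hx1, hx2⟩ := Finset.mem_filter.1 hx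
      have : x ∈ Set.range valley := by
        rw [hvalley, Finset.range_orderEmbOfFin]
        simpa using hx2
      obtain ⟨j, rfl⟩ := this
      refine Finset.mem_map.2 ⟨j, Finset.mem_Iio.2 ?_, rfl⟩
      rw [← valley.lt_iff_lt]
      exact lt_of_le_of_lt (Fin.le_def.2 (Nat.le_of_lt_succ hx1)) hlt
    have h3 := Finset.card_le_card h1
    have h4 := Finset.card_le_card h2
    rw [Finset.card_map, Fin.card_Iic] at h3
    rw [Finset.card_map, Fin.card_Iio] at h4
    omega
  let f : Fin (2 * k) → Fin (2 * k) := fun i =>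
    if (i : ℕ) % 2 = 1 then valley ⟨i / 2, by omega⟩ else peak ⟨i / 2, by omega⟩
  have hlf : ∀ i, l (f i) = if (i : ℕ) % 2 = 1 then U else D := by
    intro i
    simp only [f]
    split_ifs
    · exact hlU _
    · exact hlD _
  have hf : Function.Injective f := by
    intro i j e
    have h1 := hlf i
    rw [e, hlf j] at h1
    simp only [f] at e
    split_ifs at e h1
    · have := congrArg Fin.val (valley.injective e)
      simp only at this
      exact Fin.ext (by omega)
    · have := congrArg Fin.val (peak.injective e)
      simp only at this
      exact Fin.ext (by omega)
  refine ⟨Equiv.ofBijective f (Finite.injective_iff_bijective.1 hf), ⟨?_, ?_⟩, ?_⟩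
  · intro i j hij hpar
    rw [Fin.lt_def] at hij
    change f i < f j
    simp only [f, hpar]
    split_ifs
    · exact valley.strictMono (Fin.lt_def.2 (by simp only; omega))
    · exact peak.strictMono (Fin.lt_def.2 (by simp only; omega))
  · intro i j e hi
    change f j < f i
    simp only [f, e]
    rw [if_pos (by omega), if_neg (by omega)]
    convert hlt ⟨i / 2, by omega⟩ using 3
    omega
  · rw [hl, stepWord]
    congr 1
    funext v
    obtain ⟨i, rfl⟩ := (Finite.injective_iff_bijective.1 hf).2 v
    rw [hlf]
    have : (Equiv.ofBijective f (Finite.injective_iff_bijective.1 hf)).symm (f i) = i :=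
      Equiv.ofBijective_symm_apply_apply f _ i
    rw [this]

theorem ncard_isTwoRow (k : ℕ) :
    {w : Equiv.Perm (Fin (2 * k)) | IsTwoRow w}.ncard = catalan k := by
  rw [← DyckWord.card_dyckWord_semilength_eq_catalan, ← Nat.card_coe_set_eq,
    ← Nat.card_eq_fintype_card]
  refine Nat.card_congr (Equiv.ofBijective
    (fun w => ⟨IsTwoRow.dyckWord w.2, IsTwoRow.semilength_dyckWord w.2⟩) ⟨?_, ?_⟩)
  · intro v w e
    exact Subtype.ext (v.2.eq_of_stepWord_eq w.2
      (congrArg (fun p : {p : DyckWord // p.semilength = k} => p.1.toList) e))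
  · rintro ⟨p, hp⟩
    obtain ⟨w, h1, h2⟩ := exists_isTwoRow_stepWord_eq p hp
    exact ⟨⟨w, h1⟩, Subtype.ext (DyckWord.ext h2)⟩

/-! ### The map `phi` on two-row arrays. -/

theorem phi_apply {m : ℕ} (v : Equiv.Perm (Fin (2 * m - 2))) (i : Fin (2 * m)) :
    phi m v i = phiFun m v i := rfl

theorem phi_one {m : ℕ} (v : Equiv.Perm (Fin (2 * m - 2))) (i : Fin (2 * m)) (h : (i : ℕ) = 1) :
    (phi m v i : ℕ) = 0 := by
  rw [phi_apply, phiFun, dif_pos h]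

theorem phi_last {m : ℕ} (v : Equiv.Perm (Fin (2 * m - 2))) (i : Fin (2 * m))
    (h : (i : ℕ) = 2 * m - 2) : (phi m v i : ℕ) = 2 * m - 1 := by
  rw [phi_apply, phiFun, dif_neg (by omega), dif_pos h]

theorem phi_even {m : ℕ} (v : Equiv.Perm (Fin (2 * m - 2))) (i : Fin (2 * m))
    (j : Fin (2 * m - 2)) (h : (i : ℕ) = j) (hi : (i : ℕ) % 2 = 0) :
    (phi m v i : ℕ) = v j + 1 := by
  rw [phi_apply, phiFun, dif_neg (by omega), dif_neg (by omega), dif_pos hi]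
  simp only [h]

theorem phi_odd {m : ℕ} (v : Equiv.Perm (Fin (2 * m - 2))) (i : Fin (2 * m))
    (j : Fin (2 * m - 2)) (h : (i : ℕ) = j + 2) (hi : (i : ℕ) % 2 = 1) :
    (phi m v i : ℕ) = v j + 1 := by
  rw [phi_apply, phiFun, dif_neg (by omega), dif_neg (by omega), dif_neg (by omega)]
  simp only [h, Nat.add_sub_cancel]

theorem phi_injective (m : ℕ) : Function.Injective (phi m) := by
  intro u v h
  ext i
  have hpar := Nat.mod_two_eq_zero_or_one (i : ℕ)
  rcases hpar with hi | hi
  · have h1 := phi_even u ⟨i, by omega⟩ i rfl hi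
    have h2 := phi_even v ⟨i, by omega⟩ i rfl hi
    rw [h] at h1
    omega
  · have h1 := phi_odd u ⟨i + 2, by omega⟩ i rfl (by simp only; omega)
    have h2 := phi_odd v ⟨i + 2, by omega⟩ i rfl (by simp only; omega)
    rw [h] at h1
    omega

/-- In a column not meeting the two new entries, the new valley is the valley of `v` one column to
the left, which is smaller than the valley, and so than the peak, in the same column of `v`. -/
theorem IsTwoRow.phi {m : ℕ} {v : Equiv.Perm (Fin (2 * m - 2))} (hv : IsTwoRow v) :
    IsTwoRow (phi m v) := by
  obtain ⟨h1, h2⟩ := hv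
  refine ⟨?_, ?_⟩
  · intro i j hij hp
    rw [Fin.lt_def] at hij ⊢
    rcases Nat.mod_two_eq_zero_or_one (i : ℕ) with hi | hi
    · have e1 := phi_even v i ⟨i, by omega⟩ rfl hi
      by_cases hj : (j : ℕ) = 2 * m - 2
      · have := phi_last v j hj
        omega
      · have e2 := phi_even v j ⟨j, by omega⟩ rfl (by omega)
        have := Fin.lt_def.1 (h1 ⟨i, by omega⟩ ⟨j, by omega⟩ (Fin.lt_def.2 hij) hp)
        omega
    · have e2 := phi_odd v j ⟨j - 2, by omega⟩ (by simp only; omega) (by omega)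
      by_cases hj : (i : ℕ) = 1
      · have := phi_one v i hj
        omega
      · have e1 := phi_odd v i ⟨i - 2, by omega⟩ (by simp only; omega) (by omega)
        have := Fin.lt_def.1 (h1 ⟨i - 2, by omega⟩ ⟨j - 2, by omega⟩
          (Fin.lt_def.2 (by simp only; omega)) (by simp only; omega))
        omega
  · intro i j e hi
    rw [Fin.lt_def]
    by_cases hj : (j : ℕ) = 1
    · have a1 := phi_one v j hj
      by_cases hl : (i : ℕ) = 2 * m - 2
      · have := phi_last v i hl
        omega
      · have := phi_even v i ⟨i, by omega⟩ rfl hi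
        omega
    · have a1 := phi_odd v j ⟨j - 2, by omega⟩ (by simp only; omega) (by omega)
      by_cases hl : (i : ℕ) = 2 * m - 2
      · have := phi_last v i hl
        omega
      · have a2 := phi_even v i ⟨i, by omega⟩ rfl hi
        have a3 := Fin.lt_def.1 (h1 ⟨j - 2, by omega⟩ ⟨j, by omega⟩
          (Fin.lt_def.2 (by simp only; omega)) (by simp only; omega))
        have a4 := Fin.lt_def.1 (h2 ⟨i, by omega⟩ ⟨j, by omega⟩ e hi)
        omega

/-- An odd `r` separates the peak of a column from its smaller valley. An even `r` separates
positions `r - 2` and `r + 1`, whose entries come from a single column of `v` and so are again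
decreasing. -/
theorem IsTwoRow.not_stablePrefix_phi {m r : ℕ} {v : Equiv.Perm (Fin (2 * m - 2))}
    (hv : IsTwoRow v) (hr : 0 < r) (hr' : r < 2 * m) : ¬ StablePrefix r (Elnitsky.phi m v) := by
  intro hs
  rcases Nat.mod_two_eq_zero_or_one r with hp | hp
  · have h1 := hs ⟨r - 2, by omega⟩ (by simp only; omega)
    have h2 := hs.le_apply (i := ⟨r + 1, by omega⟩) (by simp)
    have h3 := phi_even v ⟨r - 2, by omega⟩ ⟨r - 2, by omega⟩ rfl (by simp only; omega)
    have h4 := phi_odd v ⟨r + 1, by omega⟩ ⟨r - 1, by omega⟩ (by simp only; omega)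
      (by simp only; omega)
    have h5 := Fin.lt_def.1 (hv.2 ⟨r - 2, by omega⟩ ⟨r - 1, by omega⟩ (by simp only; omega)
      (by simp only; omega))
    omega
  · have h1 := hs ⟨r - 1, by omega⟩ (by simp only; omega)
    have h2 := hs.le_apply (i := ⟨r, by omega⟩) (by simp)
    have h5 := Fin.lt_def.1 (hv.phi.2 ⟨r - 1, by omega⟩ ⟨r, by omega⟩ (by simp only; omega)
      (by simp only; omega))
    omega

theorem IsTwoRow.exists_phi_eq {m : ℕ} {w : Equiv.Perm (Fin (2 * m))} (hm : 1 ≤ m)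
    (hw : IsTwoRow w) (hs : ∀ r, 0 < r → r < 2 * m → ¬ StablePrefix r w) :
    ∃ v : Equiv.Perm (Fin (2 * m - 2)), IsTwoRow v ∧ Elnitsky.phi m v = w := by
  have hle : ∀ i j : Fin (2 * m), (i : ℕ) ≤ j → (i : ℕ) % 2 = (j : ℕ) % 2 → w i ≤ w j := by
    intro i j hij hp
    rcases Nat.lt_or_eq_of_le hij with h | h
    · exact (hw.1 i j (Fin.lt_def.2 h) hp).le
    · rw [Fin.ext h]
  have hmin : ∀ i : Fin (2 * m), (i : ℕ) ≠ 1 → w ⟨1, by omega⟩ < w i := by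
    intro i hi
    rcases Nat.mod_two_eq_zero_or_one (i : ℕ) with hp | hp
    · have h1 := hw.2 i ⟨i + 1, by omega⟩ rfl hp
      exact lt_of_le_of_lt (hle _ _ (by simp) (by simp only; omega)) h1
    · exact hw.1 _ _ (Fin.lt_def.2 (by simp only; omega)) (by simp only; omega)
  have hmax : ∀ i : Fin (2 * m), (i : ℕ) ≠ 2 * m - 2 → w i < w ⟨2 * m - 2, by omega⟩ := by
    intro i hi
    rcases Nat.mod_two_eq_zero_or_one (i : ℕ) with hp | hp
    · exact hw.1 _ _ (Fin.lt_def.2 (by simp only; omega)) (by simp only; omega)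
    · have h1 := hw.2 ⟨i - 1, by omega⟩ i (by simp only; omega) (by simp only; omega)
      exact lt_of_lt_of_le h1 (hle _ _ (by simp only; omega) (by simp only; omega))
  have hw1 : (w ⟨1, by omega⟩ : ℕ) = 0 := by
    obtain ⟨i, hi⟩ := w.surjective ⟨0, by omega⟩
    by_cases h : (i : ℕ) = 1
    · have e : i = ⟨1, by omega⟩ := Fin.ext h
      rw [← e, hi]
    · have := Fin.lt_def.1 (hmin i h)
      rw [hi] at this
      simp at this
  have hwl : (w ⟨2 * m - 2, by omega⟩ : ℕ) = 2 * m - 1 := by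
    obtain ⟨i, hi⟩ := w.surjective ⟨2 * m - 1, by omega⟩
    by_cases h : (i : ℕ) = 2 * m - 2
    · have e : i = ⟨2 * m - 2, by omega⟩ := Fin.ext h
      rw [← e, hi]
    · have := Fin.lt_def.1 (hmax i h)
      rw [hi] at this
      simp only at this
      omega
  -- Otherwise the peak at `i`, which is the maximum of the first `i + 2` entries, would lie below
  -- all later entries, and this prefix would be stable.
  have hcross : ∀ i j : Fin (2 * m), (j : ℕ) = i + 3 → (i : ℕ) % 2 = 0 → w j < w i := by
    intro i j e hi
    by_contra hc
    have hij : w i < w j := lt_of_le_of_ne (not_lt.1 hc) fun e' => by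
      have := congrArg Fin.val (w.injective e')
      omega
    refine hs (i + 2) (by omega) (by omega) (stablePrefix_of_forall_lt fun a b ha hb => ?_)
    have h1 : w a ≤ w i := by
      rcases Nat.mod_two_eq_zero_or_one (a : ℕ) with hp | hp
      · exact hle _ _ (by omega) (by omega)
      · exact (hw.2 ⟨a - 1, by omega⟩ a (by simp only; omega) (by simp only; omega)).le.trans
          (hle _ _ (by simp only; omega) (by simp only; omega))
    rcases Nat.mod_two_eq_zero_or_one (b : ℕ) with hp | hp
    · exact lt_of_le_of_lt h1 (hw.1 _ _ (Fin.lt_def.2 (by omega)) (by omega))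
    · exact lt_of_le_of_lt h1 (lt_of_lt_of_le hij (hle _ _ (by omega) (by omega)))
  -- Undo the slide: peaks stay in place and valleys are read two positions further right. This
  -- skips exactly the positions of the minimum and the maximum of `w`.
  let src : Fin (2 * m - 2) → Fin (2 * m) := fun i =>
    if (i : ℕ) % 2 = 0 then ⟨i, by omega⟩ else ⟨i + 2, by omega⟩
  have hsrc : ∀ i, (src i : ℕ) = if (i : ℕ) % 2 = 0 then (i : ℕ) else i + 2 := by
    intro i
    simp only [src]
    split_ifs <;> rfl
  have hpos : ∀ i, 0 < (w (src i) : ℕ) := by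
    intro i
    have := Fin.lt_def.1 (hmin (src i) (by rw [hsrc]; split_ifs <;> omega))
    omega
  have hlt : ∀ i, (w (src i) : ℕ) < 2 * m - 1 := by
    intro i
    have := Fin.lt_def.1 (hmax (src i) (by rw [hsrc]; split_ifs <;> omega))
    omega
  let f : Fin (2 * m - 2) → Fin (2 * m - 2) := fun i =>
    ⟨w (src i) - 1, by have := hpos i; have := hlt i; omega⟩
  have hf : ∀ i, (f i : ℕ) + 1 = w (src i) := fun i => by
    have := hpos i
    simp only [f]
    omega
  have hinj : Function.Injective f := by
    intro i j e
    have h1 := hf i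
    rw [e, hf j] at h1
    have h2 := congrArg Fin.val (w.injective (Fin.ext h1))
    rw [hsrc, hsrc] at h2
    apply Fin.ext
    split_ifs at h2 <;> omega
  have hflt : ∀ i j, w (src i) < w (src j) → f i < f j := by
    intro i j h
    rw [Fin.lt_def] at h ⊢
    have := hf i
    have := hf j
    omega
  refine ⟨Equiv.ofBijective f (Finite.injective_iff_bijective.1 hinj), ⟨?_, ?_⟩, ?_⟩
  · intro i j hij hp
    rw [Fin.lt_def] at hij
    refine hflt i j (hw.1 _ _ (Fin.lt_def.2 ?_) ?_) <;> rw [hsrc, hsrc] <;> split_ifs <;> omega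
  · intro i j e hi
    refine hflt j i (hcross _ _ ?_ ?_)
    · rw [hsrc, hsrc, if_pos hi, if_neg (by omega)]
      omega
    · rw [hsrc, if_pos hi, hi]
  · ext i
    by_cases h1 : (i : ℕ) = 1
    · have e : i = ⟨1, by omega⟩ := Fin.ext h1
      rw [phi_one _ _ h1, e, hw1]
    by_cases h2 : (i : ℕ) = 2 * m - 2
    · have e : i = ⟨2 * m - 2, by omega⟩ := Fin.ext h2
      rw [phi_last _ _ h2, e, hwl]
    rcases Nat.mod_two_eq_zero_or_one (i : ℕ) with hp | hp
    · rw [phi_even _ i ⟨i, by omega⟩ rfl hp]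
      refine (hf _).trans ?_
      congr
      apply Fin.ext
      rw [hsrc, if_pos hp]
    · rw [phi_odd _ i ⟨i - 2, by omega⟩ (by simp only; omega) hp]
      refine (hf _).trans ?_
      congr
      apply Fin.ext
      rw [hsrc, if_neg (by simp only; omega)]
      simp only
      omega

theorem bijOn_phi (m : ℕ) (hm : 1 ≤ m) :
    Set.BijOn (phi m)
      {v : Equiv.Perm (Fin (2 * m - 2)) | Avoids321 v ∧ IsAlternating v}
      {w : Equiv.Perm (Fin (2 * m)) | IsFullySupported w ∧ Avoids321 w ∧ IsAlternating w} := by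
  have key : ∀ v : Equiv.Perm (Fin (2 * m - 2)), Avoids321 v ∧ IsAlternating v ↔ IsTwoRow v := by
    have e : 2 * m - 2 = 2 * (m - 1) := by omega
    rw [e]
    exact avoids321_and_isAlternating_iff
  refine ⟨?_, (phi_injective m).injOn, ?_⟩
  · intro v hv
    have hv := (key v).1 hv
    exact ⟨(isFullySupported_iff _).2 fun r h1 h2 => hv.not_stablePrefix_phi h1 h2,
      (avoids321_and_isAlternating_iff _).2 hv.phi⟩
  · rintro w ⟨h1, h2⟩
    obtain ⟨v, hv, e⟩ := ((avoids321_and_isAlternating_iff _).1 h2).exists_phi_eq hm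
      ((isFullySupported_iff _).1 h1)
    exact ⟨v, (key v).2 hv, e⟩

theorem ncard_isFullySupported_avoids321_isAlternating (m : ℕ) (hm : 1 ≤ m) :
    {w : Equiv.Perm (Fin (2 * m)) |
      IsFullySupported w ∧ Avoids321 w ∧ IsAlternating w}.ncard = catalan (m - 1) := by
  have h := bijOn_phi m hm
  rw [← h.image_eq, h.injOn.ncard_image]
  have e : 2 * m - 2 = 2 * (m - 1) := by omega
  rw [e, ← ncard_isTwoRow]
  simp only [avoids321_and_isAlternating_iff]

/-! ### Directions and vertices. -/

theorem dir_re {n : ℕ} (θ : Fin n → ℝ) (a : Fin n) : (dir θ a).re = Real.cos (θ a) :=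
  Complex.exp_ofReal_mul_I_re _

theorem dir_im {n : ℕ} (θ : Fin n → ℝ) (a : Fin n) : (dir θ a).im = Real.sin (θ a) :=
  Complex.exp_ofReal_mul_I_im _

theorem dir_im_neg {n : ℕ} {θ : Fin n → ℝ} (hθ : IsAdmissible θ) (a : Fin n) :
    (dir θ a).im < 0 := by
  rw [dir_im]
  obtain ⟨h1, h2⟩ := hθ.2 a
  have h := Real.sin_pos_of_pos_of_lt_pi (x := θ a - Real.pi) (by linarith) (by linarith)
  rw [Real.sin_sub_pi] at h
  linarith

/-- The cross product of the directions of the sides labeled `a` and `b`. -/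
noncomputable def cross {n : ℕ} (θ : Fin n → ℝ) (a b : Fin n) : ℝ :=
  (dir θ a).re * (dir θ b).im - (dir θ a).im * (dir θ b).re

/-- The cross product is the sine of `θ b - θ a`, an angle strictly between 0 and `π`. -/
theorem cross_pos {n : ℕ} {θ : Fin n → ℝ} (hθ : IsAdmissible θ) {a b : Fin n} (h : a < b) :
    0 < cross θ a b := by
  have hlt := hθ.1 h
  obtain ⟨h1, h2⟩ := hθ.2 a
  obtain ⟨h3, h4⟩ := hθ.2 b
  have h := Real.sin_pos_of_pos_of_lt_pi (x := θ b - θ a) (by linarith) (by linarith)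
  rw [Real.sin_sub] at h
  rw [cross, dir_re, dir_re, dir_im, dir_im]
  linarith

theorem cross_comm {n : ℕ} (θ : Fin n → ℝ) (a b : Fin n) : cross θ a b = - cross θ b a := by
  unfold cross
  ring

theorem eq_of_cross_eq_zero {n : ℕ} {θ : Fin n → ℝ} (hθ : IsAdmissible θ) {a b : Fin n}
    (h : cross θ a b = 0) : a = b := by
  rcases lt_trichotomy a b with hab | hab | hab
  · exact absurd h (cross_pos hθ hab).ne'
  · exact hab
  · rw [cross_comm] at h
    have := cross_pos hθ hab
    linarith

theorem dir_injective {n : ℕ} {θ : Fin n → ℝ} (hθ : IsAdmissible θ) :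
    Function.Injective (dir θ) := by
  intro a b h
  refine eq_of_cross_eq_zero hθ ?_
  rw [cross, h]
  ring

theorem dir_ne_zero {n : ℕ} {θ : Fin n → ℝ} (hθ : IsAdmissible θ) (a : Fin n) : dir θ a ≠ 0 := by
  intro h
  have := dir_im_neg hθ a
  rw [h] at this
  simp at this

theorem vertex_zero {n : ℕ} (θ : Fin n → ℝ) (u : Equiv.Perm (Fin n)) : vertex θ u 0 = 0 := by
  simp [vertex]

theorem vertex_succ {n : ℕ} (θ : Fin n → ℝ) (u : Equiv.Perm (Fin n)) {k : ℕ} (hk : k < n) :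
    vertex θ u (k + 1) = vertex θ u k + dir θ (u ⟨k, hk⟩) := by
  unfold vertex
  have : (Finset.univ.filter fun i : Fin n => i.val < k + 1) =
      insert ⟨k, hk⟩ (Finset.univ.filter fun i : Fin n => i.val < k) := by
    ext i
    simp only [Finset.mem_filter, Finset.mem_univ, true_and, Finset.mem_insert, Fin.ext_iff]
    omega
  rw [this, Finset.sum_insert (by simp), add_comm]

theorem vertex_last {n : ℕ} (θ : Fin n → ℝ) (u : Equiv.Perm (Fin n)) :
    vertex θ u n = ∑ i, dir θ i := by
  unfold vertex
  rw [Finset.filter_true_of_mem fun i _ => i.is_lt]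
  exact Equiv.sum_comp u (dir θ)

theorem vertex_im_lt {n : ℕ} {θ : Fin n → ℝ} (hθ : IsAdmissible θ) (u : Equiv.Perm (Fin n))
    {j k : ℕ} (hjk : j < k) (hk : k ≤ n) : (vertex θ u k).im < (vertex θ u j).im := by
  induction k with
  | zero => omega
  | succ k ih =>
    have h1 : (vertex θ u (k + 1)).im < (vertex θ u k).im := by
      rw [vertex_succ θ u hk, Complex.add_im]
      linarith [dir_im_neg hθ (u ⟨k, hk⟩)]
    rcases Nat.lt_or_eq_of_le (Nat.le_of_lt_succ hjk) with h | h
    · exact h1.trans (ih h (by omega))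
    · rwa [h]

theorem vertex_im_le {n : ℕ} {θ : Fin n → ℝ} (hθ : IsAdmissible θ) (u : Equiv.Perm (Fin n))
    {j k : ℕ} (hjk : j ≤ k) (hk : k ≤ n) : (vertex θ u k).im ≤ (vertex θ u j).im := by
  rcases Nat.lt_or_eq_of_le hjk with h | h
  · exact (vertex_im_lt hθ u h hk).le
  · rw [h]

/-! ### Boundary paths as graphs over the vertical axis. -/

/-- The real part of the point at height `y` of the path with labels `u(1), …, u(n)`. -/
noncomputable def profile {n : ℕ} (θ : Fin n → ℝ) (u : Equiv.Perm (Fin n)) (y : ℝ) : ℝ :=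
  ∑ i : Fin n, max 0 (min 1 (((vertex θ u i).im - y) / -(dir θ (u i)).im)) * (dir θ (u i)).re

theorem continuous_profile {n : ℕ} (θ : Fin n → ℝ) (u : Equiv.Perm (Fin n)) :
    Continuous (profile θ u) := by
  unfold profile
  fun_prop

/-- The clamped quotient in `profile` is the fraction of side `i` lying above the height in
question. As the vertices descend, it is 1 before side `k`, 0 after it, and `s` on it. -/
theorem profile_side {n : ℕ} {θ : Fin n → ℝ} (hθ : IsAdmissible θ) (u : Equiv.Perm (Fin n))
    {k : ℕ} (hk : k < n) {s : ℝ} (h0 : 0 ≤ s) (h1 : s ≤ 1) :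
    profile θ u ((vertex θ u k).im + s * (dir θ (u ⟨k, hk⟩)).im) =
      (vertex θ u k).re + s * (dir θ (u ⟨k, hk⟩)).re := by
  have hd := dir_im_neg hθ (u ⟨k, hk⟩)
  have hterm : ∀ i : Fin n, max 0 (min 1 (((vertex θ u i).im -
      ((vertex θ u k).im + s * (dir θ (u ⟨k, hk⟩)).im)) / -(dir θ (u i)).im)) * (dir θ (u i)).re =
      (if (i : ℕ) < k then (dir θ (u i)).re else 0) +
        (if i = ⟨k, hk⟩ then s * (dir θ (u ⟨k, hk⟩)).re else 0) := by
    intro i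
    have hdi := dir_im_neg hθ (u i)
    rcases lt_trichotomy (i : ℕ) k with h | h | h
    · rw [if_pos h, if_neg (fun e => by rw [e] at h; simp at h), add_zero]
      have h2 := vertex_im_le hθ u (Nat.succ_le_of_lt h) hk.le
      rw [Nat.succ_eq_add_one, vertex_succ θ u i.is_lt, Complex.add_im, Fin.eta] at h2
      have h3 : 1 ≤ ((vertex θ u i).im -
          ((vertex θ u k).im + s * (dir θ (u ⟨k, hk⟩)).im)) / -(dir θ (u i)).im := by
        rw [le_div_iff₀ (by linarith)]
        nlinarith
      rw [min_eq_left h3, max_eq_right zero_le_one, one_mul]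
    · have hi : i = ⟨k, hk⟩ := Fin.ext h
      subst hi
      rw [if_neg (by simp), if_pos rfl, zero_add]
      congr 1
      have : ((vertex θ u k).im - ((vertex θ u k).im + s * (dir θ (u ⟨k, hk⟩)).im)) /
          -(dir θ (u ⟨k, hk⟩)).im = s := by
        have := hd.ne
        field_simp
        ring
      rw [this, min_eq_right h1, max_eq_right h0]
    · rw [if_neg (by omega), if_neg (fun e => by rw [e] at h; simp at h), add_zero]
      have h2 := vertex_im_le hθ u (Nat.succ_le_of_lt h) i.is_lt.le
      rw [Nat.succ_eq_add_one, vertex_succ θ u hk, Complex.add_im] at h2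
      have h3 : ((vertex θ u i).im -
          ((vertex θ u k).im + s * (dir θ (u ⟨k, hk⟩)).im)) / -(dir θ (u i)).im ≤ 0 := by
        refine div_nonpos_of_nonpos_of_nonneg ?_ (by linarith)
        nlinarith
      rw [max_eq_left ((min_le_right _ _).trans h3), zero_mul]
  unfold profile
  rw [Finset.sum_congr rfl fun i _ => hterm i, Finset.sum_add_distrib, ← Finset.sum_filter,
    Finset.sum_ite_eq', if_pos (Finset.mem_univ _), vertex, Complex.re_sum]

theorem exists_profile_eq {n : ℕ} {θ : Fin n → ℝ} (hθ : IsAdmissible θ) (u : Equiv.Perm (Fin n))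
    {k : ℕ} (hk : k < n) {y : ℝ} (h0 : (vertex θ u (k + 1)).im ≤ y) (h1 : y ≤ (vertex θ u k).im) :
    ∃ s : ℝ, 0 ≤ s ∧ s ≤ 1 ∧ (⟨profile θ u y, y⟩ : ℂ) = vertex θ u k + s * dir θ (u ⟨k, hk⟩) := by
  have hd := dir_im_neg hθ (u ⟨k, hk⟩)
  rw [vertex_succ θ u hk, Complex.add_im] at h0
  obtain ⟨s, hs⟩ : ∃ s, y = (vertex θ u k).im + s * (dir θ (u ⟨k, hk⟩)).im :=
    ⟨(y - (vertex θ u k).im) / (dir θ (u ⟨k, hk⟩)).im, by have := hd.ne; field_simp; ring⟩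
  have hs0 : 0 ≤ s := by nlinarith
  have hs1 : s ≤ 1 := by nlinarith
  refine ⟨s, hs0, hs1, ?_⟩
  apply Complex.ext
  · simp only [Complex.add_re, Complex.re_ofReal_mul]
    rw [hs, profile_side hθ u hk hs0 hs1]
  · simp only [Complex.add_im, Complex.im_ofReal_mul]
    exact hs

theorem exists_side_of_height {n : ℕ} (θ : Fin n → ℝ) (u : Equiv.Perm (Fin n)) (hn : 0 < n) {y : ℝ}
    (h0 : (vertex θ u n).im ≤ y) (h1 : y ≤ 0) :
    ∃ k < n, (vertex θ u (k + 1)).im ≤ y ∧ y ≤ (vertex θ u k).im := by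
  classical
  have hex : ∃ k, k < n ∧ (vertex θ u (k + 1)).im ≤ y :=
    ⟨n - 1, by omega, by rwa [Nat.sub_add_cancel hn]⟩
  obtain ⟨h2, h3⟩ := Nat.find_spec hex
  refine ⟨Nat.find hex, h2, h3, ?_⟩
  rcases h : Nat.find hex with _ | k
  · rwa [vertex_zero, Complex.zero_im]
  · by_contra hc
    exact Nat.find_min hex (m := k) (by omega) ⟨by omega, (not_le.1 hc).le⟩

theorem mem_segment_add {a d z : ℂ} :
    z ∈ segment ℝ a (a + d) ↔ ∃ s : ℝ, 0 ≤ s ∧ s ≤ 1 ∧ z = a + s * d := by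
  rw [segment_eq_image']
  simp only [add_sub_cancel_left, Set.mem_image, Set.mem_Icc, Complex.real_smul, and_assoc]
  exact ⟨fun ⟨s, h0, h1, e⟩ => ⟨s, h0, h1, e.symm⟩, fun ⟨s, h0, h1, e⟩ => ⟨s, h0, h1, e.symm⟩⟩

theorem mem_path_iff {n : ℕ} {θ : Fin n → ℝ} (hθ : IsAdmissible θ) (u : Equiv.Perm (Fin n))
    (hn : 0 < n) {z : ℂ} :
    z ∈ path θ u ↔ (∑ i, dir θ i).im ≤ z.im ∧ z.im ≤ 0 ∧ z.re = profile θ u z.im := by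
  rw [← vertex_last θ u]
  constructor
  · rintro ⟨k, hk, hz⟩
    rw [vertex_succ θ u hk, mem_segment_add] at hz
    obtain ⟨s, h0, h1, rfl⟩ := hz
    have hd := dir_im_neg hθ (u ⟨k, hk⟩)
    have h2 := vertex_im_le hθ u (Nat.succ_le_of_lt hk) le_rfl
    have h3 := vertex_im_le hθ u (Nat.zero_le k) hk.le
    rw [Nat.succ_eq_add_one, vertex_succ θ u hk, Complex.add_im] at h2
    rw [vertex_zero, Complex.zero_im] at h3
    simp only [Complex.add_im, Complex.add_re, Complex.im_ofReal_mul, Complex.re_ofReal_mul]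
    exact ⟨by nlinarith, by nlinarith, (profile_side hθ u hk h0 h1).symm⟩
  · rintro ⟨h0, h1, h2⟩
    obtain ⟨k, hk, h3, h4⟩ := exists_side_of_height θ u hn h0 h1
    obtain ⟨s, hs0, hs1, e⟩ := exists_profile_eq hθ u hk h3 h4
    refine ⟨k, hk, ?_⟩
    rw [vertex_succ θ u hk, mem_segment_add]
    exact ⟨s, hs0, hs1, by rw [← e, ← h2]⟩

/-- Since each path has a single point at each height, the region is cut out by inequalities between
continuous functions. All later containments are checked in this form. -/
theorem mem_region_iff {n : ℕ} {θ : Fin n → ℝ} (hθ : IsAdmissible θ) (w : Equiv.Perm (Fin n))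
    (hn : 0 < n) {z : ℂ} :
    z ∈ region θ w ↔ (∑ i, dir θ i).im ≤ z.im ∧ z.im ≤ 0 ∧
      profile θ 1 z.im ≤ z.re ∧ z.re ≤ profile θ w z.im := by
  constructor
  · rintro ⟨p, hp, q, hq, h1, h2, h3, h4⟩
    rw [mem_path_iff hθ _ hn] at hp hq
    rw [h1] at hp
    rw [h2] at hq
    exact ⟨hp.1, hp.2.1, hp.2.2 ▸ h3, hq.2.2 ▸ h4⟩
  · rintro ⟨h1, h2, h3, h4⟩
    exact ⟨⟨profile θ 1 z.im, z.im⟩, (mem_path_iff hθ _ hn).2 ⟨h1, h2, rfl⟩,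
      ⟨profile θ w z.im, z.im⟩, (mem_path_iff hθ _ hn).2 ⟨h1, h2, rfl⟩, rfl, rfl, h3, h4⟩

theorem isClosed_region {n : ℕ} {θ : Fin n → ℝ} (hθ : IsAdmissible θ) (w : Equiv.Perm (Fin n))
    (hn : 0 < n) : IsClosed (region θ w) := by
  have : region θ w = {z : ℂ | (∑ i, dir θ i).im ≤ z.im ∧ z.im ≤ 0 ∧
      profile θ 1 z.im ≤ z.re ∧ z.re ≤ profile θ w z.im} :=
    Set.ext fun z => mem_region_iff hθ w hn
  rw [this]
  have c1 : Continuous fun z : ℂ => profile θ 1 z.im :=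
    (continuous_profile θ 1).comp Complex.continuous_im
  have c2 : Continuous fun z : ℂ => profile θ w z.im :=
    (continuous_profile θ w).comp Complex.continuous_im
  exact (isClosed_le continuous_const Complex.continuous_im).inter
    ((isClosed_le Complex.continuous_im continuous_const).inter
      ((isClosed_le c1 Complex.continuous_re).inter (isClosed_le Complex.continuous_re c2)))

/-! ### Coordinates on a tile. -/

namespace Tile

variable {n : ℕ} (θ : Fin n → ℝ) (t : Tile n)

/-- The coordinate of `z` along the direction labeled `t.a`, measured from the top of `t`. -/
noncomputable def coordA (z : ℂ) : ℝ :=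
  ((z.re - t.top.re) * (dir θ t.b).im - (z.im - t.top.im) * (dir θ t.b).re) / cross θ t.a t.b

/-- The coordinate of `z` along the direction labeled `t.b`, measured from the top of `t`. -/
noncomputable def coordB (z : ℂ) : ℝ :=
  ((z.im - t.top.im) * (dir θ t.a).re - (z.re - t.top.re) * (dir θ t.a).im) / cross θ t.a t.b

theorem continuous_coordA : Continuous (t.coordA θ) := by
  unfold coordA
  fun_prop

theorem continuous_coordB : Continuous (t.coordB θ) := by
  unfold coordB
  fun_prop

end Tile

namespace Tile

theorem add_coord {n : ℕ} {θ : Fin n → ℝ} (hθ : IsAdmissible θ) (t : Tile n) (z : ℂ) :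
    t.top + (t.coordA θ z : ℂ) * dir θ t.a + (t.coordB θ z : ℂ) * dir θ t.b = z := by
  have hc := (cross_pos hθ t.lt).ne'
  apply Complex.ext
  · simp only [Complex.add_re, Complex.re_ofReal_mul, coordA, coordB]
    field_simp
    unfold cross
    ring
  · simp only [Complex.add_im, Complex.im_ofReal_mul, coordA, coordB]
    field_simp
    unfold cross
    ring

theorem coordA_apply {n : ℕ} {θ : Fin n → ℝ} (hθ : IsAdmissible θ) (t : Tile n) (x y : ℝ) :
    t.coordA θ (t.top + (x : ℂ) * dir θ t.a + (y : ℂ) * dir θ t.b) = x := by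
  have hc := (cross_pos hθ t.lt).ne'
  simp only [Complex.add_re, Complex.re_ofReal_mul, Complex.add_im, Complex.im_ofReal_mul, coordA]
  rw [div_eq_iff hc]
  unfold cross
  ring

theorem coordB_apply {n : ℕ} {θ : Fin n → ℝ} (hθ : IsAdmissible θ) (t : Tile n) (x y : ℝ) :
    t.coordB θ (t.top + (x : ℂ) * dir θ t.a + (y : ℂ) * dir θ t.b) = y := by
  have hc := (cross_pos hθ t.lt).ne'
  simp only [Complex.add_re, Complex.re_ofReal_mul, Complex.add_im, Complex.im_ofReal_mul, coordB]
  rw [div_eq_iff hc]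
  unfold cross
  ring

theorem mem_carrier_iff {n : ℕ} {θ : Fin n → ℝ} (hθ : IsAdmissible θ) (t : Tile n) {z : ℂ} :
    z ∈ t.carrier θ ↔ (0 ≤ t.coordA θ z ∧ t.coordA θ z ≤ 1) ∧
      0 ≤ t.coordB θ z ∧ t.coordB θ z ≤ 1 := by
  constructor
  · rintro ⟨x, hx, y, hy, rfl⟩
    rw [coordA_apply hθ, coordB_apply hθ]
    exact ⟨hx, hy⟩
  · rintro ⟨hx, hy⟩
    exact ⟨_, hx, _, hy, (add_coord hθ t z).symm⟩

theorem mem_inner_iff {n : ℕ} {θ : Fin n → ℝ} (hθ : IsAdmissible θ) (t : Tile n) {z : ℂ} :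
    z ∈ t.inner θ ↔ (0 < t.coordA θ z ∧ t.coordA θ z < 1) ∧
      0 < t.coordB θ z ∧ t.coordB θ z < 1 := by
  constructor
  · rintro ⟨x, hx, y, hy, rfl⟩
    rw [coordA_apply hθ, coordB_apply hθ]
    exact ⟨hx, hy⟩
  · rintro ⟨hx, hy⟩
    exact ⟨_, hx, _, hy, (add_coord hθ t z).symm⟩

theorem inner_subset_carrier {n : ℕ} (θ : Fin n → ℝ) (t : Tile n) : t.inner θ ⊆ t.carrier θ := by
  rintro z ⟨x, hx, y, hy, rfl⟩
  exact ⟨x, Set.Ioo_subset_Icc_self hx, y, Set.Ioo_subset_Icc_self hy, rfl⟩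

theorem isOpen_inner {n : ℕ} {θ : Fin n → ℝ} (hθ : IsAdmissible θ) (t : Tile n) :
    IsOpen (t.inner θ) := by
  have h : t.inner θ = {z | (0 < t.coordA θ z ∧ t.coordA θ z < 1) ∧
      0 < t.coordB θ z ∧ t.coordB θ z < 1} := Set.ext fun z => t.mem_inner_iff hθ
  rw [h]
  have cA := t.continuous_coordA θ
  have cB := t.continuous_coordB θ
  exact ((isOpen_lt continuous_const cA).inter (isOpen_lt cA continuous_const)).inter
    ((isOpen_lt continuous_const cB).inter (isOpen_lt cB continuous_const))

/-- A tile is contained in the closure of its interior: move slightly from the given point towards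
the centre. -/
theorem nonempty_inter_inner {n : ℕ} {θ : Fin n → ℝ} (t : Tile n)
    {s : Set ℂ} (hs : IsOpen s) {z : ℂ} (hz : z ∈ t.carrier θ) (hzs : z ∈ s) :
    ∃ q ∈ s, q ∈ t.inner θ := by
  obtain ⟨x, hx, y, hy, rfl⟩ := hz
  let f : ℝ → ℂ := fun e => t.top + (((1 - e) * x + e * (1 / 2) : ℝ) : ℂ) * dir θ t.a +
    (((1 - e) * y + e * (1 / 2) : ℝ) : ℂ) * dir θ t.b
  have hf : Continuous f := by
    simp only [f]
    fun_prop
  have h0 : f 0 ∈ s := by simpa [f] using hzs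
  have h1 : ∀ᶠ e in nhdsWithin (0 : ℝ) (Set.Ioi 0), f e ∈ s :=
    (hf.continuousAt.eventually_mem (hs.mem_nhds h0)).filter_mono nhdsWithin_le_nhds
  have h2 : ∀ᶠ e in nhdsWithin (0 : ℝ) (Set.Ioi 0), e ∈ Set.Ioo (0 : ℝ) 1 :=
    Ioo_mem_nhdsGT one_pos
  obtain ⟨e, he, he0, he1⟩ := (h1.and h2).exists
  obtain ⟨hx0, hx1⟩ := hx
  obtain ⟨hy0, hy1⟩ := hy
  exact ⟨f e, he, _, ⟨by nlinarith, by nlinarith⟩, _, ⟨by nlinarith, by nlinarith⟩, rfl⟩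

/-- Moving horizontally to the right decreases the first and increases the second coordinate. -/
theorem exists_coord_add {n : ℕ} {θ : Fin n → ℝ} (hθ : IsAdmissible θ) (t : Tile n) :
    ∃ α > 0, ∃ β > 0, ∀ (z : ℂ) (e : ℝ), t.coordA θ (z + e) = t.coordA θ z - e * α ∧
      t.coordB θ (z + e) = t.coordB θ z + e * β := by
  have hc := cross_pos hθ t.lt
  refine ⟨-(dir θ t.b).im / cross θ t.a t.b, div_pos (by linarith [dir_im_neg hθ t.b]) hc,
    -(dir θ t.a).im / cross θ t.a t.b, div_pos (by linarith [dir_im_neg hθ t.a]) hc,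
    fun z e => ⟨?_, ?_⟩⟩
  · simp only [coordA, Complex.add_re, Complex.add_im, Complex.ofReal_re, Complex.ofReal_im]
    field_simp
    ring
  · simp only [coordB, Complex.add_re, Complex.add_im, Complex.ofReal_re, Complex.ofReal_im]
    field_simp
    ring

/-- Points slightly to the left of a point of the right boundary of a tile. -/
theorem eventually_sub_mem_inner {n : ℕ} {θ : Fin n → ℝ} (hθ : IsAdmissible θ) (t : Tile n) {z : ℂ}
    (hA : 0 ≤ t.coordA θ z ∧ t.coordA θ z < 1) (hB : 0 < t.coordB θ z ∧ t.coordB θ z ≤ 1) :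
    ∀ᶠ e : ℝ in nhdsWithin 0 (Set.Ioi 0), z - e ∈ t.inner θ := by
  obtain ⟨α, hα, β, hβ, h⟩ := t.exists_coord_add hθ
  have h1 : ∀ᶠ e : ℝ in nhdsWithin 0 (Set.Ioi 0), e ∈ Set.Ioo 0 ((1 - t.coordA θ z) / α) :=
    Ioo_mem_nhdsGT (div_pos (by linarith) hα)
  have h2 : ∀ᶠ e : ℝ in nhdsWithin 0 (Set.Ioi 0), e ∈ Set.Ioo 0 (t.coordB θ z / β) :=
    Ioo_mem_nhdsGT (div_pos hB.1 hβ)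
  filter_upwards [h1, h2] with e he1 he2
  have h3 := h z (-e)
  rw [Complex.ofReal_neg, ← sub_eq_add_neg] at h3
  rw [mem_inner_iff hθ, h3.1, h3.2]
  have h4 := (lt_div_iff₀ hα).1 he1.2
  have h5 := (lt_div_iff₀ hβ).1 he2.2
  have h6 := mul_pos he1.1 hα
  have h7 := mul_pos he1.1 hβ
  refine ⟨⟨?_, ?_⟩, ?_, ?_⟩ <;> linarith [hA.1, hB.2]

/-- Points slightly to the right of a point of the left boundary of a tile. -/
theorem eventually_add_mem_inner {n : ℕ} {θ : Fin n → ℝ} (hθ : IsAdmissible θ) (t : Tile n) {z : ℂ}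
    (hA : 0 < t.coordA θ z ∧ t.coordA θ z ≤ 1) (hB : 0 ≤ t.coordB θ z ∧ t.coordB θ z < 1) :
    ∀ᶠ e : ℝ in nhdsWithin 0 (Set.Ioi 0), z + e ∈ t.inner θ := by
  obtain ⟨α, hα, β, hβ, h⟩ := t.exists_coord_add hθ
  have h1 : ∀ᶠ e : ℝ in nhdsWithin 0 (Set.Ioi 0), e ∈ Set.Ioo 0 (t.coordA θ z / α) :=
    Ioo_mem_nhdsGT (div_pos hA.1 hα)
  have h2 : ∀ᶠ e : ℝ in nhdsWithin 0 (Set.Ioi 0), e ∈ Set.Ioo 0 ((1 - t.coordB θ z) / β) :=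
    Ioo_mem_nhdsGT (div_pos (by linarith) hβ)
  filter_upwards [h1, h2] with e he1 he2
  have h3 := h z e
  rw [mem_inner_iff hθ, h3.1, h3.2]
  have h4 := (lt_div_iff₀ hα).1 he1.2
  have h5 := (lt_div_iff₀ hβ).1 he2.2
  have h6 := mul_pos he1.1 hα
  have h7 := mul_pos he1.1 hβ
  refine ⟨⟨?_, ?_⟩, ?_, ?_⟩ <;> linarith [hA.2, hB.1]

end Tile

/-! ### Corner tiles and flips of the rightside boundary. -/

/-- The tile below the sides `k` and `k + 1` of the rightside boundary, for a descent `k`. -/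
noncomputable def cornerTile {n : ℕ} (θ : Fin n → ℝ) (w : Equiv.Perm (Fin n)) (k : ℕ)
    (hk : k + 1 < n) (h : IsDescent w k hk) : Tile n :=
  ⟨vertex θ w k, w ⟨k + 1, hk⟩, w ⟨k, Nat.lt_of_succ_lt hk⟩, h⟩

section Flip

variable {n : ℕ} (θ : Fin n → ℝ) (w : Equiv.Perm (Fin n)) {k : ℕ} (hk : k + 1 < n)

theorem mul_simpleRefl_left :
    (w * simpleRefl k hk) ⟨k, Nat.lt_of_succ_lt hk⟩ = w ⟨k + 1, hk⟩ := by
  rw [Equiv.Perm.mul_apply, simpleRefl_left]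

theorem mul_simpleRefl_right :
    (w * simpleRefl k hk) ⟨k + 1, hk⟩ = w ⟨k, Nat.lt_of_succ_lt hk⟩ := by
  rw [Equiv.Perm.mul_apply, simpleRefl_right]

theorem mul_simpleRefl_of_ne {i : Fin n} (h : (i : ℕ) ≠ k) (h' : (i : ℕ) ≠ k + 1) :
    (w * simpleRefl k hk) i = w i := by
  rw [Equiv.Perm.mul_apply, simpleRefl_of_ne hk h h']

theorem vertex_mul_simpleRefl {j : ℕ} (hj : j ≠ k + 1) :
    vertex θ (w * simpleRefl k hk) j = vertex θ w j := by
  unfold vertex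
  refine Finset.sum_equiv (simpleRefl k hk) (fun i => ?_) (fun i _ => rfl)
  simp only [Finset.mem_filter, Finset.mem_univ, true_and, simpleRefl_val]
  split_ifs <;> omega

theorem vertex_add_one : vertex θ w (k + 1) =
    vertex θ w k + dir θ (w ⟨k, Nat.lt_of_succ_lt hk⟩) := vertex_succ θ w _

theorem vertex_add_two : vertex θ w (k + 2) =
    vertex θ w k + dir θ (w ⟨k + 1, hk⟩) + dir θ (w ⟨k, Nat.lt_of_succ_lt hk⟩) := by
  rw [vertex_succ θ w hk, vertex_succ θ w (Nat.lt_of_succ_lt hk)]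
  ring

theorem vertex_mul_simpleRefl_add_one : vertex θ (w * simpleRefl k hk) (k + 1) =
    vertex θ w k + dir θ (w ⟨k + 1, hk⟩) := by
  rw [vertex_add_one _ _ hk, vertex_mul_simpleRefl _ _ _ (by omega), mul_simpleRefl_left]

theorem side_mul_simpleRefl {j : ℕ} (h : j ≠ k) (h' : j ≠ k + 1) :
    side θ (w * simpleRefl k hk) j = side θ w j := by
  unfold side
  rw [vertex_mul_simpleRefl _ _ _ h', vertex_mul_simpleRefl _ _ _ (by omega)]

end Flip

/-- A flip moves only the vertex `k + 1`, so the two paths can differ only strictly between the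
heights of the vertices `k` and `k + 2`. -/
theorem profile_mul_simpleRefl_of_le {n : ℕ} {θ : Fin n → ℝ} (hθ : IsAdmissible θ)
    (w : Equiv.Perm (Fin n)) {k : ℕ} (hk : k + 1 < n) {y : ℝ}
    (h0 : (∑ i, dir θ i).im ≤ y) (h1 : y ≤ 0)
    (h : y ≤ (vertex θ w (k + 2)).im ∨ (vertex θ w k).im ≤ y) :
    profile θ (w * simpleRefl k hk) y = profile θ w y := by
  rw [← vertex_last θ w] at h0
  have hv1 := vertex_im_lt hθ w (show k < k + 1 by omega) hk.le
  have hv2 := vertex_im_lt hθ w (show k + 1 < k + 2 by omega) hk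
  obtain ⟨j, hj, h2, h3⟩ := exists_side_of_height θ w (by omega) h0 h1
  by_cases e1 : j = k
  · subst e1
    have hy : y = (vertex θ w j).im := by
      rcases h with h | h <;> linarith
    have a1 := profile_side hθ w hj le_rfl zero_le_one
    have a2 := profile_side hθ (w * simpleRefl j hk) hj le_rfl zero_le_one
    rw [vertex_mul_simpleRefl _ _ _ (by omega)] at a2
    simp only [zero_mul, add_zero] at a1 a2
    rw [hy, a1, a2]
  by_cases e2 : j = k + 1
  · subst e2
    have hy : y = (vertex θ w (k + 2)).im := by
      change (vertex θ w (k + 2)).im ≤ y at h2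
      rcases h with h | h <;> linarith
    have a1 := profile_side hθ w hj zero_le_one le_rfl
    have a2 := profile_side hθ (w * simpleRefl k hk) hj zero_le_one le_rfl
    simp only [one_mul] at a1 a2
    rw [← Complex.add_re, ← Complex.add_im, ← vertex_succ] at a1 a2
    rw [vertex_mul_simpleRefl _ _ _ (by omega)] at a2
    rw [hy, a1, a2]
  · obtain ⟨s, hs0, hs1, e⟩ := exists_profile_eq hθ w hj h2 h3
    have a1 := profile_side hθ (w * simpleRefl k hk) hj hs0 hs1
    have e3 := congrArg Complex.im e
    have e4 := congrArg Complex.re e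
    simp only [Complex.add_im, Complex.im_ofReal_mul, Complex.add_re, Complex.re_ofReal_mul]
      at e3 e4
    rw [vertex_mul_simpleRefl _ _ _ e2, mul_simpleRefl_of_ne w hk e1 e2, ← e3, ← e4] at a1
    exact a1

section CornerTile

variable {n : ℕ} {θ : Fin n → ℝ} (w : Equiv.Perm (Fin n)) {k : ℕ}
  (hk : k + 1 < n) (hd : IsDescent w k hk)

theorem cornerTile_coord_right (hθ : IsAdmissible θ) {y : ℝ} (h0 : (vertex θ w (k + 2)).im ≤ y)
    (h1 : y ≤ (vertex θ w k).im) :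
    ((cornerTile θ w k hk hd).coordA θ ⟨profile θ w y, y⟩ = 0 ∧
      0 ≤ (cornerTile θ w k hk hd).coordB θ ⟨profile θ w y, y⟩ ∧
        (cornerTile θ w k hk hd).coordB θ ⟨profile θ w y, y⟩ ≤ 1) ∨
    ((cornerTile θ w k hk hd).coordB θ ⟨profile θ w y, y⟩ = 1 ∧
      0 ≤ (cornerTile θ w k hk hd).coordA θ ⟨profile θ w y, y⟩ ∧
        (cornerTile θ w k hk hd).coordA θ ⟨profile θ w y, y⟩ ≤ 1) := by
  have hA := (cornerTile θ w k hk hd).coordA_apply hθ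
  have hB := (cornerTile θ w k hk hd).coordB_apply hθ
  rcases le_total y (vertex θ w (k + 1)).im with h | h
  · obtain ⟨s, hs0, hs1, e⟩ := exists_profile_eq hθ w hk h0 h
    right
    have e' : (⟨profile θ w y, y⟩ : ℂ) = (cornerTile θ w k hk hd).top +
        (s : ℂ) * dir θ (cornerTile θ w k hk hd).a +
          ((1 : ℝ) : ℂ) * dir θ (cornerTile θ w k hk hd).b := by
      rw [e, vertex_add_one θ w hk, cornerTile]
      push_cast
      ring
    rw [e', hA, hB]
    exact ⟨rfl, hs0, hs1⟩
  · obtain ⟨s, hs0, hs1, e⟩ := exists_profile_eq hθ w (Nat.lt_of_succ_lt hk) h h1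
    left
    have e' : (⟨profile θ w y, y⟩ : ℂ) = (cornerTile θ w k hk hd).top +
        ((0 : ℝ) : ℂ) * dir θ (cornerTile θ w k hk hd).a +
          (s : ℂ) * dir θ (cornerTile θ w k hk hd).b := by
      rw [e, cornerTile]
      push_cast
      ring
    rw [e', hA, hB]
    exact ⟨rfl, hs0, hs1⟩

theorem cornerTile_coord_left (hθ : IsAdmissible θ) {y : ℝ} (h0 : (vertex θ w (k + 2)).im ≤ y)
    (h1 : y ≤ (vertex θ w k).im) :
    ((cornerTile θ w k hk hd).coordB θ ⟨profile θ (w * simpleRefl k hk) y, y⟩ = 0 ∧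
      0 ≤ (cornerTile θ w k hk hd).coordA θ ⟨profile θ (w * simpleRefl k hk) y, y⟩ ∧
        (cornerTile θ w k hk hd).coordA θ ⟨profile θ (w * simpleRefl k hk) y, y⟩ ≤ 1) ∨
    ((cornerTile θ w k hk hd).coordA θ ⟨profile θ (w * simpleRefl k hk) y, y⟩ = 1 ∧
      0 ≤ (cornerTile θ w k hk hd).coordB θ ⟨profile θ (w * simpleRefl k hk) y, y⟩ ∧
        (cornerTile θ w k hk hd).coordB θ ⟨profile θ (w * simpleRefl k hk) y, y⟩ ≤ 1) := by
  have hA := (cornerTile θ w k hk hd).coordA_apply hθ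
  have hB := (cornerTile θ w k hk hd).coordB_apply hθ
  rw [← vertex_mul_simpleRefl θ w hk (by omega)] at h0
  rw [← vertex_mul_simpleRefl θ w hk (by omega)] at h1
  rcases le_total y (vertex θ (w * simpleRefl k hk) (k + 1)).im with h | h
  · obtain ⟨s, hs0, hs1, e⟩ := exists_profile_eq hθ (w * simpleRefl k hk) hk h0 h
    right
    have e' : (⟨profile θ (w * simpleRefl k hk) y, y⟩ : ℂ) = (cornerTile θ w k hk hd).top +
        ((1 : ℝ) : ℂ) * dir θ (cornerTile θ w k hk hd).a +
          (s : ℂ) * dir θ (cornerTile θ w k hk hd).b := by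
      rw [e, vertex_mul_simpleRefl_add_one θ w hk, mul_simpleRefl_right, cornerTile]
      push_cast
      ring
    rw [e', hA, hB]
    exact ⟨rfl, hs0, hs1⟩
  · obtain ⟨s, hs0, hs1, e⟩ :=
      exists_profile_eq hθ (w * simpleRefl k hk) (Nat.lt_of_succ_lt hk) h h1
    left
    have e' : (⟨profile θ (w * simpleRefl k hk) y, y⟩ : ℂ) = (cornerTile θ w k hk hd).top +
        (s : ℂ) * dir θ (cornerTile θ w k hk hd).a +
          ((0 : ℝ) : ℂ) * dir θ (cornerTile θ w k hk hd).b := by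
      rw [e, vertex_mul_simpleRefl θ w hk (by omega), mul_simpleRefl_left, cornerTile]
      push_cast
      ring
    rw [e', hA, hB]
    exact ⟨rfl, hs0, hs1⟩

/-- At these heights the boundary runs along the two right edges of the corner tile, where `coordA`
is 0 or `coordB` is 1. Horizontal motion changes the two coordinates strictly and in opposite
directions, so the side of the boundary can be read off from them. -/
theorem le_profile_iff (hθ : IsAdmissible θ) {z : ℂ} (h0 : (vertex θ w (k + 2)).im ≤ z.im)
    (h1 : z.im ≤ (vertex θ w k).im) :
    (z.re ≤ profile θ w z.im ↔
      0 ≤ (cornerTile θ w k hk hd).coordA θ z ∧ (cornerTile θ w k hk hd).coordB θ z ≤ 1) ∧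
    (z.re < profile θ w z.im ↔
      0 < (cornerTile θ w k hk hd).coordA θ z ∧ (cornerTile θ w k hk hd).coordB θ z < 1) := by
  obtain ⟨α, hα, β, hβ, h⟩ := (cornerTile θ w k hk hd).exists_coord_add hθ
  have hc := cornerTile_coord_right w hk hd hθ h0 h1
  obtain ⟨h2, h3⟩ := h ⟨profile θ w z.im, z.im⟩ (z.re - profile θ w z.im)
  have e : (⟨profile θ w z.im, z.im⟩ : ℂ) + ((z.re - profile θ w z.im : ℝ) : ℂ) = z := by
    apply Complex.ext <;> simp
  rw [e] at h2 h3
  rw [h2, h3]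
  constructor <;> constructor
  · intro hz
    rcases hc with ⟨h4, h5, h6⟩ | ⟨h4, h5, h6⟩ <;> constructor <;> nlinarith
  · rintro ⟨h7, h8⟩
    rcases hc with ⟨h4, h5, h6⟩ | ⟨h4, h5, h6⟩ <;> nlinarith
  · intro hz
    rcases hc with ⟨h4, h5, h6⟩ | ⟨h4, h5, h6⟩ <;> constructor <;> nlinarith
  · rintro ⟨h7, h8⟩
    rcases hc with ⟨h4, h5, h6⟩ | ⟨h4, h5, h6⟩ <;> nlinarith

theorem profile_mul_simpleRefl_le_iff (hθ : IsAdmissible θ) {z : ℂ}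
    (h0 : (vertex θ w (k + 2)).im ≤ z.im) (h1 : z.im ≤ (vertex θ w k).im) :
    (profile θ (w * simpleRefl k hk) z.im ≤ z.re ↔
      (cornerTile θ w k hk hd).coordA θ z ≤ 1 ∧ 0 ≤ (cornerTile θ w k hk hd).coordB θ z) ∧
    (profile θ (w * simpleRefl k hk) z.im < z.re ↔
      (cornerTile θ w k hk hd).coordA θ z < 1 ∧ 0 < (cornerTile θ w k hk hd).coordB θ z) := by
  obtain ⟨α, hα, β, hβ, h⟩ := (cornerTile θ w k hk hd).exists_coord_add hθ
  have hc := cornerTile_coord_left w hk hd hθ h0 h1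
  obtain ⟨h2, h3⟩ := h ⟨profile θ (w * simpleRefl k hk) z.im, z.im⟩
    (z.re - profile θ (w * simpleRefl k hk) z.im)
  have e : (⟨profile θ (w * simpleRefl k hk) z.im, z.im⟩ : ℂ) +
      ((z.re - profile θ (w * simpleRefl k hk) z.im : ℝ) : ℂ) = z := by
    apply Complex.ext <;> simp
  rw [e] at h2 h3
  rw [h2, h3]
  constructor <;> constructor
  · intro hz
    rcases hc with ⟨h4, h5, h6⟩ | ⟨h4, h5, h6⟩ <;> constructor <;> nlinarith
  · rintro ⟨h7, h8⟩
    rcases hc with ⟨h4, h5, h6⟩ | ⟨h4, h5, h6⟩ <;> nlinarith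
  · intro hz
    rcases hc with ⟨h4, h5, h6⟩ | ⟨h4, h5, h6⟩ <;> constructor <;> nlinarith
  · rintro ⟨h7, h8⟩
    rcases hc with ⟨h4, h5, h6⟩ | ⟨h4, h5, h6⟩ <;> nlinarith

theorem Tile.im_mem_of_mem_carrier (hθ : IsAdmissible θ) (t : Tile n) {z : ℂ}
    (hz : z ∈ t.carrier θ) :
    t.top.im + (dir θ t.a).im + (dir θ t.b).im ≤ z.im ∧ z.im ≤ t.top.im := by
  obtain ⟨x, ⟨hx0, hx1⟩, y, ⟨hy0, hy1⟩, rfl⟩ := hz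
  have ha := dir_im_neg hθ t.a
  have hb := dir_im_neg hθ t.b
  simp only [Complex.add_im, Complex.im_ofReal_mul]
  constructor <;> nlinarith

theorem cornerTile_im_of_mem (hθ : IsAdmissible θ) {z : ℂ}
    (hz : z ∈ (cornerTile θ w k hk hd).carrier θ) :
    (vertex θ w (k + 2)).im ≤ z.im ∧ z.im ≤ (vertex θ w k).im := by
  have := (cornerTile θ w k hk hd).im_mem_of_mem_carrier hθ hz
  rw [vertex_add_two θ w hk]
  exact this

theorem mem_cornerTile_iff (hθ : IsAdmissible θ) {z : ℂ} :
    z ∈ (cornerTile θ w k hk hd).carrier θ ↔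
      ((vertex θ w (k + 2)).im ≤ z.im ∧ z.im ≤ (vertex θ w k).im) ∧
        profile θ (w * simpleRefl k hk) z.im ≤ z.re ∧ z.re ≤ profile θ w z.im := by
  constructor
  · intro hz
    have him := cornerTile_im_of_mem w hk hd hθ hz
    rw [Tile.mem_carrier_iff hθ] at hz
    exact ⟨him, (profile_mul_simpleRefl_le_iff w hk hd hθ him.1 him.2).1.2 ⟨hz.1.2, hz.2.1⟩,
      (le_profile_iff w hk hd hθ him.1 him.2).1.2 ⟨hz.1.1, hz.2.2⟩⟩
  · rintro ⟨him, h1, h2⟩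
    have h3 := (profile_mul_simpleRefl_le_iff w hk hd hθ him.1 him.2).1.1 h1
    have h4 := (le_profile_iff w hk hd hθ him.1 him.2).1.1 h2
    exact (Tile.mem_carrier_iff hθ _).2 ⟨⟨h4.1, h3.1⟩, h3.2, h4.2⟩

theorem profile_lt_of_mem_inner (hθ : IsAdmissible θ) {z : ℂ}
    (hz : z ∈ (cornerTile θ w k hk hd).inner θ) :
    profile θ (w * simpleRefl k hk) z.im < z.re := by
  have him := cornerTile_im_of_mem w hk hd hθ (Tile.inner_subset_carrier θ _ hz)
  rw [Tile.mem_inner_iff hθ] at hz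
  exact (profile_mul_simpleRefl_le_iff w hk hd hθ him.1 him.2).2.2 ⟨hz.1.2, hz.2.1⟩

theorem profile_mul_simpleRefl_le (hθ : IsAdmissible θ) (hd : IsDescent w k hk) {y : ℝ}
    (h0 : (∑ i, dir θ i).im ≤ y) (h1 : y ≤ 0) :
    profile θ (w * simpleRefl k hk) y ≤ profile θ w y := by
  by_cases h : y ≤ (vertex θ w (k + 2)).im ∨ (vertex θ w k).im ≤ y
  · exact (profile_mul_simpleRefl_of_le hθ w hk h0 h1 h).le
  · rw [not_or, not_le, not_le] at h
    have hc := cornerTile_coord_right w hk hd hθ h.1.le h.2.le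
    refine (profile_mul_simpleRefl_le_iff w hk hd hθ (z := ⟨profile θ w y, y⟩) h.1.le h.2.le).1.2 ?_
    rcases hc with ⟨h4, h5, h6⟩ | ⟨h4, h5, h6⟩ <;> constructor <;> linarith

end CornerTile

/-- A property holds for all permutations if it holds for the identity and is inherited from
`w * s` to `w` whenever multiplication by the simple reflection `s` removes a descent. -/
theorem perm_induction {n : ℕ} {P : Equiv.Perm (Fin n) → Prop} (one : P 1)
    (step : ∀ w k (hk : k + 1 < n), IsDescent w k hk → P (w * simpleRefl k hk) → P w)
    (w : Equiv.Perm (Fin n)) : P w := by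
  induction hN : (inversions w).card generalizing w with
  | zero =>
    by_cases hw : w = 1
    · rwa [hw]
    · obtain ⟨k, hk, hd⟩ := exists_isDescent hw
      have := card_inversions_mul_simpleRefl hk w hd
      omega
  | succ N ih =>
    by_cases hw : w = 1
    · rwa [hw]
    · obtain ⟨k, hk, hd⟩ := exists_isDescent hw
      have := card_inversions_mul_simpleRefl hk w hd
      exact step w k hk hd (ih _ (by omega))

theorem profile_one_le {n : ℕ} {θ : Fin n → ℝ} (hθ : IsAdmissible θ) (w : Equiv.Perm (Fin n))
    {y : ℝ} (h0 : (∑ i, dir θ i).im ≤ y) (h1 : y ≤ 0) : profile θ 1 y ≤ profile θ w y := by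
  induction w using perm_induction with
  | one => exact le_rfl
  | step w k hk hd ih => exact ih.trans (profile_mul_simpleRefl_le w hk hθ hd h0 h1)

/-- Between the heights of the vertices `k` and `k + 2`, the corner tile is the gap between the old
and the new profile. At other heights these profiles agree. -/
theorem region_eq_union {n : ℕ} {θ : Fin n → ℝ} (hθ : IsAdmissible θ) (w : Equiv.Perm (Fin n))
    {k : ℕ} (hk : k + 1 < n) (hd : IsDescent w k hk) :
    region θ w = region θ (w * simpleRefl k hk) ∪ (cornerTile θ w k hk hd).carrier θ := by
  have hn : 0 < n := by omega
  ext z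
  rw [Set.mem_union, mem_region_iff hθ _ hn, mem_region_iff hθ _ hn, mem_cornerTile_iff w hk hd hθ]
  constructor
  · rintro ⟨h0, h1, h2, h3⟩
    by_cases hz : z.re ≤ profile θ (w * simpleRefl k hk) z.im
    · exact Or.inl ⟨h0, h1, h2, hz⟩
    · right
      refine ⟨?_, (not_le.1 hz).le, h3⟩
      by_contra hc
      refine hz (h3.trans (profile_mul_simpleRefl_of_le hθ w hk h0 h1 ?_).ge)
      rw [not_and_or, not_le, not_le] at hc
      exact hc.imp le_of_lt le_of_lt
  · rintro (⟨h0, h1, h2, h3⟩ | ⟨⟨h0, h1⟩, h2, h3⟩)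
    · exact ⟨h0, h1, h2, h3.trans (profile_mul_simpleRefl_le w hk hθ hd h0 h1)⟩
    · have h4 : (∑ i, dir θ i).im ≤ z.im := by
        refine le_trans ?_ h0
        rw [← vertex_last θ w]
        exact vertex_im_le hθ w (show k + 2 ≤ n from hk) le_rfl
      have h5 : z.im ≤ 0 := by
        have := vertex_im_le hθ w (Nat.zero_le k) (by omega)
        rw [vertex_zero, Complex.zero_im] at this
        exact h1.trans this
      exact ⟨h4, h5, (profile_one_le hθ _ h4 h5).trans h2, h3⟩

theorem inner_cornerTile_disjoint {n : ℕ} {θ : Fin n → ℝ} (hθ : IsAdmissible θ)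
    (w : Equiv.Perm (Fin n)) {k : ℕ} (hk : k + 1 < n) (hd : IsDescent w k hk) :
    Disjoint ((cornerTile θ w k hk hd).inner θ) (region θ (w * simpleRefl k hk)) := by
  rw [Set.disjoint_left]
  intro z hz hr
  have h1 := profile_lt_of_mem_inner w hk hd hθ hz
  have h2 := (mem_region_iff hθ _ (by omega)).1 hr
  exact absurd h2.2.2.2 (not_le.2 h1)

/-! ### Tilings built by flips are rhombic tilings. -/

theorem vertex_eq_of_stablePrefix {n j : ℕ} (θ : Fin n → ℝ) {w : Equiv.Perm (Fin n)}
    (h : StablePrefix j w) : vertex θ w j = vertex θ 1 j := by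
  unfold vertex
  refine Finset.sum_equiv w (fun i => ?_) (fun i _ => rfl)
  simp only [Finset.mem_filter, Finset.mem_univ, true_and]
  refine ⟨h i, fun hi => ?_⟩
  by_contra hc
  have := h.le_apply (not_lt.1 hc)
  omega

theorem side_eq_of_stablePrefix {n j : ℕ} (θ : Fin n → ℝ) {w : Equiv.Perm (Fin n)} (hj : j < n)
    (h : StablePrefix j w) (he : w ⟨j, hj⟩ = ⟨j, hj⟩) : side θ w j = side θ 1 j := by
  unfold side
  rw [vertex_succ θ _ hj, vertex_succ θ _ hj, vertex_eq_of_stablePrefix θ h, he,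
    Equiv.Perm.one_apply]

theorem edges_cornerTile {n : ℕ} (θ : Fin n → ℝ) (w : Equiv.Perm (Fin n)) {k : ℕ} (hk : k + 1 < n)
    (hd : IsDescent w k hk) :
    (cornerTile θ w k hk hd).edges θ =
      {side θ (w * simpleRefl k hk) k, side θ w k, side θ (w * simpleRefl k hk) (k + 1),
        side θ w (k + 1)} := by
  unfold side
  rw [vertex_mul_simpleRefl_add_one, vertex_mul_simpleRefl θ w hk (j := k) (by omega),
    vertex_mul_simpleRefl θ w hk (j := k + 1 + 1) (by omega), vertex_add_one θ w hk,
    vertex_add_two θ w hk]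
  rfl

theorem Tile.convex_carrier {n : ℕ} (θ : Fin n → ℝ) (t : Tile n) : Convex ℝ (t.carrier θ) := by
  rintro _ ⟨x, ⟨hx0, hx1⟩, y, ⟨hy0, hy1⟩, rfl⟩ _ ⟨x', ⟨hx0', hx1'⟩, y', ⟨hy0', hy1'⟩, rfl⟩
    a b ha hb hab
  refine ⟨a * x + b * x', ⟨by positivity, by nlinarith⟩, a * y + b * y',
    ⟨by positivity, by nlinarith⟩, ?_⟩
  obtain rfl : b = 1 - a := by linarith
  simp only [Complex.real_smul]
  push_cast
  ring

theorem Tile.segment_subset_carrier {n : ℕ} (θ : Fin n → ℝ) (t : Tile n) {p q : ℂ}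
    (h : s(p, q) ∈ t.edges θ) : segment ℝ p q ⊆ t.carrier θ := by
  have key : p ∈ t.carrier θ ∧ q ∈ t.carrier θ := by
    have h00 : t.top ∈ t.carrier θ := ⟨0, by simp, 0, by simp, by simp⟩
    have h10 : t.top + dir θ t.a ∈ t.carrier θ := ⟨1, by simp, 0, by simp, by simp⟩
    have h01 : t.top + dir θ t.b ∈ t.carrier θ := ⟨0, by simp, 1, by simp, by simp⟩
    have h11 : t.top + dir θ t.a + dir θ t.b ∈ t.carrier θ := ⟨1, by simp, 1, by simp, by simp⟩
    rcases h with h | h | h | h <;>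
      · rcases Sym2.eq_iff.1 h with ⟨rfl, rfl⟩ | ⟨rfl, rfl⟩ <;> constructor <;> assumption
  exact (t.convex_carrier θ).segment_subset key.1 key.2

noncomputable instance {n : ℕ} : DecidableEq (Tile n) := Classical.decEq _

/-- The tilings obtained from the empty one by successively adding tiles, each of which replaces
an ascent of the current rightside boundary by a descent. -/
inductive FlipTiling {n : ℕ} (θ : Fin n → ℝ) : Equiv.Perm (Fin n) → Finset (Tile n) → Prop
  | one : FlipTiling θ 1 ∅
  | step (w : Equiv.Perm (Fin n)) (k : ℕ) (hk : k + 1 < n) (hd : IsDescent w k hk)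
      (T : Finset (Tile n)) (h : FlipTiling θ (w * simpleRefl k hk) T) :
      FlipTiling θ w (insert (cornerTile θ w k hk hd) T)

theorem exists_flipTiling {n : ℕ} (θ : Fin n → ℝ) (w : Equiv.Perm (Fin n)) :
    ∃ T, FlipTiling θ w T := by
  induction w using perm_induction with
  | one => exact ⟨∅, .one⟩
  | step w k hk hd ih =>
    obtain ⟨T, hT⟩ := ih
    exact ⟨_, .step w k hk hd T hT⟩

theorem region_one {n : ℕ} {θ : Fin n → ℝ} (hθ : IsAdmissible θ) (hn : 0 < n) :
    region θ 1 = path θ 1 := by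
  ext z
  rw [mem_region_iff hθ _ hn, mem_path_iff hθ _ hn, le_antisymm_iff, and_comm (a := z.re ≤ _)]

/-- The left path is adjoined because the region of a general `w` may degenerate to arcs of it that
no tile covers. For the identity it is the whole region. -/
theorem FlipTiling.union_eq {n : ℕ} {θ : Fin n → ℝ} (hθ : IsAdmissible θ) (hn : 0 < n)
    {w : Equiv.Perm (Fin n)} {T : Finset (Tile n)} (h : FlipTiling θ w T) :
    path θ 1 ∪ ⋃ t ∈ T, t.carrier θ = region θ w := by
  induction h with
  | one => simp [region_one hθ hn]
  | step w k hk hd T h ih =>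
    rw [region_eq_union hθ w hk hd, ← ih, Finset.set_biUnion_insert, Set.union_assoc,
      Set.union_comm (Tile.carrier θ _)]

theorem FlipTiling.carrier_subset {n : ℕ} {θ : Fin n → ℝ} (hθ : IsAdmissible θ) (hn : 0 < n)
    {w : Equiv.Perm (Fin n)} {T : Finset (Tile n)} (h : FlipTiling θ w T) {t : Tile n}
    (ht : t ∈ T) : t.carrier θ ⊆ region θ w := by
  rw [← h.union_eq hθ hn]
  exact (Set.subset_biUnion_of_mem (u := fun t : Tile n => t.carrier θ) (Finset.mem_coe.2 ht)).trans
    Set.subset_union_right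

theorem FlipTiling.disjoint_inner {n : ℕ} {θ : Fin n → ℝ} (hθ : IsAdmissible θ)
    {w : Equiv.Perm (Fin n)} {T : Finset (Tile n)} (h : FlipTiling θ w T) :
    ∀ t ∈ T, ∀ t' ∈ T, t ≠ t' → Disjoint (t.inner θ) (t'.inner θ) := by
  induction h with
  | one => simp
  | step w k hk hd T h ih =>
    have key : ∀ t ∈ T, Disjoint ((cornerTile θ w k hk hd).inner θ) (t.inner θ) := fun t ht =>
      (inner_cornerTile_disjoint hθ w hk hd).mono_right
        ((t.inner_subset_carrier θ).trans (h.carrier_subset hθ (by omega) ht))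
    intro t ht t' ht' hne
    rcases Finset.mem_insert.1 ht with rfl | ht <;> rcases Finset.mem_insert.1 ht' with rfl | ht'
    · exact absurd rfl hne
    · exact key t' ht'
    · exact (key t ht).symm
    · exact ih t ht t' ht' hne

theorem Tile.ext {n : ℕ} {t t' : Tile n} (h : t.top = t'.top) (ha : t.a = t'.a)
    (hb : t.b = t'.b) : t = t' := by
  obtain ⟨top, a, b, hab⟩ := t
  obtain ⟨top', a', b', hab'⟩ := t'
  simp only at h ha hb
  subst h ha hb
  rfl

theorem Tile.inner_nonempty {n : ℕ} (θ : Fin n → ℝ) (t : Tile n) : (t.inner θ).Nonempty :=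
  ⟨_, 1 / 2, by norm_num, 1 / 2, by norm_num, rfl⟩

theorem FlipTiling.cornerTile_notMem {n : ℕ} {θ : Fin n → ℝ} (hθ : IsAdmissible θ)
    {w : Equiv.Perm (Fin n)} {k : ℕ} {hk : k + 1 < n} (hd : IsDescent w k hk)
    {T : Finset (Tile n)} (h : FlipTiling θ (w * simpleRefl k hk) T) :
    cornerTile θ w k hk hd ∉ T := by
  intro ht
  obtain ⟨z, hz⟩ := (cornerTile θ w k hk hd).inner_nonempty θ
  exact Set.disjoint_left.1 (inner_cornerTile_disjoint hθ w hk hd) hz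
    (h.carrier_subset hθ (by omega) ht (Tile.inner_subset_carrier θ _ hz))

/-- This supplies the neighbours across the left edges of the next tile to be added. -/
theorem FlipTiling.side_right {n : ℕ} {θ : Fin n → ℝ} {w : Equiv.Perm (Fin n)}
    {T : Finset (Tile n)} (h : FlipTiling θ w T) :
    ∀ j < n, (∃ i < n, side θ w j = side θ 1 i) ∨ ∃ t ∈ T, side θ w j ∈ t.edges θ := by
  induction h with
  | one => exact fun j hj => Or.inl ⟨j, hj, rfl⟩
  | step w k hk hd T h ih =>
    intro j hj
    by_cases h1 : j = k
    · subst h1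
      exact Or.inr ⟨_, Finset.mem_insert_self _ _, by rw [edges_cornerTile]; simp⟩
    by_cases h2 : j = k + 1
    · subst h2
      exact Or.inr ⟨_, Finset.mem_insert_self _ _, by rw [edges_cornerTile]; simp⟩
    rw [← side_mul_simpleRefl θ w hk h1 h2]
    exact (ih j hj).imp_right fun ⟨t, ht, he⟩ => ⟨t, Finset.mem_insert_of_mem ht, he⟩

/-- The right edges of the new tile are boundary sides of `w`. Its left edges are the sides `k` and
`k + 1` of the previous right boundary, so each is on the left boundary or belongs to an old tile,
and an old edge that loses its place on the right boundary is matched by the new tile. -/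
theorem FlipTiling.edge_to_edge {n : ℕ} {θ : Fin n → ℝ} (hθ : IsAdmissible θ)
    {w : Equiv.Perm (Fin n)} {T : Finset (Tile n)} (h : FlipTiling θ w T) :
    ∀ t ∈ T, ∀ e ∈ t.edges θ, e ∈ polygonSides θ w ∨ ∃ t' ∈ T, t' ≠ t ∧ e ∈ t'.edges θ := by
  induction h with
  | one => simp
  | step w k hk hd T h ih =>
    have hnew := h.cornerTile_notMem hθ hd
    have hleft : ∀ j < n, side θ (w * simpleRefl k hk) j ∈ polygonSides θ w ∨
        ∃ t' ∈ T, side θ (w * simpleRefl k hk) j ∈ t'.edges θ := fun j hj =>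
      (h.side_right j hj).imp_left fun ⟨i, hi, e⟩ => ⟨i, hi, Or.inl e⟩
    intro t ht e he
    rcases Finset.mem_insert.1 ht with rfl | htT
    · have hl : ∀ j < n, e = side θ (w * simpleRefl k hk) j → e ∈ polygonSides θ w ∨
          ∃ t' ∈ insert (cornerTile θ w k hk hd) T, t' ≠ cornerTile θ w k hk hd ∧
            e ∈ t'.edges θ := by
        rintro j hj rfl
        exact (hleft j hj).imp_right fun ⟨t', ht', he'⟩ =>
          ⟨t', Finset.mem_insert_of_mem ht', fun e => hnew (e ▸ ht'), he'⟩
      rw [edges_cornerTile] at he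
      rcases he with he | he | he | he
      · exact hl k (by omega) he
      · exact Or.inl ⟨k, by omega, Or.inr he⟩
      · exact hl (k + 1) hk he
      · exact Or.inl ⟨k + 1, hk, Or.inr he⟩
    · rcases ih t htT e he with ⟨j, hj, hs⟩ | ⟨t', ht', hne, he'⟩
      · rcases hs with hs | hs
        · exact Or.inl ⟨j, hj, Or.inl hs⟩
        · by_cases h1 : j = k
          · subst h1
            exact Or.inr ⟨_, Finset.mem_insert_self _ _, fun e' => hnew (e'.symm ▸ htT),
              by rw [edges_cornerTile, hs]; simp⟩
          by_cases h2 : j = k + 1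
          · subst h2
            exact Or.inr ⟨_, Finset.mem_insert_self _ _, fun e' => hnew (e'.symm ▸ htT),
              by rw [edges_cornerTile, hs]; simp⟩
          rw [side_mul_simpleRefl θ w hk h1 h2] at hs
          exact Or.inl ⟨j, hj, Or.inr hs⟩
      · exact Or.inr ⟨t', Finset.mem_insert_of_mem ht', hne, he'⟩

/-- A left side remains uncovered only as long as no flip touches it, and then the right boundary
still passes through it. -/
theorem FlipTiling.side_left {n : ℕ} {θ : Fin n → ℝ} {w : Equiv.Perm (Fin n)}
    {T : Finset (Tile n)} (h : FlipTiling θ w T) (j : ℕ) (hj : j < n) :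
    (∃ t ∈ T, side θ 1 j ∈ t.edges θ) ∨ (StablePrefix j w ∧ w ⟨j, hj⟩ = ⟨j, hj⟩) := by
  induction h with
  | one => exact Or.inr ⟨fun i hi => hi, rfl⟩
  | step w k hk hd T h ih =>
    rcases ih with ⟨t, ht, he⟩ | ⟨h1, h2⟩
    · exact Or.inl ⟨t, Finset.mem_insert_of_mem ht, he⟩
    · have hside := side_eq_of_stablePrefix θ hj h1 h2
      by_cases e1 : j = k
      · subst e1
        exact Or.inl ⟨_, Finset.mem_insert_self _ _, by rw [← hside, edges_cornerTile]; simp⟩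
      by_cases e2 : j = k + 1
      · subst e2
        exact Or.inl ⟨_, Finset.mem_insert_self _ _, by rw [← hside, edges_cornerTile]; simp⟩
      · right
        rw [mul_simpleRefl_of_ne w hk e1 e2] at h2
        refine ⟨?_, h2⟩
        have := h1.mul (stablePrefix_simpleRefl (n := n) (r := j) hk (Ne.symm e2))
        rwa [mul_simpleRefl_mul_self] at this

theorem FlipTiling.isRhombicTiling {n : ℕ} {θ : Fin n → ℝ} (hθ : IsAdmissible θ) (hn : 2 ≤ n)
    {w : Equiv.Perm (Fin n)} {T : Finset (Tile n)} (h : FlipTiling θ w T)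
    (hw : IsFullySupported w) : IsRhombicTiling θ w T := by
  refine ⟨?_, h.disjoint_inner hθ, h.edge_to_edge hθ⟩
  rw [isFullySupported_iff] at hw
  rw [← h.union_eq hθ (by omega), eq_comm, Set.union_eq_right]
  rintro z ⟨j, hj, hz⟩
  rcases h.side_left j hj with ⟨t, ht, he⟩ | ⟨h1, h2⟩
  · exact Set.mem_biUnion (Finset.mem_coe.2 ht) (t.segment_subset_carrier θ he hz)
  · exfalso
    -- The stable prefix of length 0 says nothing. For `j = 0` the fixed point gives a stable prefix
    -- of length 1, a proper one because `2 ≤ n`.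
    rcases Nat.eq_zero_or_pos j with rfl | hj0
    · refine hw 1 one_pos hn fun i hi => ?_
      have : i = ⟨0, hj⟩ := Fin.ext (by simp only; omega)
      rw [this, h2]
      exact one_pos
    · exact hw j hj0 hj h1

/-! ### Every rhombic tiling is built by flips. -/

theorem edge_eq_iff {n : ℕ} {θ : Fin n → ℝ} (hθ : IsAdmissible θ) {p q : ℂ} {c c' : Fin n} :
    s(p, p + dir θ c) = s(q, q + dir θ c') ↔ p = q ∧ c = c' := by
  constructor
  · intro h
    rcases Sym2.eq_iff.1 h with ⟨h1, h2⟩ | ⟨h1, h2⟩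
    · subst h1
      exact ⟨rfl, dir_injective hθ (add_left_cancel h2)⟩
    · have h3 := dir_im_neg hθ c
      have h4 := dir_im_neg hθ c'
      have h5 := congrArg Complex.im h1
      have h6 := congrArg Complex.im h2
      rw [Complex.add_im] at h5 h6
      linarith
  · rintro ⟨rfl, rfl⟩
    rfl

theorem side_eq {n : ℕ} (θ : Fin n → ℝ) (u : Equiv.Perm (Fin n)) {k : ℕ} (hk : k < n) :
    side θ u k = s(vertex θ u k, vertex θ u k + dir θ (u ⟨k, hk⟩)) := by
  rw [side, vertex_succ θ u hk]

theorem Tile.mem_edges_iff {n : ℕ} {θ : Fin n → ℝ} (hθ : IsAdmissible θ) (t : Tile n) {p : ℂ}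
    {c : Fin n} : s(p, p + dir θ c) ∈ t.edges θ ↔
      (p = t.top ∧ c = t.a) ∨ (p = t.top ∧ c = t.b) ∨ (p = t.top + dir θ t.a ∧ c = t.b) ∨
        (p = t.top + dir θ t.b ∧ c = t.a) := by
  have e : t.top + dir θ t.a + dir θ t.b = t.top + dir θ t.b + dir θ t.a := by ring
  rw [← edge_eq_iff hθ, ← edge_eq_iff hθ, ← edge_eq_iff hθ, ← edge_eq_iff hθ, ← e]
  rfl

/-- The coordinates of a point on an edge of a tile. -/
theorem Tile.coord_of_mem_edges {n : ℕ} {θ : Fin n → ℝ} (hθ : IsAdmissible θ) (t : Tile n) {p : ℂ}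
    {c : Fin n} (h : s(p, p + dir θ c) ∈ t.edges θ) (σ : ℝ) :
    (t.coordA θ (p + σ * dir θ c) = σ ∧ t.coordB θ (p + σ * dir θ c) = 0) ∨
    (t.coordA θ (p + σ * dir θ c) = 0 ∧ t.coordB θ (p + σ * dir θ c) = σ) ∨
    (t.coordA θ (p + σ * dir θ c) = 1 ∧ t.coordB θ (p + σ * dir θ c) = σ) ∨
    (t.coordA θ (p + σ * dir θ c) = σ ∧ t.coordB θ (p + σ * dir θ c) = 1) := by
  have key : ∀ x y : ℝ, p + σ * dir θ c = t.top + (x : ℂ) * dir θ t.a + (y : ℂ) * dir θ t.b →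
      t.coordA θ (p + σ * dir θ c) = x ∧ t.coordB θ (p + σ * dir θ c) = y := by
    intro x y e
    rw [e]
    exact ⟨t.coordA_apply hθ x y, t.coordB_apply hθ x y⟩
  rcases (t.mem_edges_iff hθ).1 h with ⟨rfl, rfl⟩ | ⟨rfl, rfl⟩ | ⟨rfl, rfl⟩ | ⟨rfl, rfl⟩
  · exact Or.inl (key _ _ (by push_cast; ring))
  · exact Or.inr (Or.inl (key _ _ (by push_cast; ring)))
  · exact Or.inr (Or.inr (Or.inl (key _ _ (by push_cast; ring))))
  · exact Or.inr (Or.inr (Or.inr (key _ _ (by push_cast; ring))))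

/-- A rhombic tiling of a possibly degenerate polygon `X(w)`: parts of the leftside boundary that
are shared with the rightside boundary need not be covered by tiles. -/
structure IsPretiling {n : ℕ} (θ : Fin n → ℝ) (w : Equiv.Perm (Fin n)) (T : Finset (Tile n)) :
    Prop where
  union_eq : path θ 1 ∪ ⋃ t ∈ T, t.carrier θ = region θ w
  disjoint : ∀ t ∈ T, ∀ t' ∈ T, t ≠ t' → Disjoint (t.inner θ) (t'.inner θ)
  edge : ∀ t ∈ T, ∀ e ∈ t.edges θ, e ∈ polygonSides θ w ∨ ∃ t' ∈ T, t' ≠ t ∧ e ∈ t'.edges θ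

theorem path_one_subset_region {n : ℕ} {θ : Fin n → ℝ} (hθ : IsAdmissible θ) (hn : 0 < n)
    (w : Equiv.Perm (Fin n)) : path θ 1 ⊆ region θ w := by
  intro z hz
  obtain ⟨h1, h2, h3⟩ := (mem_path_iff hθ _ hn).1 hz
  exact (mem_region_iff hθ _ hn).2 ⟨h1, h2, h3.ge, h3.le.trans (profile_one_le hθ w h1 h2)⟩

theorem IsRhombicTiling.isPretiling {n : ℕ} {θ : Fin n → ℝ} (hθ : IsAdmissible θ) (hn : 0 < n)
    {w : Equiv.Perm (Fin n)} {T : Finset (Tile n)} (h : IsRhombicTiling θ w T) :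
    IsPretiling θ w T := by
  refine ⟨?_, h.2.1, h.2.2⟩
  rw [h.1]
  exact Set.union_eq_right.2 (path_one_subset_region hθ hn w)

theorem vertex_eq_mk_profile {n : ℕ} {θ : Fin n → ℝ} (hθ : IsAdmissible θ)
    (w : Equiv.Perm (Fin n)) (hn : 0 < n) {j : ℕ} (hj : j ≤ n) :
    (vertex θ w j).re = profile θ w (vertex θ w j).im := by
  rcases Nat.lt_or_eq_of_le hj with h | rfl
  · have := profile_side hθ w h le_rfl zero_le_one
    simpa using this.symm
  · obtain ⟨k, rfl⟩ : ∃ k, j = k + 1 := ⟨j - 1, by omega⟩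
    have := profile_side hθ w (Nat.lt_succ_self k) zero_le_one le_rfl
    rw [one_mul, one_mul, ← Complex.add_re, ← Complex.add_im, ← vertex_succ] at this
    exact this.symm

namespace IsPretiling

variable {n : ℕ} {θ : Fin n → ℝ} {w : Equiv.Perm (Fin n)} {T : Finset (Tile n)}

theorem carrier_subset (h : IsPretiling θ w T) {t : Tile n} (ht : t ∈ T) :
    t.carrier θ ⊆ region θ w := by
  rw [← h.union_eq]
  exact (Set.subset_biUnion_of_mem (u := fun t : Tile n => t.carrier θ) (Finset.mem_coe.2 ht)).trans
    Set.subset_union_right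

/-- No tile extends to the right of a point of the rightside boundary. -/
theorem coord_of_re_eq (hθ : IsAdmissible θ) (h : IsPretiling θ w T) {t : Tile n} (ht : t ∈ T)
    {p : ℂ} (hp : p.re = profile θ w p.im) (hn : 0 < n) :
    ¬ ((0 < t.coordA θ p ∧ t.coordA θ p ≤ 1) ∧ 0 ≤ t.coordB θ p ∧ t.coordB θ p < 1) := by
  rintro ⟨hA, hB⟩
  obtain ⟨e, he, he0⟩ := ((t.eventually_add_mem_inner hθ hA hB).and self_mem_nhdsWithin).exists
  have h1 := (mem_region_iff hθ _ hn).1 (h.carrier_subset ht (t.inner_subset_carrier θ he))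
  have h2 := h1.2.2.2
  simp only [Complex.add_re, Complex.add_im, Complex.ofReal_re, Complex.ofReal_im, add_zero] at h2
  have he0 : 0 < e := he0
  linarith

/-- A point on the right boundary of both tiles has points immediately to its left that are interior
to both. -/
theorem eq_of_coord (hθ : IsAdmissible θ) (h : IsPretiling θ w T) {t t' : Tile n} (ht : t ∈ T)
    (ht' : t' ∈ T) {p : ℂ}
    (hA : 0 ≤ t.coordA θ p ∧ t.coordA θ p < 1) (hB : 0 < t.coordB θ p ∧ t.coordB θ p ≤ 1)
    (hA' : 0 ≤ t'.coordA θ p ∧ t'.coordA θ p < 1) (hB' : 0 < t'.coordB θ p ∧ t'.coordB θ p ≤ 1) :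
    t = t' := by
  by_contra hne
  obtain ⟨e, he, he'⟩ := ((t.eventually_sub_mem_inner hθ hA hB).and
    (t'.eventually_sub_mem_inner hθ hA' hB')).exists
  exact Set.disjoint_left.1 (h.disjoint t ht t' ht' hne) he he'

/-- An edge of a tile that contains an interior point of a side of the rightside boundary is
parallel to it. -/
theorem label_eq_of_right_edge (hθ : IsAdmissible θ) {k : ℕ} (hk : k < n) {s σ : ℝ}
    (hs : 0 < s ∧ s < 1) (hσ : 0 < σ ∧ σ < 1) {P : ℂ} {c : Fin n}
    (hp : P + σ * dir θ c = vertex θ w k + s * dir θ (w ⟨k, hk⟩))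
    (hsub : ∀ τ : ℝ, 0 ≤ τ → τ ≤ 1 → P + τ * dir θ c ∈ region θ w) : c = w ⟨k, hk⟩ := by
  have hn : 0 < n := by omega
  set d := dir θ (w ⟨k, hk⟩) with hd
  have hd0 : d.im < 0 := dir_im_neg hθ _
  have c1 : Continuous fun δ : ℝ => s + δ * ((dir θ c).im / d.im) := by fun_prop
  have c2 : Continuous fun δ : ℝ => σ + δ := by fun_prop
  have ev1 : ∀ᶠ δ : ℝ in nhds 0, s + δ * ((dir θ c).im / d.im) ∈ Set.Ioo (0 : ℝ) 1 :=
    c1.continuousAt.eventually_mem (isOpen_Ioo.mem_nhds (by simpa using hs))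
  have ev2 : ∀ᶠ δ : ℝ in nhds 0, σ + δ ∈ Set.Ioo (0 : ℝ) 1 :=
    c2.continuousAt.eventually_mem (isOpen_Ioo.mem_nhds (by simpa using hσ))
  obtain ⟨ε, hε, hball⟩ := Metric.eventually_nhds_iff.1 (ev1.and ev2)
  -- Moving along the edge by `δ` must not cross the boundary side. The horizontal offset is linear
  -- in `δ`, so nonpositivity for both signs makes the edge and the side parallel.
  have key : ∀ δ : ℝ, |δ| < ε → δ * ((dir θ c).re - (dir θ c).im / d.im * d.re) ≤ 0 := by
    intro δ hδ
    obtain ⟨h1, h2⟩ := hball (y := δ) (by simpa using hδ)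
    have h3 := (mem_region_iff hθ w hn).1 (hsub (σ + δ) h2.1.le h2.2.le)
    have h4 := profile_side hθ w hk h1.1.le h1.2.le
    have hre := congrArg Complex.re hp
    have him := congrArg Complex.im hp
    simp only [Complex.add_re, Complex.re_ofReal_mul, Complex.add_im, Complex.im_ofReal_mul]
      at hre him h3
    rw [← hd] at h4
    have e1 : P.im + (σ + δ) * (dir θ c).im =
        (vertex θ w k).im + (s + δ * ((dir θ c).im / d.im)) * d.im := by
      have := hd0.ne
      field_simp
      linarith
    rw [e1, h4] at h3
    linarith [h3.2.2.2]
  have h1 := key (ε / 2) (by rw [abs_of_pos (by linarith)]; linarith)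
  have h2 := key (-(ε / 2)) (by rw [abs_neg, abs_of_pos (by linarith)]; linarith)
  have h3 : (dir θ c).re - (dir θ c).im / d.im * d.re = 0 := by
    apply le_antisymm <;> nlinarith
  refine eq_of_cross_eq_zero hθ ?_
  unfold cross
  rw [← hd]
  have := hd0.ne
  field_simp at h3
  linarith

/-- Each nondegenerate side of the rightside boundary is a right edge of a tile. -/
theorem exists_tile_of_side (hθ : IsAdmissible θ) (h : IsPretiling θ w T) {k : ℕ} (hk : k < n)
    {y₀ : ℝ} (hy₀ : (vertex θ w (k + 1)).im < y₀ ∧ y₀ < (vertex θ w k).im)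
    (hlt : profile θ 1 y₀ < profile θ w y₀) :
    ∃ t ∈ T, (t.b = w ⟨k, hk⟩ ∧ t.top = vertex θ w k) ∨
      (t.a = w ⟨k, hk⟩ ∧ t.top + dir θ t.b = vertex θ w k) := by
  have hn : 0 < n := by omega
  have hopen : IsOpen (Set.Ioo (vertex θ w (k + 1)).im (vertex θ w k).im ∩
      {y | profile θ 1 y < profile θ w y}) :=
    isOpen_Ioo.inter (isOpen_lt (continuous_profile θ 1) (continuous_profile θ w))
  have hinf := infinite_of_mem_nhds y₀ (hopen.mem_nhds ⟨hy₀, hlt⟩)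
  -- Choose a height avoiding the finitely many heights of tile vertices, so that the boundary point
  -- at this height lies in the relative interior of a tile edge.
  have hfin : (⋃ t ∈ T, ({t.top.im, t.top.im + (dir θ t.a).im, t.top.im + (dir θ t.b).im,
      t.top.im + (dir θ t.a).im + (dir θ t.b).im} : Set ℝ)).Finite :=
    T.finite_toSet.biUnion fun t _ => Set.toFinite _
  obtain ⟨y, ⟨⟨hy0, hy1⟩, hylt⟩, hyF⟩ := (hinf.sdiff hfin).nonempty
  have hylt : profile θ 1 y < profile θ w y := hylt
  obtain ⟨s, hs0, hs1, hp⟩ := exists_profile_eq hθ w hk hy0.le hy1.le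
  set p : ℂ := ⟨profile θ w y, y⟩ with hpdef
  have hpim : y = (vertex θ w k).im + s * (dir θ (w ⟨k, hk⟩)).im := by
    have := congrArg Complex.im hp
    simpa using this
  have hdk := dir_im_neg hθ (w ⟨k, hk⟩)
  have hs : 0 < s ∧ s < 1 := by
    rw [vertex_succ θ w hk, Complex.add_im] at hy0
    constructor <;> nlinarith
  have hpreg : p ∈ region θ w := by
    have h1 := vertex_im_le hθ w (Nat.succ_le_of_lt hk) le_rfl
    have h2 := vertex_im_le hθ w (Nat.zero_le k) hk.le
    rw [vertex_last] at h1
    rw [vertex_zero, Complex.zero_im] at h2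
    exact (mem_region_iff hθ w hn).2 ⟨h1.trans hy0.le, hy1.le.trans h2, hylt.le, le_rfl⟩
  have hpath : p ∉ path θ 1 := fun hc => by
    have := ((mem_path_iff hθ _ hn).1 hc).2.2
    exact hylt.ne' this
  have hpt : ∃ t ∈ T, p ∈ t.carrier θ := by
    rw [← h.union_eq] at hpreg
    rcases hpreg with hc | hc
    · exact absurd hc hpath
    · simpa using hc
  obtain ⟨t, ht, htp⟩ := hpt
  have hcoord := h.coord_of_re_eq hθ ht (p := p) rfl hn
  obtain ⟨⟨hA0, hA1⟩, hB0, hB1⟩ := (t.mem_carrier_iff hθ).1 htp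
  have hadd := t.add_coord hθ p
  have him : y = t.top.im + t.coordA θ p * (dir θ t.a).im + t.coordB θ p * (dir θ t.b).im := by
    have := congrArg Complex.im hadd
    simp only [Complex.add_im, Complex.im_ofReal_mul] at this
    exact this.symm
  have hyt : y ∉ ({t.top.im, t.top.im + (dir θ t.a).im, t.top.im + (dir θ t.b).im,
      t.top.im + (dir θ t.a).im + (dir θ t.b).im} : Set ℝ) := fun hc =>
    hyF (Set.mem_biUnion (Finset.mem_coe.2 ht) hc)
  simp only [Set.mem_insert_iff, Set.mem_singleton_iff, not_or] at hyt
  obtain ⟨n1, n2, n3, n4⟩ := hyt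
  obtain ⟨P, c, σ, hσ, hPσ, hedge, hcase⟩ : ∃ (P : ℂ) (c : Fin n) (σ : ℝ), (0 < σ ∧ σ < 1) ∧
      P + σ * dir θ c = p ∧ s(P, P + dir θ c) ∈ t.edges θ ∧
        ((c = t.b ∧ P = t.top) ∨ (c = t.a ∧ P = t.top + dir θ t.b)) := by
    by_cases hA : t.coordA θ p = 0
    · rw [hA, zero_mul, add_zero] at him
      have hB0' : t.coordB θ p ≠ 0 := fun e => n1 (by rw [him, e]; ring)
      have hB1' : t.coordB θ p ≠ 1 := fun e => n3 (by rw [him, e]; ring)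
      refine ⟨t.top, t.b, t.coordB θ p, ⟨lt_of_le_of_ne hB0 hB0'.symm, lt_of_le_of_ne hB1 hB1'⟩,
        ?_, (t.mem_edges_iff hθ).2 (Or.inr (Or.inl ⟨rfl, rfl⟩)), Or.inl ⟨rfl, rfl⟩⟩
      rw [hA] at hadd
      simpa using hadd
    · have hB : t.coordB θ p = 1 := by
        by_contra hB
        exact hcoord ⟨⟨lt_of_le_of_ne hA0 (Ne.symm hA), hA1⟩, hB0, lt_of_le_of_ne hB1 hB⟩
      rw [hB, one_mul] at him
      have hA1' : t.coordA θ p ≠ 1 := fun e => n4 (by rw [him, e]; ring)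
      refine ⟨t.top + dir θ t.b, t.a, t.coordA θ p, ⟨lt_of_le_of_ne hA0 (Ne.symm hA),
        lt_of_le_of_ne hA1 hA1'⟩, ?_,
        (t.mem_edges_iff hθ).2 (Or.inr (Or.inr (Or.inr ⟨rfl, rfl⟩))), Or.inr ⟨rfl, rfl⟩⟩
      rw [hB] at hadd
      refine Eq.trans ?_ hadd
      push_cast
      ring
  have hseg := t.segment_subset_carrier θ hedge
  have hc : c = w ⟨k, hk⟩ := label_eq_of_right_edge hθ hk hs hσ (hPσ.trans hp) fun τ h0 h1 =>
    h.carrier_subset ht (hseg (mem_segment_add.2 ⟨τ, h0, h1, rfl⟩))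
  have hP : P = vertex θ w k := by
    have hcp := t.coord_of_mem_edges hθ hedge σ
    rw [hPσ] at hcp
    have hright : (0 ≤ t.coordA θ p ∧ t.coordA θ p < 1) ∧
        0 < t.coordB θ p ∧ t.coordB θ p ≤ 1 := by
      rcases hcp with ⟨e1, e2⟩ | ⟨e1, e2⟩ | ⟨e1, e2⟩ | ⟨e1, e2⟩
      · refine absurd ?_ hcoord
        rw [e1, e2]
        exact ⟨⟨hσ.1, hσ.2.le⟩, le_rfl, one_pos⟩
      · rw [e1, e2]
        exact ⟨⟨le_rfl, one_pos⟩, hσ.1, hσ.2.le⟩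
      · refine absurd ?_ hcoord
        rw [e1, e2]
        exact ⟨⟨one_pos, le_rfl⟩, hσ.1.le, hσ.2⟩
      · rw [e1, e2]
        exact ⟨⟨hσ.1.le, hσ.2⟩, one_pos, le_rfl⟩
    -- The edge cannot be a left side, as `p` is off the left path. A second tile on it would extend
    -- beyond the right boundary or overlap `t`. So the edge is a right side, and the height of `p`
    -- identifies it as side `k`.
    rcases h.edge t ht _ hedge with ⟨j, hj, e | e⟩ | ⟨t', ht', hne, he'⟩
    · exfalso
      rw [side_eq θ 1 hj, edge_eq_iff hθ] at e
      refine hpath ⟨j, hj, ?_⟩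
      rw [vertex_succ θ 1 hj, mem_segment_add]
      exact ⟨σ, hσ.1.le, hσ.2.le, by rw [← e.1, ← e.2, hPσ]⟩
    · rw [side_eq θ w hj, edge_eq_iff hθ] at e
      rw [e.1]
      have h1 : y = (vertex θ w j).im + σ * (dir θ (w ⟨j, hj⟩)).im := by
        have := congrArg Complex.im hPσ
        rw [e.1, e.2] at this
        simpa using this.symm
      have hdj := dir_im_neg hθ (w ⟨j, hj⟩)
      have h2 : y < (vertex θ w j).im := by nlinarith [hσ.1]
      have h3 : (vertex θ w (j + 1)).im < y := by
        rw [vertex_succ θ w hj, Complex.add_im]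
        nlinarith [hσ.2]
      rcases lt_trichotomy j k with hjk | hjk | hjk
      · have := vertex_im_le hθ w (Nat.succ_le_of_lt hjk) hk.le
        rw [Nat.succ_eq_add_one] at this
        linarith
      · rw [hjk]
      · have := vertex_im_le hθ w (Nat.succ_le_of_lt hjk) hj.le
        rw [Nat.succ_eq_add_one] at this
        linarith
    · exfalso
      have hcp' := t'.coord_of_mem_edges hθ he' σ
      rw [hPσ] at hcp'
      have hcoord' := h.coord_of_re_eq hθ ht' (p := p) rfl hn
      rcases hcp' with ⟨e1, e2⟩ | ⟨e1, e2⟩ | ⟨e1, e2⟩ | ⟨e1, e2⟩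
      · rw [e1, e2] at hcoord'
        exact hcoord' ⟨⟨hσ.1, hσ.2.le⟩, le_rfl, one_pos⟩
      · refine hne (h.eq_of_coord hθ ht' ht (p := p) ?_ ?_ hright.1 hright.2) <;>
          simp only [e1, e2]
        · exact ⟨le_rfl, one_pos⟩
        · exact ⟨hσ.1, hσ.2.le⟩
      · rw [e1, e2] at hcoord'
        exact hcoord' ⟨⟨one_pos, le_rfl⟩, hσ.1.le, hσ.2⟩
      · refine hne (h.eq_of_coord hθ ht' ht (p := p) ?_ ?_ hright.1 hright.2) <;>
          simp only [e1, e2]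
        · exact ⟨hσ.1.le, hσ.2⟩
        · exact ⟨one_pos, le_rfl⟩
  refine ⟨t, ht, ?_⟩
  rcases hcase with ⟨h1, h2⟩ | ⟨h1, h2⟩
  · exact Or.inl ⟨h1 ▸ hc, h2 ▸ hP⟩
  · exact Or.inr ⟨h1 ▸ hc, h2 ▸ hP⟩

end IsPretiling

theorem Tile.coord_right_corner {n : ℕ} {θ : Fin n → ℝ} (hθ : IsAdmissible θ) (t : Tile n) :
    t.coordA θ (t.top + dir θ t.b) = 0 ∧ t.coordB θ (t.top + dir θ t.b) = 1 := by
  have h1 := t.coordA_apply hθ 0 1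
  have h2 := t.coordB_apply hθ 0 1
  simp only [Complex.ofReal_zero, zero_mul, add_zero, Complex.ofReal_one, one_mul] at h1 h2
  exact ⟨h1, h2⟩

namespace IsPretiling

variable {n : ℕ} {θ : Fin n → ℝ} {w : Equiv.Perm (Fin n)} {T : Finset (Tile n)}

/-- A right corner of a tile on the rightside boundary is not on the leftside boundary. -/
theorem profile_lt_of_right_corner (hθ : IsAdmissible θ) (h : IsPretiling θ w T) {j : ℕ}
    (hn : 0 < n) (hj : j ≤ n) {t : Tile n} (ht : t ∈ T)
    (he : t.top + dir θ t.b = vertex θ w j) :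
    profile θ 1 (vertex θ w j).im < profile θ w (vertex θ w j).im := by
  obtain ⟨h1, h2⟩ := Tile.coord_right_corner hθ t
  obtain ⟨e, he1, he0⟩ := ((t.eventually_sub_mem_inner hθ (z := t.top + dir θ t.b)
    (by rw [h1]; exact ⟨le_rfl, one_pos⟩) (by rw [h2]; exact ⟨one_pos, le_rfl⟩)).and
      self_mem_nhdsWithin).exists
  have he0 : 0 < e := he0
  have h3 := (mem_region_iff hθ w hn).1 (h.carrier_subset ht (t.inner_subset_carrier θ he1))
  rw [he] at h3
  simp only [Complex.sub_re, Complex.sub_im, Complex.ofReal_re, Complex.ofReal_im, sub_zero] at h3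
  rw [← vertex_eq_mk_profile hθ w hn hj]
  linarith [h3.2.2.1]

theorem pos_and_lt_of_profile_lt (hθ : IsAdmissible θ) {j : ℕ} (hn : 0 < n) (hj : j ≤ n)
    (h : profile θ 1 (vertex θ w j).im < profile θ w (vertex θ w j).im) : 0 < j ∧ j < n := by
  constructor
  · rcases Nat.eq_zero_or_pos j with rfl | h0
    · have h1 := vertex_eq_mk_profile hθ w hn hj
      have h2 := vertex_eq_mk_profile hθ 1 hn hj
      rw [vertex_zero] at h1 h2 h
      linarith
    · exact h0
  · rcases Nat.lt_or_eq_of_le hj with h0 | rfl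
    · exact h0
    · have h1 := vertex_eq_mk_profile hθ w hn hj
      have h2 := vertex_eq_mk_profile hθ 1 hn hj
      rw [vertex_last] at h1 h2 h
      linarith

/-- The tile `t` has the side `k` of the rightside boundary as its upper right edge. -/
def IsUpper (θ : Fin n → ℝ) (w : Equiv.Perm (Fin n)) (k : ℕ) (t : Tile n) : Prop :=
  ∃ hk : k < n, t.b = w ⟨k, hk⟩ ∧ t.top = vertex θ w k

/-- The tile `t` has the side `k` of the rightside boundary as its lower right edge. -/
def IsLower (θ : Fin n → ℝ) (w : Equiv.Perm (Fin n)) (k : ℕ) (t : Tile n) : Prop :=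
  ∃ hk : k < n, t.a = w ⟨k, hk⟩ ∧ t.top + dir θ t.b = vertex θ w k

theorem IsUpper.right_corner {k : ℕ} {t : Tile n} (h : IsUpper θ w k t) :
    t.top + dir θ t.b = vertex θ w (k + 1) := by
  obtain ⟨hk, h1, h2⟩ := h
  rw [vertex_succ θ w hk, h1, h2]

theorem exists_tile_below (hθ : IsAdmissible θ) (h : IsPretiling θ w T) {j : ℕ} (hj : j < n)
    (hlt : profile θ 1 (vertex θ w j).im < profile θ w (vertex θ w j).im) :
    ∃ t ∈ T, IsUpper θ w j t ∨ IsLower θ w j t := by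
  have hopen : IsOpen {y | profile θ 1 y < profile θ w y} :=
    isOpen_lt (continuous_profile θ 1) (continuous_profile θ w)
  have ev1 : ∀ᶠ y in nhdsWithin (vertex θ w j).im (Set.Iio (vertex θ w j).im),
      profile θ 1 y < profile θ w y := nhdsWithin_le_nhds (hopen.mem_nhds hlt)
  have ev2 : ∀ᶠ y in nhdsWithin (vertex θ w j).im (Set.Iio (vertex θ w j).im),
      y ∈ Set.Ioo (vertex θ w (j + 1)).im (vertex θ w j).im :=
    Ioo_mem_nhdsLT (vertex_im_lt hθ w (Nat.lt_succ_self j) hj)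
  obtain ⟨y, h1, h2⟩ := (ev1.and ev2).exists
  obtain ⟨t, ht, hc⟩ := h.exists_tile_of_side hθ hj h2 h1
  exact ⟨t, ht, hc.imp (fun e => ⟨hj, e⟩) fun e => ⟨hj, e⟩⟩

theorem exists_tile_above (hθ : IsAdmissible θ) (h : IsPretiling θ w T) {j : ℕ} (hj : j < n)
    (hlt : profile θ 1 (vertex θ w (j + 1)).im < profile θ w (vertex θ w (j + 1)).im) :
    ∃ t ∈ T, IsUpper θ w j t ∨ IsLower θ w j t := by
  have hopen : IsOpen {y | profile θ 1 y < profile θ w y} :=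
    isOpen_lt (continuous_profile θ 1) (continuous_profile θ w)
  have ev1 : ∀ᶠ y in nhdsWithin (vertex θ w (j + 1)).im (Set.Ioi (vertex θ w (j + 1)).im),
      profile θ 1 y < profile θ w y := nhdsWithin_le_nhds (hopen.mem_nhds hlt)
  have ev2 : ∀ᶠ y in nhdsWithin (vertex θ w (j + 1)).im (Set.Ioi (vertex θ w (j + 1)).im),
      y ∈ Set.Ioo (vertex θ w (j + 1)).im (vertex θ w j).im :=
    Ioo_mem_nhdsGT (vertex_im_lt hθ w (Nat.lt_succ_self j) hj)
  obtain ⟨y, h1, h2⟩ := (ev1.and ev2).exists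
  obtain ⟨t, ht, hc⟩ := h.exists_tile_of_side hθ hj h2 h1
  exact ⟨t, ht, hc.imp (fun e => ⟨hj, e⟩) fun e => ⟨hj, e⟩⟩

/-- Walk down the boundary. The right corner of an upper tile lies strictly to the right of the left
path, so the next side again carries a tile. The type must change to lower before the bottom vertex,
where the two paths meet. -/
theorem exists_upper_lower_of_upper (hθ : IsAdmissible θ) (h : IsPretiling θ w T) {k : ℕ}
    {t : Tile n} (ht : t ∈ T) (hu : IsUpper θ w k t) :
    ∃ j, ∃ t ∈ T, ∃ t' ∈ T, IsUpper θ w j t ∧ IsLower θ w (j + 1) t' := by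
  induction hN : n - k generalizing k t with
  | zero =>
    obtain ⟨hk, -⟩ := hu
    omega
  | succ N ih =>
    have hk : k < n := hu.1
    have hlt := h.profile_lt_of_right_corner hθ (by omega) hk ht hu.right_corner
    obtain ⟨-, hk'⟩ := pos_and_lt_of_profile_lt hθ (by omega) hk hlt
    obtain ⟨t', ht', hu' | hl'⟩ := h.exists_tile_below hθ hk' hlt
    · exact ih ht' hu' (by omega)
    · exact ⟨k, t, ht, t', ht', hu, hl'⟩

/-- The same walk upwards, stopped by the top vertex. -/
theorem exists_upper_lower_of_lower (hθ : IsAdmissible θ) (h : IsPretiling θ w T) {k : ℕ}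
    {t : Tile n} (ht : t ∈ T) (hl : IsLower θ w k t) :
    ∃ j, ∃ t ∈ T, ∃ t' ∈ T, IsUpper θ w j t ∧ IsLower θ w (j + 1) t' := by
  induction k generalizing t with
  | zero =>
    obtain ⟨hk, -, h2⟩ := hl
    have := h.profile_lt_of_right_corner hθ (by omega) hk.le ht h2
    exact absurd (pos_and_lt_of_profile_lt hθ (by omega) hk.le this).1 (lt_irrefl _)
  | succ k ih =>
    obtain ⟨hk, -, h2⟩ := id hl
    have hlt := h.profile_lt_of_right_corner hθ (by omega) hk.le ht h2
    obtain ⟨t', ht', hu' | hl'⟩ := h.exists_tile_above hθ (by omega) hlt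
    · exact ⟨k, t', ht', t, ht, hu', hl⟩
    · exact ih ht' hl'

/-- After a descent, the vertex `k + 1` is the right corner of the corner tile, strictly to the
right of the flipped path. -/
theorem exists_profile_lt (hθ : IsAdmissible θ) (hw : w ≠ 1) :
    ∃ j, 0 < j ∧ j < n ∧ profile θ 1 (vertex θ w j).im < profile θ w (vertex θ w j).im := by
  obtain ⟨k, hk, hd⟩ := exists_isDescent hw
  have hn : 0 < n := by omega
  refine ⟨k + 1, by omega, hk, ?_⟩
  have h1 := vertex_im_le hθ w (show k + 1 ≤ n from hk.le) le_rfl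
  have h2 := vertex_im_le hθ w (Nat.zero_le (k + 1)) hk.le
  rw [vertex_last] at h1
  rw [vertex_zero, Complex.zero_im] at h2
  refine lt_of_le_of_lt (profile_one_le hθ (w * simpleRefl k hk) h1 h2) ?_
  rw [← vertex_eq_mk_profile hθ w hn hk.le]
  refine (profile_mul_simpleRefl_le_iff w hk hd hθ (vertex_im_le hθ w (by omega) hk)
    (vertex_im_le hθ w (by omega) hk.le)).2.2 ?_
  have e : (cornerTile θ w k hk hd).top + dir θ (cornerTile θ w k hk hd).b =
      vertex θ w (k + 1) := by
    rw [vertex_add_one θ w hk]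
    rfl
  obtain ⟨h3, h4⟩ := Tile.coord_right_corner hθ (cornerTile θ w k hk hd)
  rw [← e, h3, h4]
  exact ⟨one_pos, one_pos⟩

/-- The upper tile on one side and the lower tile on the next have the same right corner, hence are
equal. Since `a < b` in a tile, its labels form a descent. -/
theorem exists_cornerTile_mem (hθ : IsAdmissible θ) (h : IsPretiling θ w T) (hw : w ≠ 1) :
    ∃ k hk hd, cornerTile θ w k hk hd ∈ T := by
  obtain ⟨j, hj0, hjn, hlt⟩ := exists_profile_lt hθ hw
  obtain ⟨k, t, ht, t', ht', hu, hl⟩ :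
      ∃ j, ∃ t ∈ T, ∃ t' ∈ T, IsUpper θ w j t ∧ IsLower θ w (j + 1) t' := by
    obtain ⟨t, ht, hu | hl⟩ := h.exists_tile_below hθ hjn hlt
    · exact h.exists_upper_lower_of_upper hθ ht hu
    · exact h.exists_upper_lower_of_lower hθ ht hl
  have htt : t = t' := by
    obtain ⟨a1, a2⟩ := Tile.coord_right_corner hθ t
    obtain ⟨b1, b2⟩ := Tile.coord_right_corner hθ t'
    rw [hu.right_corner] at a1 a2
    rw [hl.2.2] at b1 b2
    refine h.eq_of_coord hθ ht ht' (p := vertex θ w (k + 1)) ?_ ?_ ?_ ?_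
    · rw [a1]; exact ⟨le_rfl, one_pos⟩
    · rw [a2]; exact ⟨one_pos, le_rfl⟩
    · rw [b1]; exact ⟨le_rfl, one_pos⟩
    · rw [b2]; exact ⟨one_pos, le_rfl⟩
  subst htt
  obtain ⟨hk, h1, h2⟩ := hu
  obtain ⟨hk', h3, -⟩ := hl
  have hd : IsDescent w k hk' := by
    have := t.lt
    rwa [h1, h3] at this
  refine ⟨k, hk', hd, ?_⟩
  have e : cornerTile θ w k hk' hd = t := by
    exact Tile.ext h2.symm h3.symm h1.symm
  rwa [e]

/-- The flipped region is closed. A point of `t` outside it would give an interior point of `t` in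
the corner tile, and from there a common interior point. -/
theorem carrier_subset_of_ne (hθ : IsAdmissible θ) (h : IsPretiling θ w T) {k : ℕ}
    {hk : k + 1 < n} {hd : IsDescent w k hk} (hc : cornerTile θ w k hk hd ∈ T) {t : Tile n}
    (ht : t ∈ T) (hne : t ≠ cornerTile θ w k hk hd) :
    t.carrier θ ⊆ region θ (w * simpleRefl k hk) := by
  intro p hp
  by_contra hpr
  obtain ⟨q, hq1, hq2⟩ := t.nonempty_inter_inner
    (isClosed_region hθ (w * simpleRefl k hk) (by omega)).isOpen_compl hp hpr
  have hqw := h.carrier_subset ht (t.inner_subset_carrier θ hq2)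
  rw [region_eq_union hθ w hk hd] at hqw
  have hqc := hqw.resolve_left hq1
  obtain ⟨r, hr1, hr2⟩ := (cornerTile θ w k hk hd).nonempty_inter_inner (t.isOpen_inner hθ) hqc hq2
  exact Set.disjoint_left.1 (h.disjoint t ht _ hc hne) hr1 hr2

/-- Both sides end at the right corner of the corner tile, which lies outside the flipped region. -/
theorem not_side_mem_edges (hθ : IsAdmissible θ) {k : ℕ} {hk : k + 1 < n} (hd : IsDescent w k hk)
    {t : Tile n} (ht : t.carrier θ ⊆ region θ (w * simpleRefl k hk)) :
    side θ w k ∉ t.edges θ ∧ side θ w (k + 1) ∉ t.edges θ := by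
  have key : ∀ x y : ℝ, 0 ≤ x → x < 1 → 0 < y → y ≤ 1 →
      (cornerTile θ w k hk hd).top + (x : ℂ) * dir θ (cornerTile θ w k hk hd).a +
        (y : ℂ) * dir θ (cornerTile θ w k hk hd).b ∉ region θ (w * simpleRefl k hk) := by
    intro x y hx0 hx1 hy0 hy1 hc
    have hmem : (cornerTile θ w k hk hd).top + (x : ℂ) * dir θ (cornerTile θ w k hk hd).a +
        (y : ℂ) * dir θ (cornerTile θ w k hk hd).b ∈ (cornerTile θ w k hk hd).carrier θ :=
      ⟨x, ⟨hx0, hx1.le⟩, y, ⟨hy0.le, hy1⟩, rfl⟩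
    have him := cornerTile_im_of_mem w hk hd hθ hmem
    have h1 := (profile_mul_simpleRefl_le_iff w hk hd hθ him.1 him.2).2.2 (by
      rw [Tile.coordA_apply hθ, Tile.coordB_apply hθ]
      exact ⟨hx1, hy0⟩)
    have h2 := ((mem_region_iff hθ _ (by omega)).1 hc).2.2.2
    exact absurd h2 (not_le.2 h1)
  constructor
  · intro he
    rw [side_eq θ w (Nat.lt_of_succ_lt hk)] at he
    refine key 0 1 le_rfl one_pos one_pos le_rfl
      (ht (t.segment_subset_carrier θ he (mem_segment_add.2 ⟨1, zero_le_one, le_rfl, ?_⟩)))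
    simp [cornerTile]
  · intro he
    rw [side_eq θ w hk, vertex_add_one θ w hk] at he
    refine key 0 1 le_rfl one_pos one_pos le_rfl
      (ht (t.segment_subset_carrier θ he (mem_segment_add.2 ⟨0, le_rfl, zero_le_one, ?_⟩)))
    simp [cornerTile]

theorem mem_left_edge (hθ : IsAdmissible θ) {k : ℕ} {hk : k + 1 < n} (hd : IsDescent w k hk)
    {p : ℂ} (hp : p ∈ (cornerTile θ w k hk hd).carrier θ)
    (hr : p ∈ region θ (w * simpleRefl k hk)) :
    p ∈ segment ℝ (vertex θ (w * simpleRefl k hk) k) (vertex θ (w * simpleRefl k hk) (k + 1)) ∨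
    p ∈ segment ℝ (vertex θ (w * simpleRefl k hk) (k + 1))
      (vertex θ (w * simpleRefl k hk) (k + 2)) := by
  have him := cornerTile_im_of_mem w hk hd hθ hp
  have h1 := mt (profile_mul_simpleRefl_le_iff w hk hd hθ him.1 him.2).2.2
    (not_lt.2 ((mem_region_iff hθ _ (by omega)).1 hr).2.2.2)
  have hadd := (cornerTile θ w k hk hd).add_coord hθ p
  rw [Tile.mem_carrier_iff hθ] at hp
  obtain ⟨⟨hA0, hA1⟩, hB0, hB1⟩ := hp
  have hv0 := vertex_mul_simpleRefl θ w hk (j := k) (by omega)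
  have hv1 := vertex_mul_simpleRefl_add_one θ w hk
  have hv2 := vertex_mul_simpleRefl θ w hk (j := k + 2) (by omega)
  rw [hv0, hv1, hv2, vertex_add_two θ w hk, mem_segment_add, mem_segment_add]
  rcases lt_or_eq_of_le hA1 with hA | hA
  · left
    have hB : (cornerTile θ w k hk hd).coordB θ p = 0 := by
      by_contra hB
      exact h1 ⟨hA, lt_of_le_of_ne hB0 (Ne.symm hB)⟩
    rw [hB] at hadd
    refine ⟨_, hA0, hA1, hadd.symm.trans ?_⟩
    simp [cornerTile]
  · right
    rw [hA] at hadd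
    refine ⟨_, hB0, hB1, hadd.symm.trans ?_⟩
    simp [cornerTile]

/-- Two things could fail on removal: the left edges of the corner tile could become uncovered, and
neighbours could lose their partner. The edge-to-edge condition covers those edges by the left path
or another tile, and they become sides of the new right boundary. -/
theorem erase_cornerTile (hθ : IsAdmissible θ) (h : IsPretiling θ w T) {k : ℕ}
    {hk : k + 1 < n} {hd : IsDescent w k hk} (hc : cornerTile θ w k hk hd ∈ T) :
    IsPretiling θ (w * simpleRefl k hk) (T.erase (cornerTile θ w k hk hd)) := by
  have hn : 0 < n := by omega
  have hsub : ∀ t ∈ T.erase (cornerTile θ w k hk hd),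
      t.carrier θ ⊆ region θ (w * simpleRefl k hk) := fun t ht =>
    h.carrier_subset_of_ne hθ hc (Finset.mem_of_mem_erase ht) (Finset.ne_of_mem_erase ht)
  have hv0 := vertex_mul_simpleRefl θ w hk (j := k) (by omega)
  have hv1 := vertex_mul_simpleRefl_add_one θ w hk
  -- A left edge of the corner tile is not a right side of `w`: its label would determine the side,
  -- and the heights of their top ends differ.
  have hside : ∀ i, (i = k ∨ i = k + 1) → ∀ j < n, side θ (w * simpleRefl k hk) i ≠ side θ w j := by
    intro i hi j hj e
    have hlt := vertex_im_lt hθ w (Nat.lt_succ_self k) hk.le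
    have hlt' := vertex_im_lt hθ (w * simpleRefl k hk) (Nat.lt_succ_self k) hk.le
    rw [side_eq θ _ (show i < n by omega), side_eq θ w hj, edge_eq_iff hθ] at e
    obtain ⟨e1, e2⟩ := e
    rcases hi with rfl | rfl
    · rw [mul_simpleRefl_left] at e2
      have hj' : j = i + 1 := (congrArg Fin.val (w.injective e2)).symm
      rw [hv0, hj'] at e1
      rw [Nat.succ_eq_add_one, ← e1] at hlt
      exact lt_irrefl _ hlt
    · rw [mul_simpleRefl_right] at e2
      have hj' : j = k := (congrArg Fin.val (w.injective e2)).symm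
      rw [hj', ← hv0] at e1
      rw [Nat.succ_eq_add_one, e1] at hlt'
      exact lt_irrefl _ hlt'
  have hcover : ∀ i, (i = k ∨ i = k + 1) → ∀ p ∈ segment ℝ (vertex θ (w * simpleRefl k hk) i)
      (vertex θ (w * simpleRefl k hk) (i + 1)),
      p ∈ path θ 1 ∪ ⋃ t ∈ T.erase (cornerTile θ w k hk hd), t.carrier θ := by
    intro i hi p hp
    have hedge : side θ (w * simpleRefl k hk) i ∈ (cornerTile θ w k hk hd).edges θ := by
      rw [edges_cornerTile]
      rcases hi with rfl | rfl <;> simp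
    rcases h.edge _ hc _ hedge with ⟨j, hj, e | e⟩ | ⟨t, ht, hne, he⟩
    · left
      refine ⟨j, hj, ?_⟩
      rcases Sym2.eq_iff.1 e with ⟨e1, e2⟩ | ⟨e1, e2⟩
      · rwa [← e1, ← e2]
      · rwa [← e1, ← e2, segment_symm]
    · exact absurd e (hside i hi j hj)
    · right
      exact Set.mem_biUnion (Finset.mem_coe.2 (Finset.mem_erase.2 ⟨hne, ht⟩))
        (t.segment_subset_carrier θ he hp)
  refine ⟨Set.Subset.antisymm ?_ ?_, fun t ht t' ht' hne =>
    h.disjoint t (Finset.mem_of_mem_erase ht) t' (Finset.mem_of_mem_erase ht') hne, ?_⟩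
  · exact Set.union_subset (path_one_subset_region hθ hn _) (Set.iUnion₂_subset hsub)
  · intro p hp
    have hpw : p ∈ region θ w := by
      rw [region_eq_union hθ w hk hd]
      exact Or.inl hp
    rw [← h.union_eq] at hpw
    rcases hpw with hpw | hpw
    · exact Or.inl hpw
    · obtain ⟨t, ht, hpt⟩ := Set.mem_iUnion₂.1 hpw
      by_cases hne : t = cornerTile θ w k hk hd
      · subst hne
        rcases mem_left_edge hθ hd hpt hp with hs | hs
        · exact hcover k (Or.inl rfl) p hs
        · exact hcover (k + 1) (Or.inr rfl) p hs
      · exact Or.inr (Set.mem_biUnion (Finset.mem_coe.2 (Finset.mem_erase.2 ⟨hne, ht⟩)) hpt)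
  · intro t ht e he
    obtain ⟨hn1, hn2⟩ := not_side_mem_edges hθ hd (hsub t ht)
    rcases h.edge t (Finset.mem_of_mem_erase ht) e he with ⟨j, hj, hs | hs⟩ | ⟨t', ht', hne, he'⟩
    · exact Or.inl ⟨j, hj, Or.inl hs⟩
    · left
      by_cases h1 : j = k
      · exact absurd (by rwa [hs, h1] at he) hn1
      by_cases h2 : j = k + 1
      · exact absurd (by rwa [hs, h2] at he) hn2
      exact ⟨j, hj, Or.inr (by rw [hs, side_mul_simpleRefl θ w hk h1 h2])⟩
    · by_cases hct : t' = cornerTile θ w k hk hd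
      · left
        rw [hct, edges_cornerTile] at he'
        rcases he' with e1 | e1 | e1 | e1
        · exact ⟨k, by omega, Or.inr e1⟩
        · exact absurd (by rwa [e1] at he) hn1
        · exact ⟨k + 1, hk, Or.inr e1⟩
        · rw [Set.mem_singleton_iff] at e1
          exact absurd (by rwa [e1] at he) hn2
      · exact Or.inr ⟨t', Finset.mem_erase.2 ⟨hct, ht'⟩, hne, he'⟩

theorem eq_empty (hθ : IsAdmissible θ) (hn : 0 < n) (h : IsPretiling θ 1 T) : T = ∅ := by
  refine Finset.eq_empty_of_forall_notMem fun t ht => ?_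
  obtain ⟨z, hz⟩ := t.inner_nonempty θ
  have hr := (mem_region_iff hθ 1 hn).1 (h.carrier_subset ht (t.inner_subset_carrier θ hz))
  have hre := le_antisymm hr.2.2.2 hr.2.2.1
  obtain ⟨hA, hB⟩ := (t.mem_inner_iff hθ).1 hz
  exact h.coord_of_re_eq hθ ht hre hn ⟨⟨hA.1, hA.2.le⟩, hB.1.le, hB.2⟩

theorem flipTiling (hθ : IsAdmissible θ) (hn : 0 < n) (h : IsPretiling θ w T) :
    FlipTiling θ w T := by
  induction hN : (inversions w).card generalizing w T with
  | zero =>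
    by_cases hw : w = 1
    · subst hw
      rw [h.eq_empty hθ hn]
      exact .one
    · obtain ⟨k, hk, hd⟩ := exists_isDescent hw
      have := card_inversions_mul_simpleRefl hk w hd
      omega
  | succ N ih =>
    have hw : w ≠ 1 := by
      rintro rfl
      simp [inversions_one] at hN
    obtain ⟨k, hk, hd, hc⟩ := h.exists_cornerTile_mem hθ hw
    have := card_inversions_mul_simpleRefl hk w hd
    have := FlipTiling.step w k hk hd _ (ih (h.erase_cornerTile hθ hc) (by omega))
    rwa [Finset.insert_erase hc] at this

end IsPretiling

/-! ### Corner tiles that occur in all tilings and those that do not. -/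

theorem avoids321_iff {n : ℕ} (w : Equiv.Perm (Fin n)) :
    Avoids321 w ↔ ∀ a b c, (a, b) ∈ inversions w → (b, c) ∈ inversions w → False := by
  simp only [mem_inversions]
  constructor
  · rintro h a b c ⟨h1, h2⟩ ⟨h3, h4⟩
    exact h ⟨w.symm c, w.symm b, w.symm a, h4, h2, by simpa using h1, by simpa using h3⟩
  · rintro h ⟨i, j, k, h1, h2, h3, h4⟩
    exact h (w k) (w j) (w i) ⟨h3, by simpa using h2⟩ ⟨h4, by simpa using h1⟩

/-- A 321 pattern is a chain of two inversions of values, and removing a descent only removes an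
inversion. -/
theorem Avoids321.mul_simpleRefl {n k : ℕ} {hk : k + 1 < n} {w : Equiv.Perm (Fin n)}
    (h : Avoids321 w) (hd : IsDescent w k hk) : Avoids321 (w * simpleRefl k hk) := by
  rw [avoids321_iff] at h ⊢
  rw [inversions_mul_simpleRefl hk w hd]
  exact fun a b c h1 h2 => h a b c (Finset.mem_of_mem_erase h1) (Finset.mem_of_mem_erase h2)

theorem isDescent_mul_simpleRefl_of_ne {n j k : ℕ} (hj : j + 1 < n) (hk : k + 1 < n)
    (w : Equiv.Perm (Fin n)) (h1 : k ≠ j) (h2 : k ≠ j + 1) (h3 : k + 1 ≠ j) :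
    IsDescent (w * simpleRefl j hj) k hk ↔ IsDescent w k hk := by
  unfold IsDescent
  rw [mul_simpleRefl_of_ne w hj (i := ⟨k, by omega⟩) h1 h2,
    mul_simpleRefl_of_ne w hj (i := ⟨k + 1, hk⟩) h3 (by simp only; omega)]

theorem cornerTile_mul_simpleRefl {n j k : ℕ} (θ : Fin n → ℝ) (hj : j + 1 < n) (hk : k + 1 < n)
    (w : Equiv.Perm (Fin n)) (h1 : k ≠ j) (h2 : k ≠ j + 1) (h3 : k + 1 ≠ j)
    (hd : IsDescent w k hk) (hd' : IsDescent (w * simpleRefl j hj) k hk) :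
    cornerTile θ (w * simpleRefl j hj) k hk hd' = cornerTile θ w k hk hd := by
  exact Tile.ext (vertex_mul_simpleRefl θ w hj h2)
    (mul_simpleRefl_of_ne w hj h3 (by simp only; omega)) (mul_simpleRefl_of_ne w hj h1 h2)

/-- For a 321-avoiding permutation, the corner tiles appear in all tilings. -/
theorem FlipTiling.cornerTile_mem {n : ℕ} {θ : Fin n → ℝ} {w : Equiv.Perm (Fin n)}
    {T : Finset (Tile n)} (h : FlipTiling θ w T) (hw : Avoids321 w) {k : ℕ} (hk : k + 1 < n)
    (hd : IsDescent w k hk) : cornerTile θ w k hk hd ∈ T := by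
  induction h with
  | one =>
    have := Fin.lt_def.1 hd
    simp at this
  | step w j hj hdj T h ih =>
    -- The last flip either adds the corner at `k` or occurs at a descent not adjacent to `k`, since
    -- adjacent descents form a 321 pattern. In the second case the corner was already there before
    -- the flip.
    by_cases h1 : k = j
    · subst h1
      exact Finset.mem_insert_self _ _
    by_cases h2 : k = j + 1
    · subst h2
      exact absurd ⟨_, _, _, Fin.lt_def.2 (Nat.lt_succ_self j), Fin.lt_def.2 (Nat.lt_succ_self _),
        hd, hdj⟩ hw
    by_cases h3 : k + 1 = j
    · subst h3
      exact absurd ⟨_, _, _, Fin.lt_def.2 (Nat.lt_succ_self k), Fin.lt_def.2 (Nat.lt_succ_self _),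
        hdj, hd⟩ hw
    have hd' := (isDescent_mul_simpleRefl_of_ne hj hk w h1 h2 h3).2 hd
    have := ih (hw.mul_simpleRefl hdj) hd'
    rw [cornerTile_mul_simpleRefl θ hj hk w h1 h2 h3 hd hd'] at this
    exact Finset.mem_insert_of_mem this

theorem FlipTiling.mem_inversions {n : ℕ} {θ : Fin n → ℝ} {w : Equiv.Perm (Fin n)}
    {T : Finset (Tile n)} (h : FlipTiling θ w T) {t : Tile n} (ht : t ∈ T) :
    (t.a, t.b) ∈ inversions w := by
  induction h with
  | one => simp at ht
  | step w j hj hdj T h ih =>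
    rcases Finset.mem_insert.1 ht with rfl | ht
    · exact mem_inversions_of_isDescent hj w hdj
    · have := ih ht
      rw [inversions_mul_simpleRefl hj w hdj] at this
      exact Finset.mem_of_mem_erase this

theorem exists_flipTiling_step {n : ℕ} {θ : Fin n → ℝ} {w : Equiv.Perm (Fin n)} {k : ℕ}
    (hk : k + 1 < n) (hd : IsDescent w k hk) {t : Tile n} (hne : t ≠ cornerTile θ w k hk hd)
    (h : ∃ T, FlipTiling θ (w * simpleRefl k hk) T ∧ t ∉ T) : ∃ T, FlipTiling θ w T ∧ t ∉ T := by
  obtain ⟨T, hT, ht⟩ := h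
  exact ⟨_, .step w k hk hd T hT, fun hc => (Finset.mem_insert.1 hc).elim hne ht⟩

/-- Once the two labels have been exchanged they are no longer an inversion, so no earlier tile
carries them. The tile with these labels sits at vertex `k`, which is not the top of `t`. -/
theorem exists_flipTiling_notMem_of_eq {n : ℕ} {θ : Fin n → ℝ} {w : Equiv.Perm (Fin n)} {k : ℕ}
    (hk : k + 1 < n) (hd : IsDescent w k hk) {t : Tile n} (ha : t.a = w ⟨k + 1, hk⟩)
    (hb : t.b = w ⟨k, Nat.lt_of_succ_lt hk⟩) (htop : t.top ≠ vertex θ w k) :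
    ∃ T, FlipTiling θ w T ∧ t ∉ T := by
  obtain ⟨T, hT⟩ := exists_flipTiling θ (w * simpleRefl k hk)
  refine exists_flipTiling_step hk hd (fun e => htop (congrArg Tile.top e)) ⟨T, hT, fun ht => ?_⟩
  have := hT.mem_inversions ht
  rw [inversions_mul_simpleRefl hk w hd, ha, hb] at this
  exact Finset.notMem_erase _ _ this

/-- If three consecutive entries of `w` decrease, the corner tile at the last two of them is missing
from some tiling. -/
theorem exists_flipTiling_notMem_upper {n : ℕ} {θ : Fin n → ℝ} (hθ : IsAdmissible θ)
    {w : Equiv.Perm (Fin n)} {i : ℕ} (hi : i + 1 + 1 < n) (hd : IsDescent w (i + 1) hi)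
    (hd0 : IsDescent w i (Nat.lt_of_succ_lt hi)) :
    ∃ T, FlipTiling θ w T ∧ cornerTile θ w (i + 1) hi hd ∉ T := by
  have hi1 : i + 1 < n := Nat.lt_of_succ_lt hi
  have hne01 : w ⟨i, by omega⟩ ≠ w ⟨i + 1, hi1⟩ := ne_of_gt hd0
  have hne12 : w ⟨i + 1, hi1⟩ ≠ w ⟨i + 1 + 1, hi⟩ := ne_of_gt hd
  refine exists_flipTiling_step hi1 hd0 (fun e => hne01 (congrArg Tile.b e).symm) ?_
  -- Write the three entries as `c b a`. Removing tiles along `c b a`, `b c a`, `b a c`, `a b c`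
  -- puts the tile with labels `a`, `b` at vertex `i`, whereas the corner tile has its top at vertex
  -- `i + 1`.
  have e0 : (w * simpleRefl i hi1) ⟨i, by omega⟩ = w ⟨i + 1, hi1⟩ := mul_simpleRefl_left w hi1
  have e1 : (w * simpleRefl i hi1) ⟨i + 1, hi1⟩ = w ⟨i, by omega⟩ := mul_simpleRefl_right w hi1
  have e2 : (w * simpleRefl i hi1) ⟨i + 1 + 1, hi⟩ = w ⟨i + 1 + 1, hi⟩ :=
    mul_simpleRefl_of_ne w hi1 (by simp only; omega) (by simp only; omega)
  have f0 : (w * simpleRefl i hi1 * simpleRefl (i + 1) hi) ⟨i, by omega⟩ = w ⟨i + 1, hi1⟩ := by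
    rw [mul_simpleRefl_of_ne _ hi (by simp only; omega) (by simp only; omega), e0]
  have f1 : (w * simpleRefl i hi1 * simpleRefl (i + 1) hi) ⟨i + 1, hi1⟩ = w ⟨i + 1 + 1, hi⟩ := by
    rw [mul_simpleRefl_left, e2]
  have hd2 : IsDescent (w * simpleRefl i hi1) (i + 1) hi := by
    unfold IsDescent
    rw [e1, e2]
    exact hd.trans hd0
  refine exists_flipTiling_step hi hd2 (fun e => ?_) ?_
  · have := congrArg Tile.b e
    simp only [cornerTile] at this
    rw [e1] at this
    exact hne01 this.symm
  · have hd3 : IsDescent (w * simpleRefl i hi1 * simpleRefl (i + 1) hi) i hi1 := by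
      unfold IsDescent
      rw [f0, f1]
      exact hd
    refine exists_flipTiling_notMem_of_eq hi1 hd3 f1.symm f0.symm ?_
    rw [vertex_mul_simpleRefl _ _ _ (by omega), vertex_mul_simpleRefl _ _ _ (by omega), cornerTile,
      vertex_add_one θ w hi1]
    simpa using dir_ne_zero hθ _

/-- If three consecutive entries of `w` decrease, the corner tile at the first two of them is missing
from some tiling. -/
theorem exists_flipTiling_notMem_lower {n : ℕ} {θ : Fin n → ℝ} (hθ : IsAdmissible θ)
    {w : Equiv.Perm (Fin n)} {i : ℕ} (hi : i + 1 + 1 < n) (hd : IsDescent w (i + 1) hi)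
    (hd0 : IsDescent w i (Nat.lt_of_succ_lt hi)) :
    ∃ T, FlipTiling θ w T ∧ cornerTile θ w i (Nat.lt_of_succ_lt hi) hd0 ∉ T := by
  have hi1 : i + 1 < n := Nat.lt_of_succ_lt hi
  have hne12 : w ⟨i + 1, hi1⟩ ≠ w ⟨i + 1 + 1, hi⟩ := ne_of_gt hd
  refine exists_flipTiling_step hi hd (fun e => hne12 (congrArg Tile.a e)) ?_
  -- The other route is `c b a`, `c a b`, `a c b`, `a b c`. The tile with labels `b`, `c` now starts
  -- one step along `a` below vertex `i`, the top of the corner tile.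
  have e0 : (w * simpleRefl (i + 1) hi) ⟨i, by omega⟩ = w ⟨i, by omega⟩ :=
    mul_simpleRefl_of_ne w hi (by simp only; omega) (by simp only; omega)
  have e1 : (w * simpleRefl (i + 1) hi) ⟨i + 1, hi1⟩ = w ⟨i + 1 + 1, hi⟩ := mul_simpleRefl_left w hi
  have e2 : (w * simpleRefl (i + 1) hi) ⟨i + 1 + 1, hi⟩ = w ⟨i + 1, hi1⟩ :=
    mul_simpleRefl_right w hi
  have f1 : (w * simpleRefl (i + 1) hi * simpleRefl i hi1) ⟨i + 1, hi1⟩ = w ⟨i, by omega⟩ := by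
    rw [mul_simpleRefl_right, e0]
  have f2 : (w * simpleRefl (i + 1) hi * simpleRefl i hi1) ⟨i + 1 + 1, hi⟩ = w ⟨i + 1, hi1⟩ := by
    rw [mul_simpleRefl_of_ne _ hi1 (by simp only; omega) (by simp only; omega), e2]
  have hd2 : IsDescent (w * simpleRefl (i + 1) hi) i hi1 := by
    unfold IsDescent
    rw [e0, e1]
    exact hd.trans hd0
  refine exists_flipTiling_step hi1 hd2 (fun e => ?_) ?_
  · have := congrArg Tile.a e
    simp only [cornerTile] at this
    rw [e1] at this
    exact hne12 this
  · have hd3 : IsDescent (w * simpleRefl (i + 1) hi * simpleRefl i hi1) (i + 1) hi := by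
      unfold IsDescent
      rw [f1, f2]
      exact hd0
    refine exists_flipTiling_notMem_of_eq hi hd3 f2.symm f1.symm ?_
    rw [vertex_mul_simpleRefl_add_one, vertex_mul_simpleRefl _ _ _ (by omega), cornerTile]
    simpa using dir_ne_zero hθ _

/-- A corner tile is missing from some tiling if a larger entry precedes its two labels. -/
theorem exists_flipTiling_notMem_of_lt {n : ℕ} {θ : Fin n → ℝ} (hθ : IsAdmissible θ)
    {w : Equiv.Perm (Fin n)} {j : ℕ} (hj : j + 1 < n) (hd : IsDescent w j hj) {i : Fin n}
    (hij : (i : ℕ) < j) (hlt : w ⟨j, Nat.lt_of_succ_lt hj⟩ < w i) :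
    ∃ T, FlipTiling θ w T ∧ cornerTile θ w j hj hd ∉ T := by
  obtain ⟨i, hi⟩ := i
  simp only at hij
  obtain ⟨d, hd'⟩ : ∃ d, j = i + d + 1 := ⟨j - i - 1, by omega⟩
  induction d generalizing w i with
  | zero =>
    subst hd'
    exact exists_flipTiling_notMem_upper hθ hj hd hlt
  | succ d ih =>
    have hi1 : i + 1 < n := by omega
    by_cases hc : w ⟨j, Nat.lt_of_succ_lt hj⟩ < w ⟨i + 1, hi1⟩
    · exact ih hd (i + 1) hi1 (by omega) hc (by omega)
    -- The next entry is at most the label `w j`, so the large entry at `i` can be flipped past it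
    -- without touching the corner.
    · have hdi : IsDescent w i hi1 := lt_of_le_of_lt (not_lt.1 hc) hlt
      have hdj := (isDescent_mul_simpleRefl_of_ne hi1 hj w (by omega) (by omega) (by omega)).2 hd
      have hk := ih hdj (i + 1) hi1 (by omega) (by
        rwa [mul_simpleRefl_right, mul_simpleRefl_of_ne w hi1 (by simp only; omega)
          (by simp only; omega)]) (by omega)
      rw [cornerTile_mul_simpleRefl θ hi1 hj w (by omega) (by omega) (by omega) hd] at hk
      refine exists_flipTiling_step hi1 hdi (fun e => ?_) hk
      have := congrArg Fin.val (w.injective (congrArg Tile.b e))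
      simp only at this
      omega

/-- A corner tile is missing from some tiling if a smaller entry follows its two labels. -/
theorem exists_flipTiling_notMem_of_gt {n : ℕ} {θ : Fin n → ℝ} (hθ : IsAdmissible θ)
    {w : Equiv.Perm (Fin n)} {j : ℕ} (hj : j + 1 < n) (hd : IsDescent w j hj) {l : Fin n}
    (hjl : j + 1 < l) (hlt : w l < w ⟨j + 1, hj⟩) :
    ∃ T, FlipTiling θ w T ∧ cornerTile θ w j hj hd ∉ T := by
  obtain ⟨l, hl⟩ := l
  simp only at hjl
  obtain ⟨d, rfl⟩ : ∃ d, l = j + 2 + d := ⟨l - j - 2, by omega⟩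
  induction d generalizing w with
  | zero => exact exists_flipTiling_notMem_lower hθ hl hlt hd
  | succ d ih =>
    have hl1 : j + 2 + d + 1 < n := hl
    by_cases hc : w ⟨j + 2 + d, by omega⟩ < w ⟨j + 1, hj⟩
    · exact ih hd (by omega) (by omega) hc
    -- Symmetrically, the small entry is flipped one place to the left, towards the corner.
    · have hdl : IsDescent w (j + 2 + d) hl1 := lt_of_lt_of_le hlt (not_lt.1 hc)
      have hd' := (isDescent_mul_simpleRefl_of_ne hl1 hj w (by omega) (by omega) (by omega)).2 hd
      have hk := ih hd' (by omega) (by omega) (by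
        rwa [mul_simpleRefl_left, mul_simpleRefl_of_ne w hl1 (by simp only; omega)
          (by simp only; omega)])
      rw [cornerTile_mul_simpleRefl θ hl1 hj w (by omega) (by omega) (by omega) hd] at hk
      refine exists_flipTiling_step hl1 hdl (fun e => ?_) hk
      have := congrArg Fin.val (w.injective (congrArg Tile.b e))
      simp only at this
      omega

/-! ### Counting forced right-perimeter tiles. -/

section Forced

variable {n : ℕ} {θ : Fin n → ℝ} {w : Equiv.Perm (Fin n)}

/-- Full support makes every flip tiling a genuine tiling, so being forced is not a vacuous
condition and can be tested on flip tilings. -/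
theorem IsForcedRightPerimeterTile.mem (hθ : IsAdmissible θ) (hn : 2 ≤ n) {t : Tile n}
    (h : IsForcedRightPerimeterTile θ w t) (hw : IsFullySupported w) {T : Finset (Tile n)}
    (hT : FlipTiling θ w T) : t ∈ T :=
  (h T (hT.isRhombicTiling hθ hn hw)).1

/-- Two consecutive boundary sides could also be the left edges of a tile, but then the smaller
label would come first in `w`, while the labels of a tile of a flip tiling form an inversion of `w`.
-/
theorem IsForcedRightPerimeterTile.exists_eq_cornerTile (hθ : IsAdmissible θ) (hn : 2 ≤ n)
    {t : Tile n} (h : IsForcedRightPerimeterTile θ w t) (hw : IsFullySupported w) :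
    ∃ k hk hd, t = cornerTile θ w k hk hd := by
  obtain ⟨T, hT⟩ := exists_flipTiling θ w
  obtain ⟨ht, k, hk, h1, h2⟩ := h T (hT.isRhombicTiling hθ hn hw)
  have hinv := (mem_inversions.1 (hT.mem_inversions ht)).2
  rw [side_eq θ w (Nat.lt_of_succ_lt hk), t.mem_edges_iff hθ] at h1
  rw [side_eq θ w hk, t.mem_edges_iff hθ, vertex_add_one θ w hk] at h2
  have hlab1 : w ⟨k, by omega⟩ = t.a ∨ w ⟨k, by omega⟩ = t.b := by tauto
  have hlab2 : w ⟨k + 1, hk⟩ = t.a ∨ w ⟨k + 1, hk⟩ = t.b := by tauto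
  have hne : w ⟨k, by omega⟩ ≠ w ⟨k + 1, hk⟩ := fun e => by
    have := congrArg Fin.val (w.injective e)
    simp at this
  have hb : w ⟨k, by omega⟩ = t.b := by
    refine hlab1.resolve_left fun e => ?_
    have e' : w ⟨k + 1, hk⟩ = t.b := hlab2.resolve_left fun e' => hne (e.trans e'.symm)
    rw [← e, ← e', Equiv.symm_apply_apply, Equiv.symm_apply_apply, Fin.lt_def] at hinv
    simp at hinv
  have ha : w ⟨k + 1, hk⟩ = t.a := hlab2.resolve_right fun e => hne (hb.trans e.symm)
  have hab : t.a ≠ t.b := t.lt.ne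
  rw [hb] at h1 h2
  rw [ha] at h2
  simp only [hab, hab.symm, and_false, and_true, false_or, or_false] at h1 h2
  have htop : t.top = vertex θ w k := by
    rcases h1 with h1 | h1
    · exact h1.symm
    · exfalso
      have i1 := dir_im_neg hθ t.a
      have i2 := dir_im_neg hθ t.b
      rw [h1] at h2
      rcases h2 with h2 | h2 <;>
      · have := congrArg Complex.im h2
        simp only [Complex.add_im] at this
        linarith
  have hd : IsDescent w k hk := by
    unfold IsDescent
    rw [ha, hb]
    exact t.lt
  exact ⟨k, hk, hd, Tile.ext htop ha.symm hb.symm⟩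

theorem isForcedRightPerimeterTile_cornerTile (hθ : IsAdmissible θ) (hw : Avoids321 w) {k : ℕ}
    (hk : k + 1 < n) (hd : IsDescent w k hk) :
    IsForcedRightPerimeterTile θ w (cornerTile θ w k hk hd) := by
  intro T hT
  refine ⟨((hT.isPretiling hθ (by omega)).flipTiling hθ (by omega)).cornerTile_mem hw hk hd,
    k, hk, ?_, ?_⟩ <;>
  · rw [edges_cornerTile]
    simp

theorem encard_forced_of_isAlternating {m : ℕ} {θ : Fin (2 * m) → ℝ} (hθ : IsAdmissible θ)
    (hm : 1 ≤ m) {w : Equiv.Perm (Fin (2 * m))} (hw : IsFullySupported w) (h1 : Avoids321 w)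
    (h2 : IsAlternating w) :
    {t : Tile (2 * m) | IsForcedRightPerimeterTile θ w t}.encard = (m : ℕ∞) := by
  have hd : ∀ i : Fin m, IsDescent w (2 * i) (by omega) := fun i =>
    (h2 (2 * i) (by omega)).1 (even_two_mul _)
  let f : Fin m → Tile (2 * m) := fun i => cornerTile θ w (2 * i) (by omega) (hd i)
  have hf : Function.Injective f := by
    intro i j e
    have := congrArg Fin.val (w.injective (congrArg Tile.b e))
    simp only at this
    exact Fin.ext (by omega)
  have hset : {t : Tile (2 * m) | IsForcedRightPerimeterTile θ w t} = Set.range f := by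
    ext t
    constructor
    · intro ht
      obtain ⟨k, hk, hdk, rfl⟩ :=
        IsForcedRightPerimeterTile.exists_eq_cornerTile hθ (by omega) ht hw
      rcases Nat.even_or_odd' k with ⟨i, rfl | rfl⟩
      · exact ⟨⟨i, by omega⟩, rfl⟩
      · have := (h2 (2 * i + 1) hk).2 (odd_two_mul_add_one i)
        exact absurd hdk (not_lt.2 this.le)
    · rintro ⟨i, rfl⟩
      exact isForcedRightPerimeterTile_cornerTile hθ h1 _ (hd i)
  rw [hset, ← Set.image_univ, hf.encard_image, Set.encard_univ]
  simp

/-- Each pair `2 * i`, `2 * i + 1` contains at most one element of `K`, hence exactly one. In the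
last pair it is the even one by the bound, and descending, each odd choice is blocked by the even
element of the following pair. -/
theorem two_mul_mem_of_card_le {m : ℕ} {K : Finset ℕ} (hlt : ∀ k ∈ K, k + 1 < 2 * m)
    (hadj : ∀ k ∈ K, k + 1 ∉ K) (hcard : m ≤ K.card) : ∀ i < m, 2 * i ∈ K := by
  have himage : K.image (fun k => k / 2) = Finset.range m := by
    refine Finset.eq_of_subset_of_card_le (fun x hx => ?_) ?_
    · obtain ⟨k, hk, rfl⟩ := Finset.mem_image.1 hx
      have := hlt k hk
      exact Finset.mem_range.2 (by omega)
    · rw [Finset.card_range, Finset.card_image_of_injOn]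
      · exact hcard
      · intro a ha b hb e
        simp only at e
        by_contra hne
        rcases Nat.lt_or_gt_of_ne hne with h | h
        · exact hadj a ha (by rwa [show a + 1 = b by omega])
        · exact hadj b hb (by rwa [show b + 1 = a by omega])
  have hpair : ∀ i < m, 2 * i ∈ K ∨ 2 * i + 1 ∈ K := by
    intro i hi
    rw [← Finset.mem_range, ← himage] at hi
    obtain ⟨k, hk, rfl⟩ := Finset.mem_image.1 hi
    rcases Nat.mod_two_eq_zero_or_one k with h | h
    · exact Or.inl (by rwa [show 2 * (k / 2) = k by omega])
    · exact Or.inr (by rwa [show 2 * (k / 2) + 1 = k by omega])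
  have key : ∀ d < m, 2 * (m - 1 - d) ∈ K := by
    intro d
    induction d with
    | zero =>
      intro hd
      refine (hpair (m - 1 - 0) (by omega)).resolve_right fun h => ?_
      have := hlt _ h
      omega
    | succ d ih =>
      intro hd
      refine (hpair (m - 1 - (d + 1)) (by omega)).resolve_right fun h => hadj _ h ?_
      rw [show 2 * (m - 1 - (d + 1)) + 1 + 1 = 2 * (m - 1 - d) by omega]
      exact ih (by omega)
  intro i hi
  have := key (m - 1 - i) (by omega)
  rwa [show m - 1 - (m - 1 - i) = i by omega] at this

theorem avoids321_and_isAlternating_of_encard_forced {m : ℕ} {θ : Fin (2 * m) → ℝ}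
    (hθ : IsAdmissible θ) (hm : 1 ≤ m) {w : Equiv.Perm (Fin (2 * m))} (hw : IsFullySupported w)
    (h : {t : Tile (2 * m) | IsForcedRightPerimeterTile θ w t}.encard = (m : ℕ∞)) :
    Avoids321 w ∧ IsAlternating w := by
  classical
  have hn : 2 ≤ 2 * m := by omega
  have hleft : ∀ k hk hd, IsForcedRightPerimeterTile θ w (cornerTile θ w k hk hd) →
      ∀ i : Fin (2 * m), (i : ℕ) < k → w i ≤ w ⟨k, Nat.lt_of_succ_lt hk⟩ := by
    intro k hk hd hf i hi
    by_contra! hc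
    obtain ⟨T, hT, hnot⟩ := exists_flipTiling_notMem_of_lt hθ hk hd hi hc
    exact hnot (hf.mem hθ hn hw hT)
  have hright : ∀ k hk hd, IsForcedRightPerimeterTile θ w (cornerTile θ w k hk hd) →
      ∀ l : Fin (2 * m), k + 1 < (l : ℕ) → w ⟨k + 1, hk⟩ ≤ w l := by
    intro k hk hd hf i hi
    by_contra! hc
    obtain ⟨T, hT, hnot⟩ := exists_flipTiling_notMem_of_gt hθ hk hd hi hc
    exact hnot (hf.mem hθ hn hw hT)
  let P : ℕ → Prop := fun k => ∃ hk hd, IsForcedRightPerimeterTile θ w (cornerTile θ w k hk hd)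
  let K : Finset ℕ := (Finset.range (2 * m)).filter P
  have hK : ∀ k, k ∈ K ↔ P k := by
    intro k
    refine ⟨fun hk => (Finset.mem_filter.1 hk).2, fun hk => Finset.mem_filter.2 ⟨?_, hk⟩⟩
    obtain ⟨hk, -⟩ := hk
    exact Finset.mem_range.2 (by omega)
  have hcard : m ≤ K.card := by
    have hcorner : ∀ t : {t : Tile (2 * m) | IsForcedRightPerimeterTile θ w t},
        ∃ k ∈ K, ∃ hk hd, t.1 = cornerTile θ w k hk hd := by
      rintro ⟨t, ht⟩
      obtain ⟨k, hk, hd, rfl⟩ := IsForcedRightPerimeterTile.exists_eq_cornerTile hθ hn ht hw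
      exact ⟨k, (hK k).2 ⟨hk, hd, ht⟩, hk, hd, rfl⟩
    choose f hfK hfk hfd hf using hcorner
    have hinj : Function.Injective fun t => (⟨f t, hfK t⟩ : (K : Set ℕ)) := by
      intro t t' e
      have e' : f t = f t' := congrArg Subtype.val e
      apply Subtype.ext
      rw [hf t, hf t']
      congr 1
    have := Function.Embedding.encard_le ⟨_, hinj⟩
    rw [h, Set.encard_coe_eq_coe_finsetCard] at this
    exact_mod_cast this
  have hall : ∀ i < m, P (2 * i) := by
    intro i hi
    refine (hK _).1 (two_mul_mem_of_card_le (fun k hk => ?_) (fun k hk hk' => ?_) hcard i hi)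
    · obtain ⟨hk, -⟩ := (hK k).1 hk
      exact hk
    · obtain ⟨h1, h2, h3⟩ := (hK k).1 hk
      obtain ⟨h4, h5, h6⟩ := (hK _).1 hk'
      -- A forced corner at `k + 1` has no larger entry before it, but a descent at `k` provides
      -- one.
      exact absurd (hleft _ h4 h5 h6 ⟨k, by omega⟩ (Nat.lt_succ_self k)) (not_le.2 h2)
  have hav : Avoids321 w := by
    rintro ⟨i, j, l, hij, hjl, h1, h2⟩
    rw [Fin.lt_def] at hij hjl
    obtain ⟨j, hj⟩ := j
    -- The middle entry of a 321 pattern belongs to some forced corner. If it is the peak, a larger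
    -- entry precedes it; if it is the valley, a smaller one follows. Both are excluded.
    rcases Nat.even_or_odd' j with ⟨k, rfl | rfl⟩
    · obtain ⟨hk, hd, hf⟩ := hall k (by omega)
      exact absurd (hleft _ hk hd hf i hij) (not_le.2 h2)
    · obtain ⟨hk, hd, hf⟩ := hall k (by omega)
      exact absurd (hright _ hk hd hf l hjl) (not_le.2 h1)
  refine ⟨hav, fun i hi => ⟨?_, ?_⟩⟩
  · rintro ⟨k, rfl⟩
    obtain ⟨hk, hd, -⟩ := hall k (by omega)
    have e : 2 * k = k + k := two_mul k
    generalize 2 * k = i at *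
    subst e
    exact hd
  · rintro ⟨k, rfl⟩
    obtain ⟨hk, hd, -⟩ := hall k (by omega)
    -- A second descent right after the forced one would form a 321 pattern.
    by_contra hc
    have hne : w ⟨2 * k + 1, by omega⟩ ≠ w ⟨2 * k + 1 + 1, hi⟩ := fun e => by
      have := congrArg Fin.val (w.injective e)
      simp at this
    exact hav ⟨⟨2 * k, by omega⟩, ⟨2 * k + 1, hk⟩, ⟨2 * k + 1 + 1, hi⟩,
      Fin.lt_def.2 (Nat.lt_succ_self _), Fin.lt_def.2 (Nat.lt_succ_self _),
      lt_of_le_of_ne (not_lt.1 hc) hne.symm, hd⟩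

end Forced

end Elnitsky

theorem theorem5 (m : ℕ) (hm : 1 ≤ m) :
    Set.BijOn (Elnitsky.phi m)
      {v : Equiv.Perm (Fin (2 * m - 2)) | Elnitsky.Avoids321 v ∧ Elnitsky.IsAlternating v}
      {w : Equiv.Perm (Fin (2 * m)) |
        Elnitsky.IsFullySupported w ∧ Elnitsky.Avoids321 w ∧ Elnitsky.IsAlternating w} ∧
    (∀ θ : Fin (2 * m) → ℝ, Elnitsky.IsAdmissible θ →
      {w : Equiv.Perm (Fin (2 * m)) | Elnitsky.IsFullySupported w ∧
          {t : Elnitsky.Tile (2 * m) |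
            Elnitsky.IsForcedRightPerimeterTile θ w t}.encard = (m : ℕ∞)} =
        {w : Equiv.Perm (Fin (2 * m)) |
          Elnitsky.IsFullySupported w ∧ Elnitsky.Avoids321 w ∧ Elnitsky.IsAlternating w} ∧
      {w : Equiv.Perm (Fin (2 * m)) | Elnitsky.IsFullySupported w ∧
          {t : Elnitsky.Tile (2 * m) |
            Elnitsky.IsForcedRightPerimeterTile θ w t}.encard = (m : ℕ∞)}.ncard =
        catalan (m - 1)) ∧
    {w : Equiv.Perm (Fin (2 * m)) |
        Elnitsky.IsFullySupported w ∧ Elnitsky.Avoids321 w ∧ Elnitsky.IsAlternating w}.ncard =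
      catalan (m - 1) := by
  have hcount := Elnitsky.ncard_isFullySupported_avoids321_isAlternating m hm
  refine ⟨Elnitsky.bijOn_phi m hm, fun θ hθ => ?_, hcount⟩
  have hset : {w : Equiv.Perm (Fin (2 * m)) | Elnitsky.IsFullySupported w ∧
      {t : Elnitsky.Tile (2 * m) |
        Elnitsky.IsForcedRightPerimeterTile θ w t}.encard = (m : ℕ∞)} =
      {w : Equiv.Perm (Fin (2 * m)) |
        Elnitsky.IsFullySupported w ∧ Elnitsky.Avoids321 w ∧ Elnitsky.IsAlternating w} := by
    ext w
    exact and_congr_right fun hw =>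
      ⟨Elnitsky.avoids321_and_isAlternating_of_encard_forced hθ hm hw,
        fun h => Elnitsky.encard_forced_of_isAlternating hθ hm hw h.1 h.2⟩
  exact ⟨hset, by rw [hset, hcount]⟩
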